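/- Notation. Let $\mathbb T=\mathbb R/\mathbb Z$. For an irrational $\alpha$ let $(q_n)_{n\ge 0}$ be the denominators of its continued fraction convergents, and for $g:\mathbb T\to\mathbb R$ put $S_n(g)(x)=\sum_{i<n}g(x+i\alpha)$. Say that a continuous $g:\mathbb T\to\mathbb R$ is *good for $\alpha$* if (i) $\sup_{x\in\mathbb T}|S_{q_n}(g)(x)|=o\big(q_{n+1}^{-4/5}\big)$ as $n\to\infty$, and (ii) for all $r\in\mathbb R\setminus\{0\}$ and $\beta\in\mathbb R$ there is no measurable $\psi:\mathbb T\to\mathbb R$ with $r g(x)\equiv\psi(x+\alpha)-\psi(x)+\beta \pmod 1$ for almost every $x$. For a continuous $f:\mathbb T\to(0,\infty)$ let $X_f$ be the (compact metrizable) quotient of $\mathbb T\times\mathbb R$ by the equivalence relation generated by $(x,y)\sim(x+\alpha,y-f(x))$, let $\mu$ be the normalized Lebesgue measure on $X_f$ (the image of Lebesgue measure on $\{(x,y):0\le y<f(x)\}$ divided by its total mass), and let $T_t[(x,y)]=[(x,y+t)]$ be the special flow over the rotation by $\alpha$ under the roof $f$. Theorem. (1) Let $\alpha$ be irrational, let $g$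 be good for $\alpha$, let $C>-\min_{x\in\mathbb T} g(x)$, and consider the special flow under the roof $f=g+C$. Then its time-$C$ map $T=T_C$ on $X_{g+C}$ satisfies: - $T$ preserves $\mu$ and is weakly mixing: $\frac1n\sum_{i<n}|\mu(T^{-i}A\cap B)-\mu(A)\mu(B)|\to0$ for all Borel sets $A,B$; - $T$ is uniquely ergodic: it has exactly one invariant Borel probability measure (namely $\mu$); - every square orbit is equidistributed: $\lim_{N\to\infty}\frac1N\sum_{i<N}h(T^{i^2}z)=\int h\,d\mu$ for every $z\in X_{g+C}$ and every continuous $h:X_{g+C}\to\mathbb R$. (2) Such functions exist: there are an irrational $\alpha$ and real numbers $(a_n)$ such that $|a_n|=o\big(q_n^{-1}q_{n+1}^{-4/5}\big)$, $|a_n|\ge q_n^{-4/5}q_{n+1}^{-1}$ for infinitely many $n$, and $g(x)=\sum_{k\ge1}a_k\cos(2\pi q_k x)$ is continuous and good for $\alpha$. -/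

import Mathlib

open MeasureTheory Filter Topology Asymptotics

namespace SpecialFlow

/-! ### Topological and measure-theoretic dynamics -/

/-- `μ` is a `T`-invariant Borel probability measure. -/
structure IsInvariantProb {X : Type*} [MeasurableSpace X] (T : X → X) (μ : Measure X) : Prop where
  isProbabilityMeasure : IsProbabilityMeasure μ
  measurePreserving : MeasurePreserving T μ μ

/-- `T` admits exactly one invariant Borel probability measure. -/
def UniquelyErgodic {X : Type*} [MeasurableSpace X] (T : X → X) : Prop :=
  ∃! μ : Measure X, IsInvariantProb T μ

/-- The measure-preserving system `(X, μ, T)` is weakly mixing: `μ` is a `T`-invariant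
probability measure and `n⁻¹ ∑_{i < n} |μ(T⁻ⁱA ∩ B) - μ(A) μ(B)| → 0` for all measurable `A`, `B`. -/
structure WeaklyMixing {X : Type*} [MeasurableSpace X] (T : X → X) (μ : Measure X) : Prop where
  invariant : IsInvariantProb T μ
  tendsto : ∀ A B : Set X, MeasurableSet A → MeasurableSet B →
    Tendsto (fun n : ℕ => (1 / (n : ℝ)) *
      ∑ i ∈ Finset.range n, |μ.real ((T^[i]) ⁻¹' A ∩ B) - μ.real A * μ.real B|) atTop (𝓝 0)

/-- The square orbit `(T^{i²} x)_{i ≥ 0}` is equidistributed with respect to `μ`. -/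
def SquareOrbitEquidistributed {X : Type*} [TopologicalSpace X] [MeasurableSpace X]
    (T : X → X) (μ : Measure X) (x : X) : Prop :=
  ∀ h : C(X, ℝ), Tendsto (fun N : ℕ => (1 / (N : ℝ)) * ∑ i ∈ Finset.range N, h (T^[i ^ 2] x))
    atTop (𝓝 (∫ z, h z ∂μ))

/-! ### The special flow over the rotation by `α` on `𝕋 = ℝ/ℤ` under a roof function `f` -/

/-- The relation `(x, y) ∼ (x + α, y - f x)` on `𝕋 × ℝ` (not yet closed to an equivalence). -/
def Rel (α : ℝ) (f : UnitAddCircle → ℝ) (p q : UnitAddCircle × ℝ) : Prop :=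
  q = (p.1 + (α : UnitAddCircle), p.2 - f p.1)

/-- The space `X_f`: the quotient of `𝕋 × ℝ` by the equivalence relation generated by
`(x, y) ∼ (x + α, y - f x)`. -/
def Space (α : ℝ) (f : UnitAddCircle → ℝ) : Type := Quot (Rel α f)

/-- The quotient topology (for continuous `f > 0`, this is the topology of the metric on `X_f`). -/
instance (α : ℝ) (f : UnitAddCircle → ℝ) : TopologicalSpace (Space α f) :=
  inferInstanceAs (TopologicalSpace (Quot (Rel α f)))

/-- The Borel σ-algebra of the quotient topology. -/
instance (α : ℝ) (f : UnitAddCircle → ℝ) : MeasurableSpace (Space α f) := borel _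

instance (α : ℝ) (f : UnitAddCircle → ℝ) : BorelSpace (Space α f) := ⟨rfl⟩

/-- The projection `(x, y) ↦ [(x, y)]`. -/
def mk (α : ℝ) (f : UnitAddCircle → ℝ) (p : UnitAddCircle × ℝ) : Space α f := Quot.mk _ p

/-- The flow `T_t [(x, y)] = [(x, y + t)]`. -/
def flow (α : ℝ) (f : UnitAddCircle → ℝ) (t : ℝ) : Space α f → Space α f :=
  Quot.map (fun p => (p.1, p.2 + t)) (by
    rintro p q rfl
    simp only [Rel, Prod.mk.injEq, true_and]
    ring)

/-- The fundamental domain `{(x, y) : 0 ≤ y < f x}` of the quotient. -/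
def fundDomain (f : UnitAddCircle → ℝ) : Set (UnitAddCircle × ℝ) :=
  {p | 0 ≤ p.2 ∧ p.2 < f p.1}

/-- Normalized Lebesgue measure on `X_f`: the image under the projection of Lebesgue measure on
the fundamental domain, divided by its total mass. -/
noncomputable def lebesgue (α : ℝ) (f : UnitAddCircle → ℝ) : Measure (Space α f) :=
  (volume (fundDomain f))⁻¹ • (volume.restrict (fundDomain f)).map (mk α f)

/-! ### The class of roof functions -/

/-- `q_n`, the denominator (in lowest terms) of the `n`-th continued fraction convergent of `α`,
with `q_0 = 1`. -/
noncomputable def convDen (α : ℝ) (n : ℕ) : ℕ := (Real.convergent α n).den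

/-- `S_n(g)(x) = g(x) + g(x + α) + ⋯ + g(x + (n - 1)α)`. -/
noncomputable def ergodicSum (α : ℝ) (g : UnitAddCircle → ℝ) (n : ℕ) (x : UnitAddCircle) : ℝ :=
  ∑ i ∈ Finset.range n, g (x + i • (α : UnitAddCircle))

/-- The two properties of a continuous function `g` on the circle: its ergodic sums at the times
`q_n` are uniformly `o(q_{n+1}^{-4/5})`, and for real `r ≠ 0` and `β` the equation
`r g(x) = ψ(x + α) - ψ(x) + β (mod 1)` for almost every `x` has no measurable solution `ψ`. -/
structure GoodRoof (α : ℝ) (g : C(UnitAddCircle, ℝ)) : Prop where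
  rigid : (fun n : ℕ => ⨆ x : UnitAddCircle, |ergodicSum α g (convDen α n) x|)
    =o[atTop] fun n : ℕ => (convDen α (n + 1) : ℝ) ^ (-(4 / 5) : ℝ)
  no_solution : ∀ r : ℝ, r ≠ 0 → ∀ β : ℝ, ¬ ∃ ψ : UnitAddCircle → ℝ, Measurable ψ ∧
    ∀ᵐ x : UnitAddCircle, ((r * g x : ℝ) : UnitAddCircle) =
      ((ψ (x + (α : UnitAddCircle)) - ψ x + β : ℝ) : UnitAddCircle)

end SpecialFlow

/-! Since S_n(g+C) = S_n(g) + nC, the n-th iterate of the time-C map T sends [(x, y)] to [(x + nα, y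
− S_n(g)(x))] (`flow_iterate_mk`). By the rigidity condition, T^{q_n} moves points by at most
1/q_{n+1} horizontally and o(q_{n+1}^{-4/5}) vertically, so T^{k q_n} is uniformly close to the
identity for all k = O(q_{n+1}^{4/5}) (`eventually_abs_iterate_mul_sub_le`).

Squares. Let q_{m+1}^{4/5} ≤ N < q_{m+2}^{4/5} and put q = q_{m+1}, p = q_m. For the exponents that
occur, h(T^k w) depends, up to ε, only on k mod q. The resulting function on ℤ/q changes little when
k is replaced by k + sp with s < q^{4/5}, by rigidity at time p. As p is invertible mod q, the
variable t = p⁻¹k turns it into a slowly varying function, sampled along a quadratic sequence with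
unit leading coefficient. In blocks of length about q^{3/4} such a sequence is equidistributed at
scale q^{4/5}: Parseval and van der Corput differencing bound its variance
(`abs_sum_quadratic_sub_le`). The mean over ℤ/q is a Birkhoff average of length q, which is close to
∫ h dμ uniformly in the starting point by unique ergodicity.

Weak mixing. Lift an eigenfunction of T to 𝕋 × ℝ and expand it along the fibres. Each Fourier
coefficient φ satisfies φ(x + α) = e(s(g(x) + C)) φ(x). Then |φ| is constant, and if φ ≠ 0 its
argument solves the cohomological equation, which is excluded for s ≠ 0. Hence eigenfunctions are
constant. That this implies weak mixing is proved with a compact operator commuting with the Koopman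
operator (`tendsto_avg_sq_inner_iterate`).

Unique ergodicity. The flow averages over times q_n C converge at every point, so averaging any
T-invariant ν over t ∈ (0, C] gives Cμ. The averages over shorter intervals (0, δ] are therefore
absolutely continuous with respect to μ, hence multiples of μ by ergodicity of T, and δ → 0 yields ν
= μ.

Existence. Take α Liouville and a_k = q_k^{-1} q_{k+1}^{-9/10}. The n-th term dominates the relevant
estimates: it contributes at most q_{n+1}^{-9/10} at time q_n, which is o(q_{n+1}^{-4/5}). At the
times ⌊c q_{n+1}^{9/10}⌋ q_n it has grown to c cos(2πq_n x), while these times still rotate by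
almost nothing along indices with q_{n+1} ≥ q_n^{20}. A solution of the cohomological equation would
force |∫ e(r S_N g)| → 1 along them, whereas the limit is |∫ e(rc cos 2πx)| ≠ 1. -/

namespace SpecialFlow

/-! ### Denominators of convergents: recurrence, coprimality and approximation. -/

section ContinuedFraction

variable {α : ℝ}

lemma exists_get?_of_irrational (hα : Irrational α) (n : ℕ) :
    ∃ gp, (GenContFract.of α).s.get? n = some gp := by
  by_contra h
  have ht : (GenContFract.of α).Terminates := by
    refine ⟨n, ?_⟩
    rw [Stream'.Seq.TerminatedAt]
    exact Option.eq_none_iff_forall_ne_some.2 fun gp hgp => h ⟨gp, hgp⟩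
  obtain ⟨r, hr⟩ := (GenContFract.terminates_iff_rat α).1 ht
  exact hα ⟨r, hr.symm⟩

lemma not_terminatedAt_of_irrational (hα : Irrational α) (n : ℕ) :
    ¬ (GenContFract.of α).TerminatedAt n := by
  obtain ⟨gp, h⟩ := exists_get?_of_irrational hα n
  intro ht
  rw [GenContFract.TerminatedAt, Stream'.Seq.TerminatedAt] at ht
  simp [h] at ht

/-- Two consecutive indices are carried because the recurrence has order two. Numerators and
denominators live in ℝ here; their integrality lets the determinant identity give coprimality. -/
lemma exists_int_nums_dens (hα : Irrational α) (n : ℕ) :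
    ∃ a b a' b' : ℤ, (GenContFract.of α).nums n = a ∧ (GenContFract.of α).dens n = b ∧
      (GenContFract.of α).nums (n + 1) = a' ∧ (GenContFract.of α).dens (n + 1) = b' := by
  induction n with
  | zero =>
    obtain ⟨gp, h⟩ := exists_get?_of_irrational hα 0
    obtain ⟨ha, z, hz⟩ := GenContFract.of_partNum_eq_one_and_exists_int_partDen_eq h
    refine ⟨⌊α⌋, 1, z * ⌊α⌋ + 1, z, ?_, ?_, ?_, ?_⟩
    · simp [GenContFract.zeroth_num_eq_h, GenContFract.of_h_eq_floor]
    · simp [GenContFract.zeroth_den_eq_one]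
    · rw [GenContFract.first_num_eq h, ha, hz]
      simp [GenContFract.of_h_eq_floor]
    · rw [GenContFract.first_den_eq h, hz]
  | succ n ih =>
    obtain ⟨a, b, a', b', h1, h2, h3, h4⟩ := ih
    obtain ⟨gp, h⟩ := exists_get?_of_irrational hα (n + 1)
    obtain ⟨ha, z, hz⟩ := GenContFract.of_partNum_eq_one_and_exists_int_partDen_eq h
    refine ⟨a', b', z * a' + a, z * b' + b, h3, h4, ?_, ?_⟩
    · rw [GenContFract.nums_recurrence h h1 h3, ha, hz]; push_cast; ring
    · rw [GenContFract.dens_recurrence h h2 h4, ha, hz]; push_cast; ring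

lemma fib_le_dens (hα : Irrational α) (n : ℕ) :
    (Nat.fib (n + 1) : ℝ) ≤ (GenContFract.of α).dens n :=
  GenContFract.succ_nth_fib_le_of_nth_den (Or.inr (not_terminatedAt_of_irrational hα _))

lemma dens_pos (hα : Irrational α) (n : ℕ) : 0 < (GenContFract.of α).dens n :=
  lt_of_lt_of_le (by exact_mod_cast Nat.fib_pos.2 n.succ_pos) (fib_le_dens hα n)

lemma nums_mul_dens_sub (hα : Irrational α) (n : ℕ) :
    (GenContFract.of α).nums n * (GenContFract.of α).dens (n + 1) -
      (GenContFract.of α).dens n * (GenContFract.of α).nums (n + 1) = (-1) ^ (n + 1) :=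
  SimpContFract.determinant (s := SimpContFract.of α) (not_terminatedAt_of_irrational hα n)

/-- The determinant identity makes the recursive numerator and denominator coprime, so their
quotient is already reduced. This links the recurrence to `convDen`, which is a denominator in
lowest terms. -/
lemma dens_eq_and_nums_eq (hα : Irrational α) (n : ℕ) :
    (GenContFract.of α).dens n = convDen α n ∧
      (GenContFract.of α).nums n = (Real.convergent α n).num := by
  obtain ⟨a, b, a', b', h1, h2, h3, h4⟩ := exists_int_nums_dens hα n
  have hdet : a * b' - b * a' = (-1) ^ (n + 1) := by
    have := nums_mul_dens_sub hα n
    rw [h1, h2, h3, h4] at this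
    exact_mod_cast this
  have hb : 0 < b := by have := dens_pos hα n; rw [h2] at this; exact_mod_cast this
  have hcop : IsCoprime a b := by
    refine ⟨b' * (-1) ^ (n + 1), -a' * (-1) ^ (n + 1), ?_⟩
    have h2 : ((-1 : ℤ) ^ (n + 1)) * (-1) ^ (n + 1) = 1 := by
      rw [← mul_pow]; simp
    linear_combination ((-1 : ℤ) ^ (n + 1)) * hdet + h2
  have hconv : Real.convergent α n = (a : ℚ) / b := by
    have := Real.convs_eq_convergent α n
    rw [GenContFract.convs] at this
    change (GenContFract.of α).nums n / (GenContFract.of α).dens n = _ at this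
    rw [h1, h2] at this
    exact_mod_cast this.symm
  have hc : Nat.Coprime a.natAbs b.natAbs := Int.isCoprime_iff_gcd_eq_one.1 hcop
  constructor
  · rw [h2, convDen, hconv]
    exact_mod_cast (Rat.den_div_eq_of_coprime hb hc).symm
  · rw [h1, hconv]
    exact_mod_cast (Rat.num_div_eq_of_coprime hb hc).symm

lemma convDen_pos (α : ℝ) (n : ℕ) : 0 < convDen α n := Rat.den_pos _

lemma convDen_le_succ (hα : Irrational α) (n : ℕ) : convDen α n ≤ convDen α (n + 1) := by
  have := GenContFract.of_den_mono (v := α) (n := n)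
  rw [(dens_eq_and_nums_eq hα n).1, (dens_eq_and_nums_eq hα (n + 1)).1] at this
  exact_mod_cast this

lemma convDen_monotone (hα : Irrational α) : Monotone (convDen α) :=
  monotone_nat_of_le_succ (convDen_le_succ hα)

lemma fib_le_convDen (hα : Irrational α) (n : ℕ) : Nat.fib (n + 1) ≤ convDen α n := by
  have := fib_le_dens hα n
  rw [(dens_eq_and_nums_eq hα n).1] at this
  exact_mod_cast this

lemma convDen_add_le (hα : Irrational α) (n : ℕ) :
    convDen α n + convDen α (n + 1) ≤ convDen α (n + 2) := by
  obtain ⟨gp, h⟩ := exists_get?_of_irrational hα (n + 1)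
  have hr := GenContFract.dens_recurrence h rfl rfl
  have h1 : 1 ≤ gp.b := GenContFract.of_one_le_get?_partDen (GenContFract.partDen_eq_s_b h)
  rw [(GenContFract.of_partNum_eq_one_and_exists_int_partDen_eq h).1,
    (dens_eq_and_nums_eq hα _).1, (dens_eq_and_nums_eq hα _).1,
    (dens_eq_and_nums_eq hα _).1] at hr
  have h2 : (convDen α (n + 1) : ℝ) ≤ gp.b * convDen α (n + 1) :=
    le_mul_of_one_le_left (by positivity) h1
  have : (convDen α n : ℝ) + convDen α (n + 1) ≤ convDen α (n + 2) := by rw [hr]; linarith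
  exact_mod_cast this

/-- Another reading of the determinant identity. It makes q_n a unit modulo q_{n+1}, which permits
the change of variable t ↦ q_n t on ℤ/q_{n+1}. -/
lemma convDen_coprime (hα : Irrational α) (n : ℕ) :
    Nat.Coprime (convDen α n) (convDen α (n + 1)) := by
  have := nums_mul_dens_sub hα n
  rw [(dens_eq_and_nums_eq hα n).1, (dens_eq_and_nums_eq hα n).2,
    (dens_eq_and_nums_eq hα (n + 1)).1, (dens_eq_and_nums_eq hα (n + 1)).2] at this
  have h : (Real.convergent α n).num * (convDen α (n + 1) : ℤ) -
    (convDen α n : ℤ) * (Real.convergent α (n + 1)).num = (-1) ^ (n + 1) := by exact_mod_cast this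
  rw [← Nat.isCoprime_iff_coprime]
  have h2 : ((-1 : ℤ) ^ (n + 1)) * (-1) ^ (n + 1) = 1 := by rw [← mul_pow]; simp
  refine ⟨-(Real.convergent α (n + 1)).num * (-1) ^ (n + 1),
    (Real.convergent α n).num * (-1) ^ (n + 1), ?_⟩
  linear_combination ((-1 : ℤ) ^ (n + 1)) * h + h2

lemma abs_convDen_mul_sub_le (hα : Irrational α) (n : ℕ) :
    |convDen α n * α - (Real.convergent α n).num| ≤ 1 / convDen α (n + 1) := by
  have h := GenContFract.abs_sub_convs_le (not_terminatedAt_of_irrational hα n)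
  rw [GenContFract.convs] at h
  change |α - (GenContFract.of α).nums n / (GenContFract.of α).dens n| ≤ _ at h
  rw [(dens_eq_and_nums_eq hα n).1, (dens_eq_and_nums_eq hα n).2,
    (dens_eq_and_nums_eq hα (n + 1)).1] at h
  have hq : (0 : ℝ) < convDen α n := by exact_mod_cast convDen_pos α n
  have hq' : (0 : ℝ) < convDen α (n + 1) := by exact_mod_cast convDen_pos α (n + 1)
  have : convDen α n * α - (Real.convergent α n).num =
      convDen α n * (α - (Real.convergent α n).num / convDen α n) := by field_simp
  rw [this, abs_mul, abs_of_pos hq]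
  calc _ ≤ (convDen α n : ℝ) * (1 / (convDen α n * convDen α (n + 1))) := by gcongr
    _ = _ := by field_simp

/-- The determinant identity gives 1 ≤ q_{n+1}|q_nα − p_n| + q_n|q_{n+1}α − p_{n+1}|, and the last
term is at most q_n/q_{n+2} ≤ 1/2. -/
lemma le_abs_convDen_mul_sub (hα : Irrational α) (n : ℕ) :
    1 / (2 * convDen α (n + 1)) ≤ |convDen α n * α - (Real.convergent α n).num| := by
  have hdet := nums_mul_dens_sub hα n
  rw [(dens_eq_and_nums_eq hα n).1, (dens_eq_and_nums_eq hα n).2,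
    (dens_eq_and_nums_eq hα (n + 1)).1, (dens_eq_and_nums_eq hα (n + 1)).2] at hdet
  have h1 := abs_convDen_mul_sub_le hα (n + 1)
  have hq : (0 : ℝ) < convDen α n := by exact_mod_cast convDen_pos α n
  have hq' : (0 : ℝ) < convDen α (n + 1) := by exact_mod_cast convDen_pos α (n + 1)
  have hq2 : (0 : ℝ) < convDen α (n + 2) := by exact_mod_cast convDen_pos α (n + 2)
  have h2 : (2 : ℝ) * convDen α n ≤ convDen α (n + 2) := by
    have a := convDen_add_le hα n
    have b := convDen_le_succ hα n
    exact_mod_cast (by omega : 2 * convDen α n ≤ convDen α (n + 2))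
  set p := ((Real.convergent α n).num : ℝ)
  set p' := ((Real.convergent α (n + 1)).num : ℝ)
  set q := (convDen α n : ℝ)
  set q' := (convDen α (n + 1) : ℝ)
  have h3 : (1 : ℝ) ≤ q' * |q * α - p| + q * |q' * α - p'| := by
    calc (1 : ℝ) = |(-1 : ℝ) ^ (n + 1)| := by simp
      _ = |q * (q' * α - p') - q' * (q * α - p)| := by rw [← hdet]; congr 1; ring
      _ ≤ |q * (q' * α - p')| + |q' * (q * α - p)| := abs_sub _ _
      _ = _ := by rw [abs_mul, abs_mul, abs_of_pos hq, abs_of_pos hq']; ring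
  have h4 : q * |q' * α - p'| ≤ 1 / 2 := by
    calc q * |q' * α - p'| ≤ q * (1 / convDen α (n + 2)) := by gcongr
      _ ≤ 1 / 2 := by rw [mul_one_div, div_le_div_iff₀ hq2 two_pos]; linarith
  rw [div_le_iff₀ (by positivity)]
  nlinarith

lemma tendsto_convDen (hα : Irrational α) : Tendsto (convDen α) atTop atTop := by
  have h : ∀ n, n - 1 ≤ convDen α n := fun n => by
    have h1 := Nat.le_fib_add_one n
    have h2 := Nat.fib_le_fib_succ (n := n)
    have h3 := fib_le_convDen hα n
    omega
  exact tendsto_atTop_mono h (tendsto_sub_atTop_nat 1)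

lemma two_pow_mul_convDen_le (hα : Irrational α) (n k : ℕ) :
    2 ^ k * convDen α n ≤ convDen α (n + 2 * k) := by
  induction k with
  | zero => simp
  | succ k ih =>
    have h1 := convDen_add_le hα (n + 2 * k)
    have h2 := convDen_le_succ hα (n + 2 * k)
    rw [show n + 2 * (k + 1) = n + 2 * k + 2 by ring, pow_succ]
    linarith

end ContinuedFraction

end SpecialFlow


namespace SpecialFlow

/-! ### Geometric and quadratic exponential sums modulo q. -/

section QuadraticSequence

open ZMod Finset

variable {q : ℕ}

/-- The standard bound `min (H, 1 / (2 ‖x / q‖))` for geometric sums of length at most `H`, where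
the value at `0` is `H`. -/
noncomputable def geomBound (H : ℝ) (x : ZMod q) : ℝ :=
  if x = 0 then H else q / (2 * x.valMinAbs.natAbs)

lemma geomBound_nonneg {H : ℝ} (hH : 0 ≤ H) (x : ZMod q) : 0 ≤ geomBound H x := by
  unfold geomBound; split_ifs <;> positivity

lemma natAbs_valMinAbs_pos {x : ZMod q} (hx : x ≠ 0) : 0 < x.valMinAbs.natAbs := by
  rw [Int.natAbs_pos]; simpa using hx

/-- At most two residues, k and −k, share an absolute value; hence the factor 2. -/
lemma sum_natAbs_valMinAbs_le (F : ℕ → ℝ) (hF : ∀ k, 0 ≤ F k) (s : Finset (ZMod q)) (t : Finset ℕ)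
    (hst : ∀ x ∈ s, x.valMinAbs.natAbs ∈ t) :
    ∑ x ∈ s, F x.valMinAbs.natAbs ≤ 2 * ∑ k ∈ t, F k := by
  rw [← Finset.sum_fiberwise_of_maps_to hst, Finset.mul_sum]
  refine Finset.sum_le_sum fun k _ => ?_
  rw [Finset.sum_congr rfl (g := fun _ => F k) (fun x hx => by rw [(Finset.mem_filter.1 hx).2]),
    Finset.sum_const, nsmul_eq_mul]
  refine mul_le_mul_of_nonneg_right ?_ (hF k)
  have : (Finset.image (fun x : ZMod q => x.valMinAbs)
      {x ∈ s | x.valMinAbs.natAbs = k}) ⊆ {(k : ℤ), -(k : ℤ)} := by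
    intro z hz
    obtain ⟨x, hx, rfl⟩ := Finset.mem_image.1 hz
    have := (Finset.mem_filter.1 hx).2
    simp only [Finset.mem_insert, Finset.mem_singleton]
    omega
  have h2 := (Finset.card_le_card this).trans Finset.card_le_two
  rw [Finset.card_image_of_injective _ ZMod.injective_valMinAbs] at h2
  exact_mod_cast h2

variable [NeZero q]

/-- Parseval's identity on `ℤ/q`. -/
lemma sum_norm_sq_fourier (c : ZMod q → ℂ) :
    ∑ ξ : ZMod q, ‖∑ b, c b * stdAddChar (ξ * b)‖ ^ 2 = q * ∑ b, ‖c b‖ ^ 2 := by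
  have key : ∀ ξ : ZMod q, ((‖∑ b, c b * stdAddChar (ξ * b)‖ ^ 2 : ℝ) : ℂ) =
      ∑ b, ∑ b', c b * (starRingEnd ℂ) (c b') * stdAddChar (ξ * (b - b')) := fun ξ => by
    rw [Complex.ofReal_pow, ← Complex.mul_conj', map_sum, Finset.sum_mul_sum]
    refine Finset.sum_congr rfl fun b _ => Finset.sum_congr rfl fun b' _ => ?_
    rw [map_mul (starRingEnd ℂ), ← AddChar.map_neg_eq_conj, mul_sub, sub_eq_add_neg, AddChar.map_add_eq_mul]
    ring
  have : ((∑ ξ : ZMod q, ‖∑ b, c b * stdAddChar (ξ * b)‖ ^ 2 : ℝ) : ℂ) =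
      ((q * ∑ b, ‖c b‖ ^ 2 : ℝ) : ℂ) := by
    rw [Complex.ofReal_sum, Finset.sum_congr rfl fun ξ _ => key ξ, Finset.sum_comm]
    push_cast
    rw [Finset.mul_sum]
    refine Finset.sum_congr rfl fun b _ => ?_
    rw [Finset.sum_comm, Finset.sum_eq_single b]
    · simp [← Complex.mul_conj', ZMod.card, mul_comm]
    · intro b' _ hb
      rw [← Finset.mul_sum, AddChar.sum_mulShift _ (isPrimitive_stdAddChar q),
        if_neg (sub_ne_zero.2 hb.symm)]
      simp
    · simp
  exact_mod_cast this

/-- The chord has length 2|sin(πv/q)| with |v| ≤ q/2, and |sin u| ≥ (2/π)|u| for |u| ≤ π/2. -/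
lemma norm_one_sub_stdAddChar (x : ZMod q) :
    4 * (x.valMinAbs.natAbs : ℝ) / q ≤ ‖stdAddChar x - 1‖ := by
  have hq : (0 : ℝ) < q := by exact_mod_cast Nat.pos_of_ne_zero (NeZero.ne q)
  set v := x.valMinAbs with hv
  have hx : x = (v : ZMod q) := (coe_valMinAbs x).symm
  have h1 : stdAddChar x = Complex.exp (Complex.I * ((2 * Real.pi * v / q : ℝ) : ℂ)) := by
    rw [hx, stdAddChar_coe]; congr 1; push_cast; ring
  have hle : |(v : ℝ)| ≤ q / 2 := by
    have := natAbs_valMinAbs_le x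
    rw [← hv] at this
    have h2 : ((v.natAbs : ℕ) : ℝ) ≤ ((q / 2 : ℕ) : ℝ) := by exact_mod_cast this
    rw [Nat.cast_natAbs, Int.cast_abs] at h2
    exact h2.trans (by simpa using Nat.cast_div_le (α := ℝ) (m := q) (n := 2))
  rw [h1, Complex.norm_exp_I_mul_ofReal_sub_one, Real.norm_eq_abs, abs_mul, abs_two,
    show 2 * Real.pi * (v : ℝ) / q / 2 = Real.pi * v / q by ring]
  have habs : |Real.pi * (v : ℝ) / q| = Real.pi * |(v : ℝ)| / q := by
    rw [abs_div, abs_mul, abs_of_pos Real.pi_pos, abs_of_pos hq]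
  have h3 : |Real.pi * (v : ℝ) / q| ≤ Real.pi / 2 := by
    rw [habs, div_le_div_iff₀ hq two_pos]; nlinarith [Real.pi_pos]
  have h4 := Real.mul_abs_le_abs_sin h3
  rw [habs] at h4
  rw [Nat.cast_natAbs, Int.cast_abs]
  calc 4 * |(v : ℝ)| / q = 2 * (2 / Real.pi * (Real.pi * |(v : ℝ)| / q)) := by
        field_simp; ring
    _ ≤ _ := by gcongr

lemma norm_sum_range_stdAddChar_le {H n : ℕ} (hn : n ≤ H) (x : ZMod q) :
    ‖∑ s ∈ range n, stdAddChar (x * (s : ZMod q))‖ ≤ geomBound (H : ℝ) x := by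
  unfold geomBound
  split_ifs with hx
  · refine (norm_sum_le _ _).trans ?_
    simp only [AddChar.norm_apply, sum_const, card_range, nsmul_eq_mul, mul_one]
    exact_mod_cast hn
  · have hq : (0 : ℝ) < q := by exact_mod_cast Nat.pos_of_ne_zero (NeZero.ne q)
    have hv : (0 : ℝ) < x.valMinAbs.natAbs := by exact_mod_cast natAbs_valMinAbs_pos hx
    have h1 := norm_one_sub_stdAddChar x
    have h0 : 0 < ‖stdAddChar x - 1‖ := lt_of_lt_of_le (by positivity) h1
    have hne : stdAddChar x ≠ 1 := fun h => by simp [h] at h0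
    have hs : ∑ s ∈ range n, stdAddChar (x * (s : ZMod q)) =
        (stdAddChar x ^ n - 1) / (stdAddChar x - 1) := by
      rw [← geom_sum_eq hne]
      refine Finset.sum_congr rfl fun s _ => ?_
      rw [← AddChar.map_nsmul_eq_pow, nsmul_eq_mul, mul_comm]
    rw [hs, norm_div, div_le_div_iff₀ h0 (by positivity)]
    have h2 : ‖stdAddChar x ^ n - 1‖ ≤ 2 := by
      refine (norm_sub_le _ _).trans ?_
      rw [norm_pow, AddChar.norm_apply]; norm_num
    have h3 : 4 * (x.valMinAbs.natAbs : ℝ) ≤ q * ‖stdAddChar x - 1‖ := by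
      rw [div_le_iff₀ hq] at h1; linarith
    nlinarith

lemma norm_sum_Ico_stdAddChar_le {H : ℕ} {a b : ℕ} (hab : b ≤ a + H) (x y : ZMod q) :
    ‖∑ s ∈ Ico a b, stdAddChar (y + x * (s : ZMod q))‖ ≤ geomBound (H : ℝ) x := by
  rw [Finset.sum_Ico_eq_sum_range]
  have : ∀ s : ℕ, stdAddChar (y + x * ((a + s : ℕ) : ZMod q)) =
      stdAddChar (y + x * (a : ZMod q)) * stdAddChar (x * (s : ZMod q)) := fun s => by
    rw [← AddChar.map_add_eq_mul]; congr 1; push_cast; ring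
  rw [Finset.sum_congr rfl fun s _ => this s, ← Finset.mul_sum, norm_mul, AddChar.norm_apply,
    one_mul]
  exact norm_sum_range_stdAddChar_le (by omega) x

/-- Away from 0 the values q/(2k), each taken at most twice, add up to q times a harmonic sum. -/
lemma sum_geomBound_le {H : ℝ} :
    ∑ x : ZMod q, geomBound H x ≤ H + q * (1 + Real.log q) := by
  rw [← Finset.add_sum_erase _ _ (Finset.mem_univ (0 : ZMod q))]
  refine add_le_add (by simp [geomBound]) ?_
  have h1 : ∑ x ∈ Finset.univ.erase (0 : ZMod q), geomBound H x =
      ∑ x ∈ Finset.univ.erase (0 : ZMod q),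
        (fun k : ℕ => (q : ℝ) / (2 * k)) x.valMinAbs.natAbs :=
    Finset.sum_congr rfl fun x hx => by simp [geomBound, (Finset.mem_erase.1 hx).1]
  rw [h1]
  refine (sum_natAbs_valMinAbs_le (fun k : ℕ => (q : ℝ) / (2 * k)) (fun k => by positivity) _
    (Finset.image (· + 1) (range q)) fun x hx => ?_).trans ?_
  · have h2 := natAbs_valMinAbs_pos (Finset.mem_erase.1 hx).1
    have h3 := natAbs_valMinAbs_le x
    have h4 := Nat.pos_of_ne_zero (NeZero.ne q)
    exact Finset.mem_image.2 ⟨x.valMinAbs.natAbs - 1, Finset.mem_range.2 (by omega), by omega⟩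
  · rw [Finset.sum_image (by intro a _ b _ h; simpa using h)]
    have h := harmonic_le_one_add_log q
    rw [harmonic] at h
    push_cast at h
    calc 2 * ∑ x ∈ range q, (q : ℝ) / (2 * ((x + 1 : ℕ) : ℝ))
        = q * ∑ x ∈ range q, ((x : ℝ) + 1)⁻¹ := by
          rw [Finset.mul_sum, Finset.mul_sum]
          refine Finset.sum_congr rfl fun x _ => ?_
          push_cast; field_simp
      _ ≤ _ := by gcongr

/-- Van der Corput differencing for a quadratic exponential sum. -/
lemma norm_sq_quadratic_sum_le (H M : ℕ) (θ γ : ZMod q) :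
    ‖∑ i ∈ range H, stdAddChar (θ * ((M + i : ℕ) : ZMod q) ^ 2 + γ)‖ ^ 2 ≤
      ∑ d ∈ Ioo (-(H : ℤ)) H, geomBound (H : ℝ) (2 * θ * (d : ZMod q)) := by
  set a : ℕ → ZMod q := fun i => θ * ((M + i : ℕ) : ZMod q) ^ 2 + γ
  have h1 : ((‖∑ i ∈ range H, stdAddChar (a i)‖ ^ 2 : ℝ) : ℂ) =
      ∑ p ∈ range H ×ˢ range H, stdAddChar (a p.1 - a p.2) := by
    rw [Complex.ofReal_pow, ← Complex.mul_conj', map_sum, Finset.sum_mul_sum,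
      Finset.sum_product]
    refine Finset.sum_congr rfl fun b _ => Finset.sum_congr rfl fun b' _ => ?_
    rw [← AddChar.map_neg_eq_conj, ← AddChar.map_add_eq_mul, ← sub_eq_add_neg]
  have h2 : ‖∑ i ∈ range H, stdAddChar (a i)‖ ^ 2 =
      ‖∑ p ∈ range H ×ˢ range H, stdAddChar (a p.1 - a p.2)‖ := by
    rw [← h1, Complex.norm_real]; simp
  have hmap : ∀ p ∈ range H ×ˢ range H, (p.1 : ℤ) - p.2 ∈ Ioo (-(H : ℤ)) H := by
    intro p hp
    simp only [Finset.mem_product, Finset.mem_range] at hp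
    simp only [Finset.mem_Ioo]
    omega
  rw [h2, ← Finset.sum_fiberwise_of_maps_to hmap]
  refine (norm_sum_le _ _).trans (Finset.sum_le_sum fun d hd => ?_)
  rw [Finset.mem_Ioo] at hd
  -- On the diagonal i − j = d the phase θ((M+j+d)² − (M+j)²) = θd(2M+d) + 2θd·j is linear in j, and
  -- j runs through an interval of length at most H.
  have h3 : ∑ p ∈ range H ×ˢ range H with (p.1 : ℤ) - p.2 = d, stdAddChar (a p.1 - a p.2) =
      ∑ j ∈ Ico (-d).toNat (min (H : ℤ) (H - d)).toNat,
        stdAddChar ((θ * (d * (2 * M + d) : ZMod q)) + (2 * θ * (d : ZMod q)) * (j : ZMod q)) := by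
    refine Finset.sum_bij' (fun p _ => p.2) (fun j _ => ((j + d).toNat, j)) ?_ ?_ ?_ ?_ ?_
    · intro p hp
      simp only [Finset.mem_filter, Finset.mem_product, Finset.mem_range] at hp
      simp only [Finset.mem_Ico]
      omega
    · intro j hj
      simp only [Finset.mem_Ico] at hj
      simp only [Finset.mem_filter, Finset.mem_product, Finset.mem_range]
      omega
    · intro p hp
      simp only [Finset.mem_filter, Finset.mem_product, Finset.mem_range] at hp
      ext <;> simp; omega
    · intro j hj; rfl
    · intro p hp
      simp only [Finset.mem_filter, Finset.mem_product, Finset.mem_range] at hp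
      have : (p.1 : ZMod q) = p.2 + (d : ZMod q) := by
        have h : (p.1 : ℤ) = p.2 + d := by omega
        have := congrArg (Int.cast : ℤ → ZMod q) h
        simpa using this
      simp only [a]
      congr 1
      push_cast
      rw [this]
      ring
  rw [h3]
  exact norm_sum_Ico_stdAddChar_le (by omega) _ _

/-- Cut (−H, H) into blocks of length D. On one block d ↦ 2θd is injective mod q, because
differences are smaller than D, so the block contributes no more than the full sum over ℤ/q. This
avoids any assumption that 2θ is a unit. -/
lemma sum_geomBound_mul_le {H D : ℕ} {θ : ZMod q} (hD : 0 < D)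
    (hinj : ∀ d : ℤ, |d| < D → 2 * θ * (d : ZMod q) = 0 → d = 0) :
    ∑ d ∈ Ioo (-(H : ℤ)) H, geomBound (H : ℝ) (2 * θ * (d : ZMod q)) ≤
      (2 * H / D + 2) * (H + q * (1 + Real.log q)) := by
  have hD' : (0 : ℤ) < D := by exact_mod_cast hD
  have hmap : ∀ d ∈ Ioo (-(H : ℤ)) H, d / (D : ℤ) ∈ Icc (-(H : ℤ) / D) ((H : ℤ) / D) := by
    intro d hd
    rw [Finset.mem_Ioo] at hd
    exact Finset.mem_Icc.2 ⟨Int.ediv_le_ediv hD' hd.1.le, Int.ediv_le_ediv hD' hd.2.le⟩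
  rw [← Finset.sum_fiberwise_of_maps_to hmap]
  have hblock : ∀ k : ℤ, ∑ d ∈ Ioo (-(H : ℤ)) H with d / (D : ℤ) = k,
      geomBound (H : ℝ) (2 * θ * (d : ZMod q)) ≤ H + q * (1 + Real.log q) := fun k => by
    refine le_trans ?_ (sum_geomBound_le (q := q) (H := (H : ℝ)))
    rw [← Finset.sum_image (f := fun x : ZMod q => geomBound (H : ℝ) x)
      (g := fun d : ℤ => 2 * θ * (d : ZMod q))]
    · exact Finset.sum_le_sum_of_subset_of_nonneg (Finset.subset_univ _)
        fun x _ _ => geomBound_nonneg (Nat.cast_nonneg _) x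
    · intro d hd d' hd' h
      simp only [Finset.coe_filter, Set.mem_ofPred_eq] at hd hd'
      have h1 : 2 * θ * ((d - d' : ℤ) : ZMod q) = 0 := by
        push_cast; rw [mul_sub]; exact sub_eq_zero.2 h
      have h2 : |d - d'| < D := by
        have e1 := Int.emod_add_mul_ediv d D
        have e2 := Int.emod_add_mul_ediv d' D
        have e3 := Int.emod_nonneg d hD'.ne'
        have e4 := Int.emod_nonneg d' hD'.ne'
        have e5 := Int.emod_lt_of_pos d hD'
        have e6 := Int.emod_lt_of_pos d' hD'
        rw [hd.2] at e1
        rw [hd'.2] at e2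
        rw [abs_lt]
        constructor <;> linarith
      have := hinj _ h2 h1
      omega
  refine (Finset.sum_le_sum fun k _ => hblock k).trans ?_
  rw [Finset.sum_const, nsmul_eq_mul]
  have hlog : 0 ≤ Real.log q := Real.log_natCast_nonneg q
  refine mul_le_mul_of_nonneg_right ?_ (by positivity)
  rw [Int.card_Icc]
  have hDr : (0 : ℝ) < D := by exact_mod_cast hD
  -- The number of blocks is ⌊H/D⌋ − ⌊−H/D⌋ + 1 ≤ 2H/D + 2.
  have h1 : (((H : ℤ) / D : ℤ) : ℝ) ≤ H / D := by
    rw [le_div_iff₀ hDr]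
    have := Int.ediv_mul_le (H : ℤ) hD'.ne'
    exact_mod_cast this
  have h2 : (-(H : ℝ) / D) - 1 ≤ ((-(H : ℤ) / D : ℤ) : ℝ) := by
    rw [sub_le_iff_le_add, div_le_iff₀ hDr]
    have := Int.lt_ediv_add_one_mul_self (-(H : ℤ)) hD'
    exact_mod_cast this.le
  have h3 : (0 : ℤ) ≤ (H : ℤ) / D + 1 - -(H : ℤ) / D := by
    have a1 : (0 : ℤ) ≤ (H : ℤ) / D := Int.ediv_nonneg (by positivity) hD'.le
    have a2 : (-(H : ℤ)) / D ≤ 0 := by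
      have := Int.ediv_le_ediv hD' (show -(H : ℤ) ≤ 0 by simp)
      simpa using this
    omega
  have h4 : ((((H : ℤ) / D + 1 - -(H : ℤ) / D).toNat : ℕ) : ℝ) =
      (((H : ℤ) / D + 1 - -(H : ℤ) / D : ℤ) : ℝ) := by
    exact_mod_cast congrArg (Int.cast : ℤ → ℝ) (Int.toNat_of_nonneg h3)
  rw [h4]
  push_cast
  have h5 : 2 * (H : ℝ) / D = H / D - (-(H : ℝ) / D) := by ring
  rw [h5]
  linarith

end QuadraticSequence

end SpecialFlow


namespace SpecialFlow

/-! ### Variance of a smoothed quadratic sequence modulo q. -/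

section QuadraticEquidistribution

open ZMod Finset

variable {q : ℕ} [NeZero q]

/-- Parseval for the indicator of {0, …, L−1}, whose residues are distinct since L ≤ q. -/
lemma sum_norm_sq_geom {L : ℕ} (hL : L ≤ q) :
    ∑ ξ : ZMod q, ‖∑ s ∈ range L, stdAddChar (ξ * (s : ZMod q))‖ ^ 2 = q * L := by
  have h := sum_norm_sq_fourier (q := q) (fun b => if b ∈ (range L).image (Nat.cast : ℕ → ZMod q)
    then 1 else 0)
  have hinj : Set.InjOn (Nat.cast : ℕ → ZMod q) (range L) := by
    intro a ha b hb hab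
    have ha' : a < q := lt_of_lt_of_le (Finset.mem_range.1 ha) hL
    have hb' : b < q := lt_of_lt_of_le (Finset.mem_range.1 hb) hL
    rw [ZMod.natCast_eq_natCast_iff] at hab
    exact Nat.ModEq.eq_of_lt_of_lt hab ha' hb'
  have h1 : ∀ ξ : ZMod q, ∑ s ∈ range L, stdAddChar (ξ * (s : ZMod q)) =
      ∑ b : ZMod q, (if b ∈ (range L).image (Nat.cast : ℕ → ZMod q) then 1 else 0) *
        stdAddChar (ξ * b) := fun ξ => by
    simp only [ite_mul, one_mul, zero_mul, Finset.sum_ite_mem, Finset.univ_inter]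
    rw [Finset.sum_image hinj]
  rw [Finset.sum_congr rfl fun ξ _ => by rw [h1 ξ], h]
  congr 1
  have h2 : ∀ b : ZMod q, ‖(if b ∈ (range L).image (Nat.cast : ℕ → ZMod q) then (1 : ℂ)
      else 0)‖ ^ 2 = if b ∈ (range L).image (Nat.cast : ℕ → ZMod q) then (1 : ℝ) else 0 := by
    intro b; split_ifs <;> simp
  rw [Finset.sum_congr rfl fun b _ => h2 b, Finset.sum_ite_mem, Finset.univ_inter,
    Finset.sum_const, Finset.card_image_of_injOn hinj]
  simp

/-- The bound for the relative variance, at scale `L`, of a quadratic sequence of length `H`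
modulo `q`; the parameters `X`, `D` with `2 X D ≤ q` are free. -/
noncomputable def quadraticVariance (q H L X D : ℕ) : ℝ :=
  q / L * ((2 * H / D + 2) * (H + q * (1 + Real.log q)) / H ^ 2) + q ^ 2 / (2 * X * L ^ 2)

/-- Frequencies are split at X. For |ξ| ≤ X van der Corput applies: 2XD ≤ q ensures 2ξd ≠ 0 mod q
for 0 < |d| < D, even when q is composite and ξ shares factors with it. For |ξ| > X the quadratic
sum is bounded trivially by H, and the smoothing kernel by (q/2|ξ|)², whose sum converges. -/
lemma sum_erase_norm_sq_mul_le {H L X D : ℕ} (hH : 0 < H) (hL : 0 < L) (hLq : L ≤ q) (hX : 0 < X)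
    (hD : 0 < D) (hXD : 2 * X * D ≤ q) (M : ℕ) (u : (ZMod q)ˣ) (c : ZMod q) :
    ∑ ξ ∈ univ.erase (0 : ZMod q),
      ‖∑ i ∈ range H, stdAddChar (ξ * ((u : ZMod q) * ((M + i : ℕ) : ZMod q) ^ 2 + c))‖ ^ 2 *
      ‖∑ s ∈ range L, stdAddChar (ξ * (s : ZMod q))‖ ^ 2 ≤
      (H * L) ^ 2 * quadraticVariance q H L X D := by
  have hH' : (0 : ℝ) < H := by exact_mod_cast hH
  have hL' : (0 : ℝ) < L := by exact_mod_cast hL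
  have hX' : (0 : ℝ) < X := by exact_mod_cast hX
  have hlog : 0 ≤ Real.log q := Real.log_natCast_nonneg q
  set A : ZMod q → ℝ := fun ξ =>
    ‖∑ i ∈ range H, stdAddChar (ξ * ((u : ZMod q) * ((M + i : ℕ) : ZMod q) ^ 2 + c))‖ ^ 2 with hA
  set K : ZMod q → ℝ := fun ξ => ‖∑ s ∈ range L, stdAddChar (ξ * (s : ZMod q))‖ ^ 2 with hK
  set W : ℝ := (2 * H / D + 2) * (H + q * (1 + Real.log q)) with hW
  have hK0 : ∀ ξ, 0 ≤ K ξ := fun ξ => by positivity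
  rw [← Finset.sum_filter_add_sum_filter_not _ (fun ξ : ZMod q => ξ.valMinAbs.natAbs ≤ X)]
  have hsmall : ∀ ξ ∈ (univ.erase (0 : ZMod q)).filter (fun ξ => ξ.valMinAbs.natAbs ≤ X),
      A ξ * K ξ ≤ W * K ξ := by
    intro ξ hξ
    obtain ⟨hξ, hξX⟩ := Finset.mem_filter.1 hξ
    have hξ0 : ξ ≠ 0 := (Finset.mem_erase.1 hξ).1
    refine mul_le_mul_of_nonneg_right ?_ (hK0 ξ)
    have h1 : ∀ i : ℕ, ξ * (u * ((M + i : ℕ) : ZMod q) ^ 2 + c) =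
      (ξ * (u : ZMod q)) * ((M + i : ℕ) : ZMod q) ^ 2 + ξ * c := fun i => by ring
    simp only [hA]
    rw [Finset.sum_congr rfl fun i _ => by rw [h1 i]]
    refine (norm_sq_quadratic_sum_le H M (ξ * (u : ZMod q)) (ξ * c)).trans (sum_geomBound_mul_le hD ?_)
    intro d hd h0
    have h2 : ((2 * ξ.valMinAbs * d : ℤ) : ZMod q) = 0 := by
      have : (u : ZMod q) * (2 * ξ * d) = 0 := by rw [← h0]; ring
      rw [Units.mul_right_eq_zero] at this
      push_cast
      exact this
    rw [ZMod.intCast_zmod_eq_zero_iff_dvd] at h2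
    have hlt : |2 * ξ.valMinAbs * d| < q := by
      rcases eq_or_ne d 0 with rfl | hd0
      · simpa using Nat.pos_of_ne_zero (NeZero.ne q)
      · rw [abs_mul, abs_mul, abs_two]
        have e1 : |ξ.valMinAbs| ≤ X := by rw [Int.abs_eq_natAbs]; exact_mod_cast hξX
        have hX2 : (0 : ℤ) < 2 * X := by positivity
        have e2 : (2 * X * D : ℤ) ≤ q := by exact_mod_cast hXD
        nlinarith [abs_nonneg d]
    have h3 := Int.eq_zero_of_abs_lt_dvd h2 hlt
    have h4 : ξ.valMinAbs ≠ 0 := by simpa using hξ0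
    simpa [h4] using h3
  have hlarge : ∀ ξ ∈ (univ.erase (0 : ZMod q)).filter (fun ξ => ¬ ξ.valMinAbs.natAbs ≤ X),
      A ξ * K ξ ≤ (fun k : ℕ => (H : ℝ) ^ 2 * ((q : ℝ) ^ 2 / 4 * ((k : ℝ) ^ 2)⁻¹))
        ξ.valMinAbs.natAbs := by
    intro ξ hξ
    have hξ0 : ξ ≠ 0 := (Finset.mem_erase.1 (Finset.mem_filter.1 hξ).1).1
    refine mul_le_mul ?_ ?_ (hK0 ξ) (by positivity)
    · refine pow_le_pow_left₀ (norm_nonneg _) ((norm_sum_le _ _).trans ?_) 2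
      simp [AddChar.norm_apply]
    · have := norm_sum_range_stdAddChar_le (le_refl L) ξ
      rw [geomBound, if_neg hξ0] at this
      refine (pow_le_pow_left₀ (norm_nonneg _) this 2).trans (le_of_eq ?_)
      rw [div_pow, mul_pow]; ring
  have hs1 := Finset.sum_le_sum hsmall
  have hs2 := Finset.sum_le_sum hlarge
  have hs3 : ∑ ξ ∈ (univ.erase (0 : ZMod q)).filter (fun ξ => ξ.valMinAbs.natAbs ≤ X), W * K ξ ≤
      W * (q * L) := by
    rw [← Finset.mul_sum, ← sum_norm_sq_geom hLq]
    refine mul_le_mul_of_nonneg_left ?_ (by positivity)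
    exact Finset.sum_le_sum_of_subset_of_nonneg (Finset.subset_univ _) fun ξ _ _ => hK0 ξ
  have hs4 : ∑ ξ ∈ (univ.erase (0 : ZMod q)).filter (fun ξ => ¬ ξ.valMinAbs.natAbs ≤ X),
      (fun k : ℕ => (H : ℝ) ^ 2 * ((q : ℝ) ^ 2 / 4 * ((k : ℝ) ^ 2)⁻¹)) ξ.valMinAbs.natAbs ≤
      (H : ℝ) ^ 2 * ((q : ℝ) ^ 2 / (2 * X)) := by
    have hXq : X ≤ q := by nlinarith
    refine (sum_natAbs_valMinAbs_le (fun k : ℕ => (H : ℝ) ^ 2 * ((q : ℝ) ^ 2 / 4 * ((k : ℝ) ^ 2)⁻¹))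
      (fun k => by positivity) _ (Ioc X q) fun ξ hξ => ?_).trans ?_
    · have h1 := (Finset.mem_filter.1 hξ).2
      have h2 := natAbs_valMinAbs_le ξ
      rw [Finset.mem_Ioc]; omega
    · rw [← Finset.mul_sum, ← Finset.mul_sum]
      have h1 := sum_Ioc_inv_sq_le_sub (α := ℝ) hX.ne' hXq
      have h2 : ∑ i ∈ Ioc X q, ((i : ℝ) ^ 2)⁻¹ ≤ (X : ℝ)⁻¹ :=
        h1.trans (sub_le_self _ (by positivity))
      calc 2 * ((H : ℝ) ^ 2 * ((q : ℝ) ^ 2 / 4 * ∑ i ∈ Ioc X q, ((i : ℝ) ^ 2)⁻¹))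
          ≤ 2 * ((H : ℝ) ^ 2 * ((q : ℝ) ^ 2 / 4 * (X : ℝ)⁻¹)) := by gcongr
        _ = _ := by field_simp; ring
  calc _ ≤ W * (q * L) + (H : ℝ) ^ 2 * ((q : ℝ) ^ 2 / (2 * X)) :=
        add_le_add (hs1.trans hs3) (hs2.trans hs4)
    _ = _ := by
      rw [quadraticVariance, ← hW]
      field_simp

/-- A slowly varying function on `ℤ/q` has nearly its mean as average along a quadratic
sequence. -/
lemma abs_sum_quadratic_sub_le {H L X D : ℕ} (hH : 0 < H) (hL : 0 < L) (hLq : L ≤ q) (hX : 0 < X)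
    (hD : 0 < D) (hXD : 2 * X * D ≤ q) (M : ℕ) (u : (ZMod q)ˣ) (c : ZMod q) (G : ZMod q → ℝ)
    {B ε : ℝ} (hB : ∀ t, |G t| ≤ B) (hG : ∀ t, ∀ s < L, |G (t + s) - G t| ≤ ε) :
    |∑ i ∈ range H, G (u * ((M + i : ℕ) : ZMod q) ^ 2 + c) - H * ((∑ t, G t) / q)| ≤
      H * (ε + B * √(quadraticVariance q H L X D)) := by
  have hH' : (0 : ℝ) < H := by exact_mod_cast hH
  have hL' : (0 : ℝ) < L := by exact_mod_cast hL
  have hq : (0 : ℝ) < q := by exact_mod_cast Nat.pos_of_ne_zero (NeZero.ne q)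
  have hB0 : 0 ≤ B := (abs_nonneg _).trans (hB 0)
  set a : ℕ → ZMod q := fun i => u * ((M + i : ℕ) : ZMod q) ^ 2 + c with ha
  set E := quadraticVariance q H L X D with hE
  -- `n` is the counting function of the sequence smoothed over intervals of length L. Its Fourier
  -- transform is the product of a quadratic and a geometric sum, so Parseval controls its distance
  -- from the mean HL/q, and Cauchy–Schwarz transfers this to `G`.
  set n : ZMod q → ℝ := fun b => ∑ i ∈ range H, ∑ s ∈ range L, if a i + s = b then 1 else 0 with hn
  have hsum : ∀ g : ZMod q → ℂ, ∑ b, (n b : ℂ) * g b =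
      ∑ i ∈ range H, ∑ s ∈ range L, g (a i + s) := fun g => by
    simp only [hn, Complex.ofReal_sum, Finset.sum_mul]
    rw [Finset.sum_comm]
    refine Finset.sum_congr rfl fun i _ => ?_
    rw [Finset.sum_comm]
    refine Finset.sum_congr rfl fun s _ => ?_
    rw [Finset.sum_eq_single (a i + s)] <;> simp +contextual [eq_comm]
  have hfour : ∀ ξ : ZMod q, ∑ b, ((n b - H * L / q : ℝ) : ℂ) * stdAddChar (ξ * b) =
      if ξ = 0 then 0 else (∑ i ∈ range H, stdAddChar (ξ * a i)) *
        ∑ s ∈ range L, stdAddChar (ξ * (s : ZMod q)) := fun ξ => by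
    have h1 : ∑ b, ((n b - H * L / q : ℝ) : ℂ) * stdAddChar (ξ * b) =
        ∑ i ∈ range H, ∑ s ∈ range L, stdAddChar (ξ * (a i + (s : ZMod q))) -
          (H * L / q : ℂ) * ∑ b, stdAddChar (b * ξ) := by
      rw [← hsum (fun b => stdAddChar (ξ * b)), Finset.mul_sum, ← Finset.sum_sub_distrib]
      refine Finset.sum_congr rfl fun b _ => ?_
      push_cast
      rw [mul_comm b ξ]; ring
    rw [h1, AddChar.sum_mulShift _ (isPrimitive_stdAddChar q)]
    have hqc : (q : ℂ) ≠ 0 := by exact_mod_cast hq.ne'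
    split_ifs with h
    · subst h
      simp [ZMod.card]
    · rw [Finset.sum_mul_sum]
      simp only [Nat.cast_zero, mul_zero, sub_zero]
      refine Finset.sum_congr rfl fun i _ => Finset.sum_congr rfl fun s _ => ?_
      rw [mul_add, AddChar.map_add_eq_mul]
  have hvar : q * ∑ b, (n b - H * L / q) ^ 2 ≤ (H * L) ^ 2 * E := by
    have h1 := sum_norm_sq_fourier (q := q) (fun b => ((n b - H * L / q : ℝ) : ℂ))
    simp only [Complex.norm_real, Real.norm_eq_abs, sq_abs] at h1
    rw [← h1, Finset.sum_congr rfl fun ξ _ => by rw [hfour ξ],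
      ← Finset.add_sum_erase _ _ (Finset.mem_univ (0 : ZMod q))]
    simp only [if_true, norm_zero, ne_eq, OfNat.ofNat_ne_zero, not_false_eq_true, zero_pow,
      zero_add]
    refine le_trans (le_of_eq ?_) (sum_erase_norm_sq_mul_le hH hL hLq hX hD hXD M u c)
    refine Finset.sum_congr rfl fun ξ hξ => ?_
    rw [if_neg (Finset.mem_erase.1 hξ).1, norm_mul, mul_pow]
  have hE0 : 0 ≤ E := by
    rw [hE, quadraticVariance]
    have hlog : 0 ≤ Real.log q := Real.log_natCast_nonneg q
    positivity
  have hdual : |∑ b, (n b - H * L / q) * G b| ≤ H * L * (B * √E) := by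
    refine abs_le_of_sq_le_sq ?_ (by positivity)
    calc (∑ b, (n b - H * L / q) * G b) ^ 2
        ≤ (∑ b, (n b - H * L / q) ^ 2) * ∑ b, G b ^ 2 := Finset.sum_mul_sq_le_sq_mul_sq _ _ _
      _ ≤ (∑ b, (n b - H * L / q) ^ 2) * (q * B ^ 2) := by
          refine mul_le_mul_of_nonneg_left ?_ (Finset.sum_nonneg fun _ _ => sq_nonneg _)
          refine (Finset.sum_le_sum fun b _ => sq_le_sq' (abs_le.1 (hB b)).1
            (abs_le.1 (hB b)).2).trans (le_of_eq ?_)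
          simp [ZMod.card]
      _ = (q * ∑ b, (n b - H * L / q) ^ 2) * B ^ 2 := by ring
      _ ≤ (H * L) ^ 2 * E * B ^ 2 := by gcongr
      _ = (H * L * (B * √E)) ^ 2 := by
          rw [mul_pow (H * L : ℝ) (B * √E), mul_pow B, Real.sq_sqrt hE0]; ring
  have hsumG : ∑ b, n b * G b = ∑ i ∈ range H, ∑ s ∈ range L, G (a i + s) := by
    have := hsum (fun b => (G b : ℂ))
    exact_mod_cast this
  have hsmooth : |L * ∑ i ∈ range H, G (a i) - ∑ i ∈ range H, ∑ s ∈ range L, G (a i + s)| ≤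
      H * L * ε := by
    have : L * ∑ i ∈ range H, G (a i) - ∑ i ∈ range H, ∑ s ∈ range L, G (a i + s) =
        ∑ i ∈ range H, ∑ s ∈ range L, (G (a i) - G (a i + s)) := by
      simp [Finset.sum_sub_distrib, Finset.mul_sum]
    rw [this]
    refine (Finset.abs_sum_le_sum_abs _ _).trans ((Finset.sum_le_sum fun i _ =>
      (Finset.abs_sum_le_sum_abs _ _).trans (Finset.sum_le_sum fun s hs => ?_)).trans
      (le_of_eq (?_ : ∑ i ∈ range H, ∑ s ∈ range L, ε = _)))
    · rw [abs_sub_comm]; exact hG _ _ (Finset.mem_range.1 hs)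
    · simp; ring
  have hfin : L * (∑ i ∈ range H, G (a i) - H * ((∑ t, G t) / q)) =
      (L * ∑ i ∈ range H, G (a i) - ∑ i ∈ range H, ∑ s ∈ range L, G (a i + s)) +
        ∑ b, (n b - H * L / q) * G b := by
    simp only [sub_mul, Finset.sum_sub_distrib, hsumG]
    rw [← Finset.mul_sum]; ring
  have habs : L * |∑ i ∈ range H, G (a i) - H * ((∑ t, G t) / q)| ≤
      H * L * ε + H * L * (B * √E) := by
    rw [← abs_of_pos hL', ← abs_mul, hfin, abs_of_pos hL']
    exact (abs_add_le _ _).trans (add_le_add hsmooth hdual)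
  refine le_of_mul_le_mul_left (habs.trans (le_of_eq ?_)) hL'
  ring

end QuadraticEquidistribution

end SpecialFlow


namespace SpecialFlow

/-! ### Choice of the exponents. -/

section QuadraticAsymptotics

/-- `⌈q ^ (3/4)⌉`, the length of the blocks of a quadratic sequence modulo `q`. -/
noncomputable def blockLength (q : ℕ) : ℕ := ⌈(q : ℝ) ^ (3 / 4 : ℝ)⌉₊

/-- `⌈q ^ (4/5)⌉`, the scale up to which functions on `ℤ/q` are required to be almost constant. -/
noncomputable def smoothScale (q : ℕ) : ℕ := ⌈(q : ℝ) ^ (4 / 5 : ℝ)⌉₊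

/-- `⌈q ^ (9/20)⌉`, the frequency at which the exponential sums are truncated. -/
noncomputable def freqCutoff (q : ℕ) : ℕ := ⌈(q : ℝ) ^ (9 / 20 : ℝ)⌉₊

/-- The spacing q/(2X) has order q^{11/20}; the surplus q^{1/20} over q^{1/2} absorbs the constants
and the roundings. -/
lemma eventually_half_le_freqSpacing :
    ∀ᶠ q : ℕ in atTop, (q : ℝ) ^ (1 / 2 : ℝ) ≤ ((q / (2 * freqCutoff q) : ℕ) : ℝ) := by
  have h1 : Tendsto (fun q : ℕ => (q : ℝ) ^ (1 / 20 : ℝ)) atTop atTop :=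
    (tendsto_rpow_atTop (by norm_num)).comp tendsto_natCast_atTop_atTop
  filter_upwards [h1.eventually_ge_atTop 8, eventually_ge_atTop 1] with q hq hq1
  have hq0 : (1 : ℝ) ≤ q := by exact_mod_cast hq1
  have hqp : (0 : ℝ) < q := by linarith
  have hX1 : (1 : ℝ) ≤ (q : ℝ) ^ (9 / 20 : ℝ) := Real.one_le_rpow hq0 (by norm_num)
  have hX2 : (freqCutoff q : ℝ) ≤ 2 * (q : ℝ) ^ (9 / 20 : ℝ) := by
    have := (Nat.ceil_lt_add_one (by positivity : (0 : ℝ) ≤ (q : ℝ) ^ (9 / 20 : ℝ))).le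
    unfold freqCutoff; linarith
  have hX0 : (0 : ℝ) < freqCutoff q :=
    lt_of_lt_of_le (by linarith) (Nat.le_ceil ((q : ℝ) ^ (9 / 20 : ℝ)))
  have hX0' : 0 < freqCutoff q := by exact_mod_cast hX0
  have h2 : (1 : ℝ) ≤ (q : ℝ) ^ (1 / 2 : ℝ) := Real.one_le_rpow hq0 (by norm_num)
  have h3 : (q : ℝ) = q ^ (9 / 20 : ℝ) * (q ^ (1 / 2 : ℝ) * q ^ (1 / 20 : ℝ)) := by
    rw [← Real.rpow_add hqp, ← Real.rpow_add hqp]; norm_num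
  have h4 : 2 * (q : ℝ) ^ (1 / 2 : ℝ) ≤ (q : ℝ) / (2 * freqCutoff q) := by
    rw [le_div_iff₀ (by positivity)]
    have e1 : (q : ℝ) ^ (1 / 2 : ℝ) * 8 ≤ q ^ (1 / 2 : ℝ) * q ^ (1 / 20 : ℝ) := by gcongr
    calc 2 * (q : ℝ) ^ (1 / 2 : ℝ) * (2 * freqCutoff q)
        ≤ 2 * (q : ℝ) ^ (1 / 2 : ℝ) * (2 * (2 * q ^ (9 / 20 : ℝ))) := by gcongr
      _ = q ^ (9 / 20 : ℝ) * (q ^ (1 / 2 : ℝ) * 8) := by ring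
      _ ≤ q ^ (9 / 20 : ℝ) * (q ^ (1 / 2 : ℝ) * q ^ (1 / 20 : ℝ)) := by gcongr
      _ = q := h3.symm
  have h5 : (q : ℝ) / (2 * freqCutoff q) ≤ ((q / (2 * freqCutoff q) : ℕ) : ℝ) + 1 := by
    have := (Nat.lt_floor_add_one ((q : ℝ) / ((2 * freqCutoff q : ℕ) : ℝ))).le
    rw [Nat.floor_div_eq_div] at this
    push_cast at this ⊢
    exact this
  linarith

/-- With D ≥ q^{1/2} the first term is at most q^{1/5} · 4q^{-5/4} · q(3 + log q) = 4(3 + log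
q)q^{-1/20}, and the second, q²/(2XL²), is at most q^{-1/20}/2. -/
lemma tendsto_quadraticVariance :
    Tendsto (fun q : ℕ => quadraticVariance q (blockLength q) (smoothScale q) (freqCutoff q)
      (q / (2 * freqCutoff q))) atTop (𝓝 0) := by
  have hlim : Tendsto (fun q : ℕ => 4 * (3 + Real.log q) / (q : ℝ) ^ (1 / 20 : ℝ) +
      1 / (2 * (q : ℝ) ^ (1 / 20 : ℝ))) atTop (𝓝 0) := by
    have h1 : Tendsto (fun q : ℕ => (q : ℝ) ^ (1 / 20 : ℝ)) atTop atTop :=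
      (tendsto_rpow_atTop (by norm_num)).comp tendsto_natCast_atTop_atTop
    have h2 : Tendsto (fun q : ℕ => Real.log q / (q : ℝ) ^ (1 / 20 : ℝ)) atTop (𝓝 0) :=
      ((isLittleO_log_rpow_atTop (by norm_num : (0 : ℝ) < 1 / 20)).tendsto_div_nhds_zero).comp
        tendsto_natCast_atTop_atTop
    have h3 := h1.inv_tendsto_atTop
    have h4 := ((h3.const_mul 12).add (h2.const_mul 4)).add (h3.const_mul (1 / 2))
    simp only [mul_zero, add_zero] at h4
    refine h4.congr fun q => ?_
    simp only [Pi.inv_apply, mul_inv, div_eq_mul_inv]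
    ring
  refine squeeze_zero' (.of_forall fun q => ?_) ?_ hlim
  · have hlog : 0 ≤ Real.log q := Real.log_natCast_nonneg q
    unfold quadraticVariance; positivity
  filter_upwards [eventually_half_le_freqSpacing, eventually_ge_atTop 1] with q hD hq1
  have hq0 : (1 : ℝ) ≤ q := by exact_mod_cast hq1
  have hqp : (0 : ℝ) < q := by linarith
  have hlog : 0 ≤ Real.log q := Real.log_natCast_nonneg q
  set D : ℝ := ((q / (2 * freqCutoff q) : ℕ) : ℝ) with hDdef
  have hH : (q : ℝ) ^ (3 / 4 : ℝ) ≤ blockLength q := Nat.le_ceil _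
  have hL : (q : ℝ) ^ (4 / 5 : ℝ) ≤ smoothScale q := Nat.le_ceil _
  have hX : (q : ℝ) ^ (9 / 20 : ℝ) ≤ freqCutoff q := Nat.le_ceil _
  have hHq : (blockLength q : ℝ) ≤ 2 * q := by
    have h1 := (Nat.ceil_lt_add_one (by positivity : (0 : ℝ) ≤ (q : ℝ) ^ (3 / 4 : ℝ))).le
    have h2 : (q : ℝ) ^ (3 / 4 : ℝ) ≤ q ^ (1 : ℝ) :=
      Real.rpow_le_rpow_of_exponent_le hq0 (by norm_num)
    rw [Real.rpow_one] at h2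
    unfold blockLength; linarith
  have hDp : 0 < D := lt_of_lt_of_le (by positivity) hD
  have hHp : (0 : ℝ) < blockLength q := lt_of_lt_of_le (by positivity) hH
  have hLp : (0 : ℝ) < smoothScale q := lt_of_lt_of_le (by positivity) hL
  have hXp : (0 : ℝ) < freqCutoff q := lt_of_lt_of_le (by positivity) hX
  rw [quadraticVariance]
  refine add_le_add ?_ ?_
  · have e1 : (q : ℝ) / smoothScale q ≤ q ^ (1 / 5 : ℝ) := by
      rw [div_le_iff₀ hLp]
      calc (q : ℝ) = q ^ (1 / 5 : ℝ) * q ^ (4 / 5 : ℝ) := by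
            rw [← Real.rpow_add hqp]; norm_num
        _ ≤ _ := by gcongr
    have e2 : (2 * (blockLength q : ℝ) / D + 2) / blockLength q ^ 2 ≤ 4 / q ^ (5 / 4 : ℝ) := by
      have e3 : (2 * (blockLength q : ℝ) / D + 2) / blockLength q ^ 2 =
          2 / (blockLength q * D) + 2 / (blockLength q * blockLength q) := by
        field_simp
      have e4 : (q : ℝ) ^ (5 / 4 : ℝ) ≤ blockLength q * D := by
        calc (q : ℝ) ^ (5 / 4 : ℝ) = q ^ (3 / 4 : ℝ) * q ^ (1 / 2 : ℝ) := by
              rw [← Real.rpow_add hqp]; norm_num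
          _ ≤ _ := by gcongr
      have e5 : (q : ℝ) ^ (5 / 4 : ℝ) ≤ blockLength q * blockLength q := by
        calc (q : ℝ) ^ (5 / 4 : ℝ) ≤ q ^ (3 / 2 : ℝ) :=
              Real.rpow_le_rpow_of_exponent_le hq0 (by norm_num)
          _ = q ^ (3 / 4 : ℝ) * q ^ (3 / 4 : ℝ) := by rw [← Real.rpow_add hqp]; norm_num
          _ ≤ _ := by gcongr
      rw [e3]
      calc _ ≤ 2 / (q : ℝ) ^ (5 / 4 : ℝ) + 2 / (q : ℝ) ^ (5 / 4 : ℝ) := by gcongr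
        _ = _ := by ring
    have e6 : (blockLength q : ℝ) + q * (1 + Real.log q) ≤ q * (3 + Real.log q) := by linarith
    calc (q : ℝ) / smoothScale q * ((2 * (blockLength q : ℝ) / D + 2) *
          (blockLength q + q * (1 + Real.log q)) / blockLength q ^ 2)
        = (q : ℝ) / smoothScale q * (((2 * (blockLength q : ℝ) / D + 2) / blockLength q ^ 2) *
          (blockLength q + q * (1 + Real.log q))) := by ring
      _ ≤ q ^ (1 / 5 : ℝ) * (4 / q ^ (5 / 4 : ℝ) * (q * (3 + Real.log q))) := by gcongr
      _ = 4 * (3 + Real.log q) / (q : ℝ) ^ (1 / 20 : ℝ) := by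
          have : (q : ℝ) ^ (5 / 4 : ℝ) = q ^ (1 / 5 : ℝ) * q * q ^ (1 / 20 : ℝ) := by
            rw [← Real.rpow_add_one hqp.ne', ← Real.rpow_add hqp]; norm_num
          rw [this]; field_simp
  · have e1 : (q : ℝ) ^ 2 * q ^ (1 / 20 : ℝ) ≤ freqCutoff q * smoothScale q ^ 2 := by
      calc (q : ℝ) ^ 2 * q ^ (1 / 20 : ℝ) = q ^ (9 / 20 : ℝ) * (q ^ (4 / 5 : ℝ)) ^ 2 := by
            rw [← Real.rpow_natCast (q : ℝ) 2, ← Real.rpow_natCast _ 2, ← Real.rpow_mul hqp.le,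
              ← Real.rpow_add hqp, ← Real.rpow_add hqp]
            norm_num
        _ ≤ _ := by gcongr
    rw [div_le_div_iff₀ (by positivity) (by positivity)]
    nlinarith

/-- Averages of slowly varying functions on `ℤ/q` along blocks of quadratic sequences. -/
theorem eventually_abs_sum_quadratic_sub_le {B ε : ℝ} (hε : 0 < ε) :
    ∀ᶠ q : ℕ in atTop, ∀ [NeZero q] (M : ℕ) (u : (ZMod q)ˣ) (c : ZMod q) (G : ZMod q → ℝ),
      (∀ t, |G t| ≤ B) → (∀ t, ∀ s < smoothScale q, |G (t + s) - G t| ≤ ε) →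
      |∑ i ∈ Finset.range (blockLength q), G (u * ((M + i : ℕ) : ZMod q) ^ 2 + c) -
        blockLength q * ((∑ t, G t) / q)| ≤ blockLength q * (2 * ε) := by
  have h0 : Tendsto (fun q : ℕ => B * √(quadraticVariance q (blockLength q) (smoothScale q)
      (freqCutoff q) (q / (2 * freqCutoff q)))) atTop (𝓝 0) := by
    have := (Real.continuous_sqrt.tendsto 0).comp tendsto_quadraticVariance
    simpa using this.const_mul B
  filter_upwards [h0.eventually_le_const hε, eventually_half_le_freqSpacing,
    eventually_ge_atTop 1] with q h1 hD hq1
  intro _ M u c G hGB hG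
  have hq0 : (1 : ℝ) ≤ q := by exact_mod_cast hq1
  have hqp : (0 : ℝ) < q := by linarith
  have hpos : ∀ e : ℝ, 0 < ⌈(q : ℝ) ^ e⌉₊ := fun e => Nat.ceil_pos.2 (by positivity)
  have hDp : 0 < q / (2 * freqCutoff q) := by
    have : (0 : ℝ) < ((q / (2 * freqCutoff q) : ℕ) : ℝ) := lt_of_lt_of_le (by positivity) hD
    exact_mod_cast this
  have hLq : smoothScale q ≤ q := by
    refine Nat.ceil_le.2 ?_
    have h2 : (q : ℝ) ^ (4 / 5 : ℝ) ≤ q ^ (1 : ℝ) :=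
      Real.rpow_le_rpow_of_exponent_le hq0 (by norm_num)
    rwa [Real.rpow_one] at h2
  have h := abs_sum_quadratic_sub_le (q := q) (H := blockLength q) (L := smoothScale q)
    (X := freqCutoff q) (hpos _) (hpos _) hLq (hpos _) hDp (Nat.mul_div_le _ _) M u c G hGB hG
  refine h.trans (mul_le_mul_of_nonneg_left ?_ (Nat.cast_nonneg _))
  linarith

end QuadraticAsymptotics

end SpecialFlow


namespace SpecialFlow

/-! ### Topology of X_f and continuity of the flow. -/

section Quotient

variable (α : ℝ) (f : UnitAddCircle → ℝ)

/-- The generator `(x, y) ↦ (x + α, y - f x)` of the equivalence relation, as a permutation. -/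
def step : Equiv.Perm (UnitAddCircle × ℝ) where
  toFun p := (p.1 + (α : UnitAddCircle), p.2 - f p.1)
  invFun p := (p.1 - (α : UnitAddCircle), p.2 + f (p.1 - (α : UnitAddCircle)))
  left_inv p := by simp
  right_inv p := by simp

lemma step_apply (p : UnitAddCircle × ℝ) :
    step α f p = (p.1 + (α : UnitAddCircle), p.2 - f p.1) := rfl

lemma step_zpow_add_one (n : ℤ) (p : UnitAddCircle × ℝ) :
    (step α f ^ (n + 1)) p = step α f ((step α f ^ n) p) := by
  rw [add_comm, zpow_add, zpow_one, Equiv.Perm.mul_apply]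

lemma mk_step (p : UnitAddCircle × ℝ) : mk α f (step α f p) = mk α f p :=
  (Quot.sound (show Rel α f p (step α f p) from rfl)).symm

lemma mk_step_zpow (n : ℤ) (p : UnitAddCircle × ℝ) : mk α f ((step α f ^ n) p) = mk α f p := by
  induction n with
  | zero => simp
  | succ n ih => rw [step_zpow_add_one, mk_step, ih]
  | pred n ih =>
    rw [← mk_step, ← step_zpow_add_one, sub_add_cancel, ih]

/-- As `step` is a permutation, the equivalence relation it generates is its orbit relation. -/
lemma mk_eq_mk_iff {p p' : UnitAddCircle × ℝ} :
    mk α f p = mk α f p' ↔ ∃ n : ℤ, (step α f ^ n) p = p' := by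
  constructor
  · intro h
    induction Quot.eqvGen_exact h with
    | rel x y hxy => exact ⟨1, by rw [zpow_one]; exact hxy.symm⟩
    | refl x => exact ⟨0, rfl⟩
    | symm x y hxy ih =>
      obtain ⟨n, hn⟩ := ih (Quot.eqvGen_sound hxy)
      exact ⟨-n, by rw [← hn, ← Equiv.Perm.mul_apply, ← zpow_add]; simp⟩
    | trans x y z hxy hyz ih ih' =>
      obtain ⟨n, hn⟩ := ih (Quot.eqvGen_sound hxy)
      obtain ⟨m, hm⟩ := ih' (Quot.eqvGen_sound hyz)
      exact ⟨m + n, by rw [← hm, ← hn, ← Equiv.Perm.mul_apply, ← zpow_add]⟩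
  · rintro ⟨n, rfl⟩
    exact (mk_step_zpow α f n p).symm

lemma mk_surjective : Function.Surjective (mk α f) := Quot.mk_surjective

variable {α f}

lemma continuous_step (hf : Continuous f) : Continuous (step α f) :=
  (by fun_prop : Continuous fun p : UnitAddCircle × ℝ =>
    (p.1 + (α : UnitAddCircle), p.2 - f p.1))

lemma continuous_step_symm (hf : Continuous f) : Continuous (step α f).symm :=
  (by fun_prop : Continuous fun p : UnitAddCircle × ℝ =>
    (p.1 - (α : UnitAddCircle), p.2 + f (p.1 - (α : UnitAddCircle))))

lemma continuous_step_zpow (hf : Continuous f) (n : ℤ) : Continuous (step α f ^ n) := by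
  have hpow : ∀ n : ℕ, Continuous (step α f ^ n) := fun n => by
    rw [Equiv.Perm.coe_pow]; exact (continuous_step hf).iterate n
  have hinv : ∀ n : ℕ, Continuous ((step α f)⁻¹ ^ n) := fun n => by
    rw [Equiv.Perm.coe_pow]; exact (continuous_step_symm hf).iterate n
  obtain ⟨n, rfl | rfl⟩ := n.eq_nat_or_neg
  · simpa using hpow n
  · simpa using hinv n

lemma continuous_mk : Continuous (mk α f) := continuous_quot_mk

lemma preimage_image_mk (U : Set (UnitAddCircle × ℝ)) :
    mk α f ⁻¹' (mk α f '' U) = ⋃ n : ℤ, (step α f ^ n) ⁻¹' U := by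
  ext p
  simp only [Set.mem_preimage, Set.mem_image, Set.mem_iUnion]
  constructor
  · rintro ⟨p', hp', h⟩
    obtain ⟨n, rfl⟩ := (mk_eq_mk_iff α f).1 h.symm
    exact ⟨n, hp'⟩
  · rintro ⟨n, hn⟩
    exact ⟨_, hn, mk_step_zpow α f n p⟩

lemma isOpenQuotientMap_mk (hf : Continuous f) : IsOpenQuotientMap (mk α f) where
  surjective := mk_surjective α f
  continuous := continuous_mk
  isOpenMap U hU := by
    have h : IsOpen (mk α f ⁻¹' (mk α f '' U)) := by
      rw [preimage_image_mk]
      exact isOpen_iUnion fun n => hU.preimage (continuous_step_zpow hf n)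
    exact h

lemma exists_pos_le (hf : Continuous f) (hpos : ∀ x, 0 < f x) : ∃ c > 0, ∀ x, c ≤ f x := by
  obtain ⟨x, hx⟩ := hf.exists_forall_le (β := UnitAddCircle) (by simp)
  exact ⟨f x, hpos x, hx⟩

lemma exists_le_bound (hf : Continuous f) : ∃ R, ∀ x, f x ≤ R := by
  obtain ⟨R, hR⟩ := (isCompact_range hf).bddAbove
  exact ⟨R, fun x => hR ⟨x, rfl⟩⟩

lemma step_zpow_snd_add_one (n : ℤ) (p : UnitAddCircle × ℝ) :
    ((step α f ^ (n + 1)) p).2 = ((step α f ^ n) p).2 - f ((step α f ^ n) p).1 := by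
  rw [step_zpow_add_one, step_apply]

lemma step_zpow_snd_add_nat_le {c : ℝ} (hc : ∀ x, c ≤ f x) (n : ℤ) (k : ℕ)
    (p : UnitAddCircle × ℝ) :
    ((step α f ^ (n + k)) p).2 ≤ ((step α f ^ n) p).2 - c * k := by
  induction k with
  | zero => simp
  | succ k ih =>
    push_cast
    rw [← add_assoc, step_zpow_snd_add_one]
    have := hc ((step α f ^ (n + k)) p).1
    linarith

lemma step_zpow_snd_le {c : ℝ} (hc : ∀ x, c ≤ f x) {m n : ℤ} (hmn : m ≤ n)
    (p : UnitAddCircle × ℝ) :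
    ((step α f ^ n) p).2 ≤ ((step α f ^ m) p).2 - c * (n - m) := by
  obtain ⟨k, rfl⟩ := Int.le.dest hmn
  have := step_zpow_snd_add_nat_le (α := α) hc m k p
  push_cast
  linarith

/-- Each step lowers the height by at least c = min f > 0, so there is a last exponent at which the
height is nonnegative; that one, and no other, lands in the domain. -/
lemma existsUnique_step_zpow_mem_fundDomain (hf : Continuous f) (hpos : ∀ x, 0 < f x)
    (p : UnitAddCircle × ℝ) : ∃! n : ℤ, (step α f ^ n) p ∈ fundDomain f := by
  obtain ⟨c, hc0, hc⟩ := exists_pos_le hf hpos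
  have hK : |p.2| ≤ c * ⌈|p.2| / c⌉ := by
    rw [← div_le_iff₀' hc0]; exact Int.le_ceil _
  have hK0 : 0 ≤ ⌈|p.2| / c⌉ := Int.ceil_nonneg (by positivity)
  obtain ⟨n, hn, hmax⟩ := Int.exists_greatest_of_bdd (P := fun n => 0 ≤ ((step α f ^ n) p).2)
    (by
      refine ⟨⌈|p.2| / c⌉, fun n hn => ?_⟩
      by_contra! h
      have h1 := step_zpow_snd_le (α := α) hc (hK0.trans h.le) p
      have h2 : (⌈|p.2| / c⌉ : ℝ) < n := by exact_mod_cast h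
      simp only [zpow_zero, Equiv.Perm.coe_one, id_eq, Int.cast_zero, sub_zero] at h1
      have := le_abs_self p.2
      nlinarith)
    (by
      refine ⟨-⌈|p.2| / c⌉, ?_⟩
      have h1 := step_zpow_snd_le (α := α) hc (neg_nonpos.2 hK0) p
      simp only [zpow_zero, Equiv.Perm.coe_one, id_eq, Int.cast_zero] at h1
      push_cast at h1
      have := neg_abs_le p.2
      linarith)
  refine ⟨n, ⟨hn, ?_⟩, fun m hm => ?_⟩
  · by_contra! h
    have := hmax (n + 1) (by rw [step_zpow_snd_add_one]; linarith)
    omega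
  · have h1 := hmax m hm.1
    by_contra hne
    have h2 : m + 1 ≤ n := by omega
    have h3 := step_zpow_snd_le (α := α) hc h2 p
    rw [step_zpow_snd_add_one] at h3
    have h4 := hm.2
    have h5 : (0 : ℝ) ≤ n - ((m + 1 : ℤ) : ℝ) := by
      rw [sub_nonneg]; exact_mod_cast h2
    have h6 := mul_nonneg hc0.le h5
    linarith

lemma exists_fundDomain_rep (hf : Continuous f) (hpos : ∀ x, 0 < f x) (z : Space α f) :
    ∃ p ∈ fundDomain f, mk α f p = z := by
  obtain ⟨p, rfl⟩ := mk_surjective α f z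
  obtain ⟨n, hn, -⟩ := existsUnique_step_zpow_mem_fundDomain (α := α) hf hpos p
  exact ⟨_, hn, mk_step_zpow α f n p⟩

lemma compactSpace (hf : Continuous f) (hpos : ∀ x, 0 < f x) : CompactSpace (Space α f) := by
  obtain ⟨R, hR⟩ := exists_le_bound hf
  refine ⟨?_⟩
  have : (Set.univ : Set (Space α f)) = mk α f '' (Set.univ ×ˢ Set.Icc 0 R) := by
    refine (Set.eq_univ_of_forall fun z => ?_).symm
    obtain ⟨p, hp, rfl⟩ := exists_fundDomain_rep hf hpos z
    exact ⟨p, ⟨trivial, hp.1, hp.2.le.trans (hR _)⟩, rfl⟩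
  rw [this]
  exact (isCompact_univ.prod isCompact_Icc).image continuous_mk

/-- The quotient map is open, so it suffices that the orbit relation is closed. It is the union of
the graphs of `step ^ n`, and this union is locally finite because `step ^ n` changes heights by at
least c|n|. -/
lemma t2Space (hf : Continuous f) (hpos : ∀ x, 0 < f x) : T2Space (Space α f) := by
  rw [t2Space_iff_of_isOpenQuotientMap (isOpenQuotientMap_mk hf)]
  obtain ⟨c, hc0, hc⟩ := exists_pos_le hf hpos
  have : {q : (UnitAddCircle × ℝ) × (UnitAddCircle × ℝ) | mk α f q.1 = mk α f q.2} =
      ⋃ n : ℤ, {q | (step α f ^ n) q.1 = q.2} := by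
    ext q; simp [mk_eq_mk_iff]
  rw [this]
  refine LocallyFinite.isClosed_iUnion ?_ fun n =>
    isClosed_eq ((continuous_step_zpow hf n).comp continuous_fst) continuous_snd
  intro q
  refine ⟨{a | |a.1.2| < |q.1.2| + 1 ∧ |a.2.2| < |q.2.2| + 1}, ?_, ?_⟩
  · refine IsOpen.mem_nhds ?_ ⟨lt_add_one _, lt_add_one _⟩
    exact (isOpen_lt (f := fun a : (UnitAddCircle × ℝ) × (UnitAddCircle × ℝ) => |a.1.2|)
      (by fun_prop) continuous_const).inter
      (isOpen_lt (f := fun a : (UnitAddCircle × ℝ) × (UnitAddCircle × ℝ) => |a.2.2|)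
      (by fun_prop) continuous_const)
  · set K : ℤ := ⌈(|q.1.2| + 1 + (|q.2.2| + 1)) / c⌉ with hK
    refine (Set.finite_Icc (-K) K).subset ?_
    rintro n ⟨a, ha, h1, h2⟩
    have ha : (step α f ^ n) a.1 = a.2 := ha
    have hb : c * |(n : ℝ)| ≤ |a.1.2| + |a.2.2| := by
      have e0 : ((step α f ^ n) a.1).2 = a.2.2 := by rw [ha]
      rcases le_total 0 n with hn | hn
      · have := step_zpow_snd_le (α := α) hc hn a.1
        rw [e0] at this
        simp only [zpow_zero, Equiv.Perm.coe_one, id_eq, Int.cast_zero, sub_zero] at this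
        rw [abs_of_nonneg (by exact_mod_cast hn)]
        have := neg_abs_le a.2.2
        have := le_abs_self a.1.2
        linarith
      · have := step_zpow_snd_le (α := α) hc hn a.1
        rw [e0] at this
        simp only [zpow_zero, Equiv.Perm.coe_one, id_eq, Int.cast_zero, zero_sub] at this
        rw [abs_of_nonpos (by exact_mod_cast hn)]
        have := neg_abs_le a.1.2
        have := le_abs_self a.2.2
        linarith
    have h3 : |(n : ℝ)| ≤ (|q.1.2| + 1 + (|q.2.2| + 1)) / c := by
      rw [le_div_iff₀ hc0]; linarith
    have h4 : |(n : ℝ)| ≤ K := h3.trans (Int.le_ceil _)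
    have h5 : |n| ≤ K := by exact_mod_cast h4
    exact Set.mem_Icc.2 (abs_le.1 h5)

lemma secondCountableTopology (hf : Continuous f) : SecondCountableTopology (Space α f) :=
  (isOpenQuotientMap_mk (α := α) hf).isQuotientMap.secondCountableTopology
    (isOpenQuotientMap_mk hf).isOpenMap

/-! ### The flow -/

lemma flow_mk (t : ℝ) (p : UnitAddCircle × ℝ) :
    flow α f t (mk α f p) = mk α f (p.1, p.2 + t) := rfl

lemma flow_add (s t : ℝ) (z : Space α f) : flow α f s (flow α f t z) = flow α f (t + s) z := by
  obtain ⟨p, rfl⟩ := mk_surjective α f z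
  simp only [flow_mk, add_assoc]

lemma flow_zero (z : Space α f) : flow α f 0 z = z := by
  obtain ⟨p, rfl⟩ := mk_surjective α f z
  simp [flow_mk]

lemma flow_iterate (t : ℝ) (n : ℕ) (z : Space α f) :
    (flow α f t)^[n] z = flow α f (n * t) z := by
  induction n with
  | zero => simp [flow_zero]
  | succ n ih =>
    rw [Function.iterate_succ_apply', ih, flow_add]; congr 1; push_cast; ring

/-- Joint continuity descends because an open quotient map remains one after taking the product with
the identity of ℝ. -/
lemma continuous_flow_uncurry (hf : Continuous f) :
    Continuous fun p : ℝ × Space α f => flow α f p.1 p.2 := by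
  have h : IsOpenQuotientMap (Prod.map (id : ℝ → ℝ) (mk α f)) :=
    IsOpenQuotientMap.id.prodMap (isOpenQuotientMap_mk hf)
  rw [← h.continuous_comp_iff]
  exact continuous_mk.comp (by fun_prop :
    Continuous fun p : ℝ × (UnitAddCircle × ℝ) => (p.2.1, p.2.2 + p.1))

lemma continuous_flow (hf : Continuous f) (t : ℝ) : Continuous (flow α f t) :=
  (continuous_flow_uncurry hf).comp (Continuous.prodMk_right t)

end Quotient

end SpecialFlow


namespace SpecialFlow

/-! ### Lebesgue measure on X_f via fundamental domains. -/

section Measure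

variable {α : ℝ} {f : UnitAddCircle → ℝ}

lemma measurePreserving_step (hf : Continuous f) : MeasurePreserving (step α f) := by
  have h1 : MeasurePreserving (fun x : UnitAddCircle => x + (α : UnitAddCircle)) :=
    measurePreserving_add_right _ _
  refine h1.skew_product (g := fun x y => y - f x) (by fun_prop) (.of_forall fun x => ?_)
  exact (measurePreserving_sub_right volume (f x)).map_eq

lemma measurePreserving_step_symm (hf : Continuous f) : MeasurePreserving (step α f).symm := by
  have h1 : MeasurePreserving (fun x : UnitAddCircle => x - (α : UnitAddCircle)) :=
    measurePreserving_sub_right _ _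
  refine h1.skew_product (g := fun x y => y + f (x - (α : UnitAddCircle))) (by fun_prop)
    (.of_forall fun x => ?_)
  exact (measurePreserving_add_right volume _).map_eq

lemma measurePreserving_step_zpow (hf : Continuous f) (n : ℤ) :
    MeasurePreserving (step α f ^ n) := by
  have hpow : ∀ n : ℕ, MeasurePreserving (step α f ^ n) := fun n => by
    rw [Equiv.Perm.coe_pow]; exact (measurePreserving_step hf).iterate n
  have hinv : ∀ n : ℕ, MeasurePreserving ((step α f)⁻¹ ^ n) := fun n => by
    rw [Equiv.Perm.coe_pow]; exact (measurePreserving_step_symm hf).iterate n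
  obtain ⟨n, rfl | rfl⟩ := n.eq_nat_or_neg
  · simpa using hpow n
  · simpa using hinv n

lemma measurableConstSMul_zpowers (hf : Continuous f) :
    MeasurableConstSMul (Subgroup.zpowers (step α f)) (UnitAddCircle × ℝ) := by
  refine ⟨fun g => ?_⟩
  obtain ⟨g, n, rfl⟩ := g
  exact (measurePreserving_step_zpow hf n).measurable

lemma smulInvariantMeasure_zpowers (hf : Continuous f) :
    SMulInvariantMeasure (Subgroup.zpowers (step α f)) (UnitAddCircle × ℝ) volume := by
  refine ⟨fun g s hs => ?_⟩
  obtain ⟨g, n, rfl⟩ := g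
  exact (measurePreserving_step_zpow hf n).measure_preimage hs.nullMeasurableSet

lemma measurableSet_fundDomain (hf : Continuous f) : MeasurableSet (fundDomain f) :=
  (measurableSet_le measurable_const measurable_snd).inter
    (measurableSet_lt measurable_snd (hf.measurable.comp measurable_fst))

/-- The vertical translation `(x, y) ↦ (x, y + t)`. -/
def vert (t : ℝ) (p : UnitAddCircle × ℝ) : UnitAddCircle × ℝ := (p.1, p.2 + t)

lemma measurePreserving_vert (t : ℝ) : MeasurePreserving (vert t) :=
  (MeasurePreserving.id _).prod (measurePreserving_add_right volume t)

lemma vert_step (t : ℝ) (p : UnitAddCircle × ℝ) :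
    vert t (step α f p) = step α f (vert t p) := by
  simp only [vert, step_apply, Prod.mk.injEq, true_and]; ring

lemma vert_step_zpow (t : ℝ) (n : ℤ) (p : UnitAddCircle × ℝ) :
    vert t ((step α f ^ n) p) = (step α f ^ n) (vert t p) := by
  induction n with
  | zero => simp
  | succ n ih => rw [step_zpow_add_one, step_zpow_add_one, vert_step, ih]
  | pred n ih =>
    apply (step α f).injective
    rw [← vert_step, ← step_zpow_add_one, ← step_zpow_add_one, sub_add_cancel, ih]

/-- Vertical translations commute with `step`, so they carry fundamental domains of the group it
generates to fundamental domains. -/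
lemma isFundamentalDomain_vert (hf : Continuous f) (hpos : ∀ x, 0 < f x) (t : ℝ) :
    IsFundamentalDomain (Subgroup.zpowers (step α f)) (vert t ⁻¹' fundDomain f) volume := by
  refine IsFundamentalDomain.mk'
    ((measurePreserving_vert t).measurable (measurableSet_fundDomain hf)).nullMeasurableSet
    fun p => ?_
  obtain ⟨n, hn, huniq⟩ := existsUnique_step_zpow_mem_fundDomain (α := α) hf hpos (vert t p)
  refine ⟨⟨step α f ^ n, n, rfl⟩, ?_, ?_⟩
  · change vert t ((step α f ^ n) p) ∈ fundDomain f
    rw [vert_step_zpow]; exact hn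
  · rintro ⟨g, m, rfl⟩ hm
    change vert t ((step α f ^ m) p) ∈ fundDomain f at hm
    rw [vert_step_zpow] at hm
    exact Subtype.ext (by simp only [huniq m hm])

lemma vert_zero : vert 0 = id := by ext p <;> simp [vert]

lemma isFundamentalDomain (hf : Continuous f) (hpos : ∀ x, 0 < f x) :
    IsFundamentalDomain (Subgroup.zpowers (step α f)) (fundDomain f) volume := by
  have := isFundamentalDomain_vert (α := α) hf hpos 0
  rwa [vert_zero, Set.preimage_id] at this

lemma preimage_mk_invariant (E : Set (Space α f)) (g : Subgroup.zpowers (step α f)) :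
    (fun p => g • p) ⁻¹' (mk α f ⁻¹' E) = mk α f ⁻¹' E := by
  obtain ⟨g, n, rfl⟩ := g
  ext p
  change mk α f ((step α f ^ n) p) ∈ E ↔ mk α f p ∈ E
  rw [mk_step_zpow]

lemma measurable_mk : Measurable (mk α f) := continuous_mk.measurable

lemma volume_fundDomain (hf : Continuous f) (hpos : ∀ x, 0 < f x) :
    volume (fundDomain f) = ENNReal.ofReal (∫ x, f x) := by
  rw [Measure.volume_eq_prod, Measure.prod_apply (measurableSet_fundDomain hf),
    ofReal_integral_eq_lintegral_ofReal (hf.integrable_of_hasCompactSupport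
      (HasCompactSupport.of_compactSpace f)) (.of_forall fun x => (hpos x).le)]
  refine lintegral_congr fun x => ?_
  have : Prod.mk x ⁻¹' fundDomain f = Set.Ico 0 (f x) := by ext y; simp [fundDomain]
  rw [this, Real.volume_Ico, sub_zero]

lemma integral_roof_pos (hf : Continuous f) (hpos : ∀ x, 0 < f x) : 0 < ∫ x, f x := by
  obtain ⟨c, hc0, hc⟩ := exists_pos_le hf hpos
  have h := integral_mono (μ := (volume : Measure UnitAddCircle)) (integrable_const c)
    (hf.integrable_of_hasCompactSupport (HasCompactSupport.of_compactSpace f)) hc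
  have h1 : (volume : Measure UnitAddCircle).real Set.univ = 1 := by
    simp [measureReal_def]
  rw [integral_const, h1, one_smul] at h
  linarith

lemma volume_fundDomain_ne_zero (hf : Continuous f) (hpos : ∀ x, 0 < f x) :
    volume (fundDomain f) ≠ 0 := by
  rw [volume_fundDomain hf hpos]
  simpa using integral_roof_pos hf hpos

lemma volume_fundDomain_ne_top (hf : Continuous f) (hpos : ∀ x, 0 < f x) :
    volume (fundDomain f) ≠ ⊤ := by
  rw [volume_fundDomain hf hpos]
  exact ENNReal.ofReal_ne_top

lemma lebesgue_apply {E : Set (Space α f)} (hE : MeasurableSet E) :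
    lebesgue α f E = (volume (fundDomain f))⁻¹ * volume (mk α f ⁻¹' E ∩ fundDomain f) := by
  rw [lebesgue, Measure.smul_apply, Measure.map_apply measurable_mk hE,
    Measure.restrict_apply (measurable_mk hE), smul_eq_mul]

lemma isProbabilityMeasure_lebesgue (hf : Continuous f) (hpos : ∀ x, 0 < f x) :
    IsProbabilityMeasure (lebesgue α f) := by
  refine ⟨?_⟩
  rw [lebesgue_apply MeasurableSet.univ, Set.preimage_univ, Set.univ_inter]
  exact ENNReal.inv_mul_cancel (volume_fundDomain_ne_zero hf hpos)
    (volume_fundDomain_ne_top hf hpos)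

/-- The flow replaces the fundamental domain by a vertical translate of it, and a set saturated
under the group has the same measure in any two fundamental domains. -/
lemma measurePreserving_flow (hf : Continuous f) (hpos : ∀ x, 0 < f x) (t : ℝ) :
    MeasurePreserving (flow α f t) (lebesgue α f) (lebesgue α f) := by
  have := measurableConstSMul_zpowers (α := α) hf
  have := smulInvariantMeasure_zpowers (α := α) hf
  have hm : Measurable (flow α f t) := (continuous_flow hf t).measurable
  refine ⟨hm, ?_⟩
  ext E hE
  rw [Measure.map_apply hm hE, lebesgue_apply (hm hE), lebesgue_apply hE]
  congr 1
  have h1 : mk α f ⁻¹' (flow α f t ⁻¹' E) ∩ fundDomain f =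
      vert t ⁻¹' (mk α f ⁻¹' E ∩ vert (-t) ⁻¹' fundDomain f) := by
    ext p
    simp only [Set.mem_inter_iff, Set.mem_preimage, flow_mk, vert, add_neg_cancel_right]
  rw [h1, (measurePreserving_vert t).measure_preimage
    ((measurable_mk hE).inter ((measurePreserving_vert _).measurable
      (measurableSet_fundDomain hf))).nullMeasurableSet]
  exact (isFundamentalDomain_vert hf hpos (-t)).measure_set_eq (isFundamentalDomain hf hpos)
    (measurable_mk hE) (preimage_mk_invariant E)

/-- A saturated set that is null in one fundamental domain is null, being covered by countably many
translates. Almost-everywhere statements can thus be moved between X_f and 𝕋 × ℝ. -/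
lemma measure_preimage_mk_eq_zero (hf : Continuous f) (hpos : ∀ x, 0 < f x) {E : Set (Space α f)}
    (hE : MeasurableSet E) : lebesgue α f E = 0 ↔ volume (mk α f ⁻¹' E) = 0 := by
  have := measurableConstSMul_zpowers (α := α) hf
  have := smulInvariantMeasure_zpowers (α := α) hf
  rw [lebesgue_apply hE]
  constructor
  · intro h
    refine (isFundamentalDomain (α := α) hf hpos).measure_zero_of_invariant _ (fun g => ?_) ?_
    · rw [← Set.preimage_smul_inv]; exact preimage_mk_invariant E _
    · exact (mul_eq_zero.1 h).resolve_left
        (ENNReal.inv_ne_zero.2 (volume_fundDomain_ne_top hf hpos))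
  · intro h
    rw [measure_mono_null Set.inter_subset_left h, mul_zero]

lemma ae_lebesgue_iff (hf : Continuous f) (hpos : ∀ x, 0 < f x) {P : Space α f → Prop}
    (hP : MeasurableSet {z | P z}) :
    (∀ᵐ z ∂lebesgue α f, P z) ↔ ∀ᵐ p : UnitAddCircle × ℝ, P (mk α f p) := by
  rw [ae_iff, ae_iff]
  exact measure_preimage_mk_eq_zero hf hpos hP.compl

lemma integral_lebesgue (hf : Continuous f) (hpos : ∀ x, 0 < f x) (h : C(Space α f, ℝ)) :
    ∫ z, h z ∂lebesgue α f =
      (∫ x, f x)⁻¹ * ∫ x, ∫ y in (0 : ℝ)..f x, h (mk α f (x, y)) := by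
  have hc : CompactSpace (Space α f) := compactSpace hf hpos
  have hI := integral_roof_pos hf hpos
  obtain ⟨R, hR⟩ : ∃ R, ∀ z, ‖h z‖ ≤ R := by
    obtain ⟨R, hR⟩ := (isCompact_range h.continuous.norm).bddAbove
    exact ⟨R, fun x => hR ⟨x, rfl⟩⟩
  have hcont : Continuous fun p : UnitAddCircle × ℝ => h (mk α f p) :=
    h.continuous.comp continuous_mk
  have hint : IntegrableOn (fun p : UnitAddCircle × ℝ => h (mk α f p)) (fundDomain f) :=
    Measure.integrableOn_of_bounded (volume_fundDomain_ne_top hf hpos)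
      hcont.aestronglyMeasurable (M := R) (.of_forall fun p => hR _)
  rw [lebesgue, integral_smul_measure, integral_map measurable_mk.aemeasurable
    h.continuous.aestronglyMeasurable, volume_fundDomain hf hpos,
    ENNReal.toReal_inv, ENNReal.toReal_ofReal hI.le, smul_eq_mul]
  congr 1
  rw [← integral_indicator (measurableSet_fundDomain hf), Measure.volume_eq_prod,
    integral_prod _ ((integrable_indicator_iff (measurableSet_fundDomain hf)).2 hint)]
  refine integral_congr_ae (.of_forall fun x => ?_)
  simp only
  rw [intervalIntegral.integral_of_le (hpos x).le, ← integral_Ico_eq_integral_Ioc,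
    ← integral_indicator measurableSet_Ico]
  refine integral_congr_ae (.of_forall fun y => ?_)
  beta_reduce
  by_cases hy : 0 ≤ y ∧ y < f x
  · rw [Set.indicator_of_mem (show (x, y) ∈ fundDomain f from hy),
      Set.indicator_of_mem (show y ∈ Set.Ico 0 (f x) from hy)]
  · rw [Set.indicator_of_notMem (show (x, y) ∉ fundDomain f from hy),
      Set.indicator_of_notMem (show y ∉ Set.Ico 0 (f x) from hy)]

end Measure

end SpecialFlow


namespace SpecialFlow

/-! ### Tools for eigenfunctions: the twisted cohomological equation and Fourier uniqueness. -/

section Eigenfunction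

/-- `e x = exp (2 π i x)`. -/
noncomputable def e (x : ℝ) : ℂ := Complex.exp (2 * Real.pi * Complex.I * x)

lemma e_add (x y : ℝ) : e (x + y) = e x * e y := by
  rw [e, e, e, ← Complex.exp_add]; congr 1; push_cast; ring

lemma e_zero : e 0 = 1 := by simp [e]

lemma e_ne_zero (x : ℝ) : e x ≠ 0 := Complex.exp_ne_zero _

lemma e_neg (x : ℝ) : e (-x) = (e x)⁻¹ := by
  exact eq_inv_of_mul_eq_one_left (by rw [← e_add, neg_add_cancel, e_zero])

lemma norm_e (x : ℝ) : ‖e x‖ = 1 := by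
  rw [e, show 2 * (Real.pi : ℂ) * Complex.I * x = ((2 * Real.pi * x : ℝ) : ℂ) * Complex.I by
    push_cast; ring]
  exact Complex.norm_exp_ofReal_mul_I _

lemma e_int (n : ℤ) : e n = 1 := by
  rw [e, Complex.exp_eq_one_iff]
  exact ⟨n, by push_cast; ring⟩

lemma continuous_e : Continuous e := by unfold e; fun_prop

lemma e_eq_e_iff {x y : ℝ} : e x = e y ↔ (x : UnitAddCircle) = y := by
  rw [e, e, Complex.exp_eq_exp_iff_exists_int, ← sub_eq_zero (a := (x : UnitAddCircle)),
    ← AddCircle.coe_sub, AddCircle.coe_eq_zero_iff]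
  have hI : (2 * Real.pi * Complex.I : ℂ) ≠ 0 := Complex.two_pi_I_ne_zero
  refine exists_congr fun n => ?_
  rw [show 2 * (Real.pi : ℂ) * Complex.I * y + n * (2 * Real.pi * Complex.I) =
    2 * Real.pi * Complex.I * (y + n : ℝ) by push_cast; ring, mul_right_inj' hI]
  norm_cast
  constructor <;> intro h <;> simp at * <;> linarith

lemma exists_e_eq {w : ℂ} (hw : ‖w‖ = 1) : ∃ θ : ℝ, e θ = w := by
  refine ⟨Complex.arg w / (2 * Real.pi), ?_⟩
  have h := Complex.norm_mul_exp_arg_mul_I w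
  rw [hw, Complex.ofReal_one, one_mul] at h
  have hpi : (Real.pi : ℂ) ≠ 0 := by exact_mod_cast Real.pi_ne_zero
  have h2 : 2 * (Real.pi : ℂ) * Complex.I * ((Complex.arg w / (2 * Real.pi) : ℝ) : ℂ) =
      Complex.arg w * Complex.I := by
    push_cast; field_simp
  rw [e, h2, h]

lemma ergodic_rotation {α : ℝ} (hα : Irrational α) :
    Ergodic (fun x : UnitAddCircle => x + (α : UnitAddCircle)) := by
  rw [AddCircle.ergodic_add_right, addOrderOf_eq_zero_iff']
  intro n hn h
  rw [← AddCircle.coe_nsmul, AddCircle.coe_eq_zero_iff] at h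
  obtain ⟨m, hm⟩ := h
  refine hα ⟨m / n, ?_⟩
  have hn' : (n : ℝ) ≠ 0 := by exact_mod_cast hn.ne'
  simp only [zsmul_eq_mul, mul_one, nsmul_eq_mul] at hm
  push_cast
  rw [hm]; field_simp

variable {α C : ℝ} {g : C(UnitAddCircle, ℝ)}

/-- The twisted cohomological equation over the rotation has no nonzero measurable solution. -/
lemma GoodRoof.ae_eq_zero (hα : Irrational α) (hg : GoodRoof α g) {s : ℝ} (hs : s ≠ 0)
    {φ : UnitAddCircle → ℂ} (hφ : Measurable φ)
    (h : ∀ᵐ x, φ (x + (α : UnitAddCircle)) = e (s * (g x + C)) * φ x) : ∀ᵐ x, φ x = 0 := by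
  -- The twist is unimodular, so ‖φ‖ is invariant under the rotation and therefore almost everywhere
  -- a constant c.
  have hinv : (fun x => ‖φ x‖) ∘ (fun x => x + (α : UnitAddCircle)) =ᵐ[volume]
      fun x => ‖φ x‖ := by
    filter_upwards [h] with x hx
    simp [hx, norm_e]
  obtain ⟨c, hc⟩ := (ergodic_rotation hα).ae_eq_const_of_ae_eq_comp₀
    hφ.norm.nullMeasurable hinv
  rcases eq_or_ne c 0 with rfl | hc0
  · filter_upwards [hc] with x hx
    simpa using hx
  exfalso
  -- If c ≠ 0, comparing arguments in the equation gives s g(x) = ψ(x + α) − ψ(x) − sC mod 1 with ψ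
  -- = arg φ / 2π.
  refine hg.no_solution s hs (-(s * C)) ⟨fun x => Complex.arg (φ x) / (2 * Real.pi),
    (Complex.measurable_arg.comp hφ).div_const _, ?_⟩
  have hc' : ∀ᵐ x, ‖φ (x + (α : UnitAddCircle))‖ = c :=
    (measurePreserving_add_right volume (α : UnitAddCircle)).quasiMeasurePreserving.ae
      (p := fun x => ‖φ x‖ = c) hc
  have hpol : ∀ w : ℂ, ‖w‖ * e (Complex.arg w / (2 * Real.pi)) = w := fun w => by
    conv_rhs => rw [← Complex.norm_mul_exp_arg_mul_I w]
    rw [e]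
    congr 2
    push_cast
    have : (Real.pi : ℂ) ≠ 0 := by exact_mod_cast Real.pi_ne_zero
    field_simp
  have hcc : (c : ℂ) ≠ 0 := by exact_mod_cast hc0
  filter_upwards [h, hc, hc'] with x hx h1 h2
  have h1 : ‖φ x‖ = c := h1
  generalize g x = gx at *
  generalize φ (x + (α : UnitAddCircle)) = w at *
  generalize φ x = v at *
  have h3 : e (Complex.arg w / (2 * Real.pi)) =
      e (s * (gx + C) + Complex.arg v / (2 * Real.pi)) := by
    apply mul_left_cancel₀ hcc
    have hv := hpol v
    have hw := hpol w
    rw [h1] at hv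
    rw [h2] at hw
    rw [hw, hx, e_add]
    linear_combination (-(e (s * (gx + C)))) * hv
  rw [← e_eq_e_iff, show s * gx = (s * (gx + C) + Complex.arg v / (2 * Real.pi)) +
    (-(Complex.arg v / (2 * Real.pi)) - s * C) by ring, e_add, ← h3, ← e_add]
  congr 1
  ring

lemma intervalIntegrable_of_bounded {P : ℝ → ℂ} (hP : Measurable P) {B : ℝ}
    (hB : ∀ y, ‖P y‖ ≤ B) (a b : ℝ) : IntervalIntegrable P volume a b :=
  (intervalIntegrable_const (c := B)).mono_fun hP.aestronglyMeasurable
    (.of_forall fun y => (hB y).trans (le_abs_self B))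

lemma intervalIntegral_shift_of_ae_periodic {P : ℝ → ℂ} (hP : Measurable P) {B : ℝ}
    (hB : ∀ y, ‖P y‖ ≤ B) (hper : ∀ᵐ y, P (y + C) = P y) (a : ℝ) :
    ∫ y in a..a + C, P y = ∫ y in 0..C, P y := by
  have hI := intervalIntegrable_of_bounded hP hB
  have h1 : ∫ y in C..a + C, P y = ∫ y in 0..a, P y := by
    have := intervalIntegral.integral_comp_add_right (a := 0) (b := a) P C
    rw [zero_add] at this
    rw [← this]
    exact intervalIntegral.integral_congr_ae (hper.mono fun y hy _ => hy)
  rw [← intervalIntegral.integral_add_adjacent_intervals (hI a C) (hI C _), h1,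
    ← intervalIntegral.integral_add_adjacent_intervals (hI 0 a) (hI a C), add_comm]

/-- Multiplication by e(−θy/C) turns the shifted frequencies (θ + k)/C into the ordinary ones k/C,
and Parseval applies. -/
lemma ae_eq_zero_of_fourier (hC : 0 < C) {P : ℝ → ℂ} (hP : Measurable P) {B : ℝ}
    (hB : ∀ y, ‖P y‖ ≤ B) (θ : ℝ)
    (h : ∀ k : ℤ, ∫ y in 0..C, P y * e (-((θ + k) / C * y)) = 0) :
    ∀ᵐ y, y ∈ Set.Ioc 0 C → P y = 0 := by
  set Q : ℝ → ℂ := fun y => P y * e (-(θ / C * y)) with hQ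
  have hQm : Measurable Q := hP.mul (continuous_e.measurable.comp (by fun_prop))
  have hQB : ∀ y, ‖Q y‖ ≤ B := fun y => by
    simp only [hQ, norm_mul, norm_e, mul_one, hB y]
  have hcoef : ∀ k : ℤ, fourierCoeffOn hC Q k = 0 := fun k => by
    rw [fourierCoeffOn_eq_integral]
    have : ∫ y in 0..C, fourier (-k) (y : AddCircle (C - 0)) • Q y =
        ∫ y in 0..C, P y * e (-((θ + k) / C * y)) := by
      refine intervalIntegral.integral_congr fun y _ => ?_
      have hk : fourier (-k) (y : AddCircle (C - 0)) = e (-(k / C * y)) := by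
        rw [fourier_coe_apply, e]
        congr 1
        push_cast
        rw [sub_zero]
        ring
      rw [hk, smul_eq_mul, show -((θ + k) / C * y) = -(θ / C * y) + -(k / C * y) by ring, e_add]
      ring
    rw [this, h k, smul_zero]
  have hL2 : MemLp Q 2 (volume.restrict (Set.Ioc 0 C)) :=
    MemLp.of_bound hQm.aestronglyMeasurable B (.of_forall hQB)
  have hsum := hasSum_sq_fourierCoeffOn hC hL2
  simp only [hcoef, norm_zero, ne_eq, OfNat.ofNat_ne_zero, not_false_eq_true, zero_pow] at hsum
  have h0 := hsum.unique hasSum_zero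
  have h1 : ∫ y in 0..C, ‖Q y‖ ^ 2 = 0 := by
    rw [smul_eq_mul] at h0
    exact (mul_eq_zero.1 h0).resolve_left (by simp [hC.ne'])
  rw [intervalIntegral.integral_of_le hC.le, setIntegral_eq_zero_iff_of_nonneg_ae
    (.of_forall fun y => by positivity)] at h1
  · have h2 := (ae_restrict_iff' measurableSet_Ioc).1 h1
    filter_upwards [h2] with y hy hyC
    have := hy hyC
    simp only [Pi.zero_apply, ne_eq, OfNat.ofNat_ne_zero, not_false_eq_true, pow_eq_zero_iff,
      norm_eq_zero, hQ, mul_eq_zero, e_ne_zero, or_false] at this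
    exact this
  · exact Measure.integrableOn_of_bounded (M := B ^ 2) (by simp)
      (hQm.norm.pow_const 2).aestronglyMeasurable (.of_forall fun y => by
        rw [norm_pow, norm_norm]; exact pow_le_pow_left₀ (norm_nonneg _) (hQB y) 2)

end Eigenfunction

end SpecialFlow


namespace SpecialFlow

/-! ### Eigenfunctions of the time-C map are constant. -/

section TimeMap

variable {α C : ℝ} {g : C(UnitAddCircle, ℝ)}

/-- Almost everywhere W(x, y + nC) = μⁿ W(x, y) for all n at once, so vanishing spreads from the
strip 0 < y ≤ C. -/
lemma ae_zero_of_ae_zero_fundamental_strip (hC : 0 < C) {W : UnitAddCircle × ℝ → ℂ} {μ : ℂ}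
    (hμ : μ ≠ 0) (hW : ∀ᵐ p, W (vert C p) = μ * W p)
    (h0 : ∀ᵐ p : UnitAddCircle × ℝ, p.2 ∈ Set.Ioc 0 C → W p = 0) : ∀ᵐ p, W p = 0 := by
  have hvert : ∀ n : ℤ, ∀ P : UnitAddCircle × ℝ → Prop, (∀ᵐ p, P p) →
      ∀ᵐ p, P (vert (n * C) p) := fun n P hP =>
    (measurePreserving_vert (n * C)).quasiMeasurePreserving.ae hP
  have h1 := ae_all_iff.2 fun n : ℤ => hvert n _ hW
  have h2 := ae_all_iff.2 fun n : ℤ => hvert n _ h0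
  filter_upwards [h1, h2] with p hp1 hp2
  have hstep : ∀ n : ℤ, W (vert ((n + 1 : ℤ) * C) p) = 0 ↔ W (vert (n * C) p) = 0 := fun n => by
    have h3 : vert ((n + 1 : ℤ) * C) p = vert C (vert (n * C) p) := by
      simp only [vert, Prod.mk.injEq, true_and]; push_cast; ring
    rw [h3, hp1 n, mul_eq_zero, or_iff_right hμ]
  have hall : ∀ n : ℤ, W (vert (n * C) p) = 0 ↔ W p = 0 := fun n => by
    induction n with
    | zero => simp [vert]
    | succ n ih => rw [hstep, ih]
    | pred n ih => rw [← ih, ← hstep, sub_add_cancel]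
  obtain ⟨n, hn, -⟩ := existsUnique_add_zsmul_mem_Ioc hC p.2 0
  rw [zsmul_eq_mul, zero_add] at hn
  exact (hall n).1 (hp2 n hn)

/-- The Fourier coefficients, along the fibres, of an eigenfunction of the time-`C` map. -/
noncomputable def fibreCoeff (C s : ℝ) (W : UnitAddCircle × ℝ → ℂ) (x : UnitAddCircle) : ℂ :=
  ∫ y in 0..C, W (x, y) * e (-(s * y))

lemma measurable_fibreCoeff (hC : 0 < C) (s : ℝ) {W : UnitAddCircle × ℝ → ℂ} (hW : Measurable W) :
    Measurable (fibreCoeff C s W) := by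
  have h : StronglyMeasurable (Function.uncurry fun (x : UnitAddCircle) (y : ℝ) =>
      W (x, y) * e (-(s * y))) :=
    (hW.mul (continuous_e.measurable.comp (by fun_prop))).stronglyMeasurable
  have := (h.integral_prod_right (ν := volume.restrict (Set.Ioc 0 C))).measurable
  convert this using 2 with x
  exact intervalIntegral.integral_of_le hC.le

/-- For s = (θ + k)/C the function W(x, y)e(−sy) is C-periodic in y. Moving from x to x + α
translates the fibre by g(x) + C, which leaves the integral over a period unchanged and only
produces the factor e(s(g(x) + C)). -/
lemma fibreCoeff_add (hC : 0 < C) {θ : ℝ} {W : UnitAddCircle × ℝ → ℂ} (hW : Measurable W) {B : ℝ}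
    (hB : ∀ p, ‖W p‖ ≤ B)
    (hinv : ∀ x y, W (x + (α : UnitAddCircle), y) = W (x, y + (g x + C)))
    (hper : ∀ᵐ p, W (vert C p) = e θ * W p) (k : ℤ) :
    ∀ᵐ x, fibreCoeff C ((θ + k) / C) W (x + (α : UnitAddCircle)) =
      e ((θ + k) / C * (g x + C)) * fibreCoeff C ((θ + k) / C) W x := by
  have h1 : ∀ᵐ x : UnitAddCircle, ∀ᵐ y : ℝ, W (vert C (x, y)) = e θ * W (x, y) :=
    Measure.ae_ae_of_ae_prod hper
  filter_upwards [h1] with x hx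
  set s := (θ + k) / C with hs
  set P : ℝ → ℂ := fun y => W (x, y) * e (-(s * y)) with hP
  have hPm : Measurable P :=
    (hW.comp measurable_prodMk_left).mul (continuous_e.measurable.comp (by fun_prop))
  have hPB : ∀ y, ‖P y‖ ≤ B := fun y => by
    simp only [hP, norm_mul, norm_e, mul_one, hB]
  have hPper : ∀ᵐ y, P (y + C) = P y := by
    filter_upwards [hx] with y hy
    have h2 : -(s * (y + C)) = -(s * y) + (-θ + (-k : ℤ)) := by
      rw [hs]; push_cast; field_simp; ring
    have h3 : W (x, y + C) = e θ * W (x, y) := hy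
    simp only [hP]
    rw [h3, h2, e_add, e_add, e_int, mul_one, e_neg θ]
    field_simp [e_ne_zero]
  have h4 := intervalIntegral_shift_of_ae_periodic hPm hPB hPper (g x + C)
  rw [fibreCoeff, fibreCoeff, ← h4]
  have h5 := intervalIntegral.integral_comp_add_right (a := 0) (b := C) P (g x + C)
  rw [zero_add, add_comm C] at h5
  rw [← h5, ← intervalIntegral.integral_const_mul]
  refine intervalIntegral.integral_congr fun y _ => ?_
  simp only [hP]
  rw [hinv, show -(s * (y + (g x + C))) = -(s * (g x + C)) + -(s * y) by ring, e_add,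
    e_neg (s * (g x + C))]
  field_simp [e_ne_zero]

/-- A bounded eigenfunction of the time-`C` map whose resonant fibre coefficients vanish is zero. -/
lemma ae_eq_zero_of_fibreCoeff (hα : Irrational α) (hg : GoodRoof α g) (hC : 0 < C) {θ : ℝ}
    {W : UnitAddCircle × ℝ → ℂ} (hW : Measurable W) {B : ℝ}
    (hB : ∀ p, ‖W p‖ ≤ B)
    (hinv : ∀ x y, W (x + (α : UnitAddCircle), y) = W (x, y + (g x + C)))
    (hper : ∀ᵐ p, W (vert C p) = e θ * W p)
    (hres : ∀ k : ℤ, θ + k = 0 → ∀ᵐ x, fibreCoeff C ((θ + k) / C) W x = 0) :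
    ∀ᵐ p, W p = 0 := by
  have hall : ∀ᵐ x, ∀ k : ℤ, fibreCoeff C ((θ + k) / C) W x = 0 := by
    refine ae_all_iff.2 fun k => ?_
    by_cases hk : θ + k = 0
    · exact hres k hk
    · exact hg.ae_eq_zero hα (div_ne_zero hk hC.ne') (measurable_fibreCoeff hC _ hW)
        (fibreCoeff_add hC hW hB hinv hper k)
  refine ae_zero_of_ae_zero_fundamental_strip hC (e_ne_zero θ) hper ?_
  have hset : MeasurableSet {p : UnitAddCircle × ℝ | p.2 ∈ Set.Ioc 0 C → W p = 0} :=
    (measurable_snd measurableSet_Ioc).imp (hW (measurableSet_singleton 0))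
  refine (Measure.ae_prod_iff_ae_ae hset).2 ?_
  filter_upwards [hall] with x hx
  exact ae_eq_zero_of_fourier hC (hW.comp measurable_prodMk_left) (fun y => hB _) θ hx

/-- Bounded eigenfunctions of the time-`C` map are constant. -/
lemma ae_eq_const_of_eigenfunction (hα : Irrational α) (hg : GoodRoof α g)
    {f : UnitAddCircle → ℝ} (hfg : f = fun x => g x + C) (hpos : ∀ x, 0 < f x) (hC : 0 < C) {F : Space α f → ℂ}
    (hF : Measurable F) {B : ℝ} (hB : ∀ z, ‖F z‖ ≤ B) {μ : ℂ} (hμ : ‖μ‖ = 1)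
    (h : ∀ᵐ z ∂lebesgue α f, F (flow α f C z) = μ * F z) :
    ∃ c, ∀ᵐ z ∂lebesgue α f, F z = c := by
  have hf : Continuous f := by rw [hfg]; fun_prop
  have hflow : Measurable (flow α f C) := (continuous_flow hf C).measurable
  have hinv : ∀ x y, F (mk α f (x + (α : UnitAddCircle), y)) =
      F (mk α f (x, y + (g x + C))) := fun x y => by
    rw [← mk_step α f (x, y + (g x + C)), step_apply]
    simp [hfg]
  have hmain : ∀ (θ : ℝ) (F : Space α f → ℂ) (B : ℝ), Measurable F → (∀ z, ‖F z‖ ≤ B) →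
      (∀ᵐ z ∂lebesgue α f, F (flow α f C z) = e θ * F z) →
      ∀ᵐ p, F (mk α f (vert C p)) = e θ * F (mk α f p) := by
    intro θ F B hF hB h
    exact (ae_lebesgue_iff hf hpos
      (measurableSet_eq_fun (hF.comp hflow) (hF.const_mul _))).1 h
  have hconst : ∀ (F : Space α f → ℂ) (c : ℂ), Measurable F →
      (∀ᵐ p, F (mk α f p) = c) → ∀ᵐ z ∂lebesgue α f, F z = c := by
    intro F c hF h
    exact (ae_lebesgue_iff hf hpos (measurableSet_eq_fun hF measurable_const)).2 h
  -- The resonance θ + k = 0 can occur only for the eigenvalue 1. There the coefficient of frequency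
  -- 0 is invariant under the rotation, hence a constant c, and subtracting c/C from the
  -- eigenfunction removes it.
  by_cases h1 : μ = 1
  · subst h1
    have hper := hmain 0 F B hF hB (by simpa [e_zero] using h)
    have hadd := fibreCoeff_add (g := g) hC (hF.comp (measurable_mk (α := α) (f := f)))
      (fun p => hB _) hinv hper 0
    have hc : ∃ c, ∀ᵐ x, fibreCoeff C 0 (F ∘ mk α f) x = c := by
      refine (ergodic_rotation hα).ae_eq_const_of_ae_eq_comp₀
        (measurable_fibreCoeff hC 0 (hF.comp measurable_mk)).nullMeasurable ?_
      filter_upwards [hadd] with x hx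
      simpa [e_zero] using hx
    obtain ⟨c, hc⟩ := hc
    refine ⟨c / C, hconst F _ hF ?_⟩
    have hz := ae_eq_zero_of_fibreCoeff (θ := 0) (C := C) (g := g) (B := B + ‖c / C‖) hα hg hC
      (W := fun p => F (mk α f p) - c / C) ((hF.comp measurable_mk).sub_const _)
      (fun p => (norm_sub_le _ _).trans (by gcongr; exact hB _))
      (fun x y => by rw [hinv]) (by
        filter_upwards [hper] with p hp
        rw [hp, e_zero, one_mul, one_mul]) (by
        intro k hk
        have hk0 : k = 0 := by exact_mod_cast (zero_add (k : ℝ)).symm.trans hk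
        subst hk0
        filter_upwards [hc] with x hx
        have hI : IntervalIntegrable (fun y => F (mk α f (x, y))) volume 0 C :=
          intervalIntegrable_of_bounded ((hF.comp measurable_mk).comp measurable_prodMk_left)
            (fun y => hB _) 0 C
        simp only [fibreCoeff, Int.cast_zero, add_zero, zero_div, zero_mul, neg_zero, e_zero,
          mul_one, Function.comp_apply] at hx ⊢
        rw [intervalIntegral.integral_sub hI intervalIntegrable_const, hx,
          intervalIntegral.integral_const]
        have : (C : ℂ) ≠ 0 := by exact_mod_cast hC.ne'
        simp only [sub_zero, Complex.real_smul]
        field_simp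
        simp)
    filter_upwards [hz] with p hp
    exact sub_eq_zero.1 hp
  · obtain ⟨θ, rfl⟩ := exists_e_eq hμ
    have hper := hmain θ F B hF hB h
    refine ⟨0, hconst F 0 hF ?_⟩
    refine ae_eq_zero_of_fibreCoeff (C := C) (g := g) hα hg hC
      (W := fun p => F (mk α f p)) (hF.comp measurable_mk) (fun p => hB _) hinv hper ?_
    intro k hk
    exfalso
    apply h1
    rw [show θ = ((-k : ℤ) : ℝ) by push_cast; linarith, e_int]

/-- Measurable eigenfunctions of the time-`C` map are constant. -/
lemma ae_eq_const_of_eigenfunction' (hα : Irrational α) (hg : GoodRoof α g)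
    {f : UnitAddCircle → ℝ} (hfg : f = fun x => g x + C) (hpos : ∀ x, 0 < f x) (hC : 0 < C) {F : Space α f → ℂ}
    (hF : Measurable F) {μ : ℂ} (hμ : ‖μ‖ = 1)
    (h : ∀ᵐ z ∂lebesgue α f, F (flow α f C z) = μ * F z) :
    ∃ c, ∀ᵐ z ∂lebesgue α f, F z = c := by
  have hb : ∀ w : ℂ, (0 : ℝ) < 1 + ‖w‖ := fun w => by positivity
  -- The map w ↦ w/(1 + |w|) commutes with multiplication by unimodular numbers and takes values in
  -- the unit disc, which reduces to the bounded case; its inverse is c ↦ c/(1 − |c|).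
  obtain ⟨c, hc⟩ := ae_eq_const_of_eigenfunction (F := fun z => F z / ((1 + ‖F z‖ : ℝ) : ℂ))
    (B := 1) hα hg hfg hpos hC (hF.div (Complex.measurable_ofReal.comp (hF.norm.const_add 1)))
    (fun z => by
      rw [norm_div, Complex.norm_real, Real.norm_of_nonneg (hb _).le, div_le_one (hb _)]
      linarith) hμ (by
      filter_upwards [h] with z hz
      rw [hz, norm_mul, hμ, one_mul, mul_div_assoc])
  refine ⟨c * ((1 - ‖c‖ : ℝ) : ℂ)⁻¹, ?_⟩
  filter_upwards [hc] with z hz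
  have h1 : ‖c‖ = ‖F z‖ / (1 + ‖F z‖) := by
    rw [← hz, norm_div, Complex.norm_real, Real.norm_of_nonneg (hb _).le]
  have h2 : 1 - ‖c‖ = (1 + ‖F z‖)⁻¹ := by
    rw [h1]; have := (hb (F z)).ne'; field_simp; ring
  have h3 : ((1 + ‖F z‖ : ℝ) : ℂ) ≠ 0 := by exact_mod_cast (hb (F z)).ne'
  rw [h2, ← hz, Complex.ofReal_inv, inv_inv, div_mul_cancel₀ _ h3]

lemma ergodic_flow (hα : Irrational α) (hg : GoodRoof α g)
    {f : UnitAddCircle → ℝ} (hfg : f = fun x => g x + C) (hpos : ∀ x, 0 < f x) (hC : 0 < C) :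
    Ergodic (flow α f C) (lebesgue α f) := by
  have hf : Continuous f := by rw [hfg]; fun_prop
  have := isProbabilityMeasure_lebesgue (α := α) hf hpos
  refine ⟨measurePreserving_flow hf hpos C, ⟨fun s hs hinv => ?_⟩⟩
  obtain ⟨c, hc⟩ := ae_eq_const_of_eigenfunction (F := s.indicator fun _ => (1 : ℂ)) (B := 1)
    (μ := 1) hα hg hfg hpos hC (measurable_const.indicator hs)
    (fun z => by by_cases hz : z ∈ s <;> simp [hz]) (by simp) (.of_forall fun z => by
      have : flow α f C z ∈ s ↔ z ∈ s := by
        conv_rhs => rw [← hinv]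
        rfl
      by_cases hz : z ∈ s <;> simp [hz, this])
  rw [eventuallyConst_set']
  by_cases h0 : c = 0
  · left
    filter_upwards [hc] with z hz
    rw [h0] at hz
    have : z ∉ s := by
      intro hzs; simp [hzs] at hz
    exact propext ⟨fun h => absurd h this, fun h => absurd h (by exact fun h => h)⟩
  · right
    filter_upwards [hc] with z hz
    have : z ∈ s := by
      by_contra hzs; simp [hzs] at hz; exact h0 hz.symm
    exact propext ⟨fun _ => trivial, fun _ => this⟩

end TimeMap

end SpecialFlow


namespace SpecialFlow

/-! ### Unitary operators: correlations of vectors orthogonal to all eigenvectors. -/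

section Hilbert

variable {E : Type*} [NormedAddCommGroup E] [InnerProductSpace ℂ E]

/-- A positive operator with finite trace is compact. -/
lemma isCompactOperator_of_trace_le [CompleteSpace E] {T : E →L[ℂ] E}
    (hpos : ∀ x, 0 ≤ (inner ℂ (T x) x : ℂ).re)
    (hCS : ∀ x y, ‖(inner ℂ (T x) y : ℂ)‖ ^ 2 ≤ (inner ℂ (T x) x : ℂ).re * (inner ℂ (T y) y : ℂ).re)
    {M : ℝ} (hM : ∀ (n : ℕ) (v : Fin n → E), Orthonormal ℂ v →
      ∑ i, (inner ℂ (T (v i)) (v i) : ℂ).re ≤ M) : IsCompactOperator T := by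
  set S : Set ℝ := {r | ∃ (n : ℕ) (v : Fin n → E), Orthonormal ℂ v ∧
    ∑ i, (inner ℂ (T (v i)) (v i) : ℂ).re = r} with hS
  have hbdd : BddAbove S := ⟨M, by rintro r ⟨n, v, hv, rfl⟩; exact hM n v hv⟩
  have hne : S.Nonempty := ⟨0, 0, Fin.elim0, ⟨fun i => i.elim0, fun i => i.elim0⟩, by simp⟩
  have happrox : ∀ ε > 0, ∃ K : E →L[ℂ] E, IsCompactOperator K ∧ ‖T - K‖ ≤ ε := by
    intro ε hε
    -- The family `v` comes within ε of the supremum of the partial traces. A unit vector orthogonal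
    -- to it could be appended, so it adds at most ε: the form of T is at most ε on the complement
    -- of the span.
    obtain ⟨_, ⟨n, v, hv, rfl⟩, hlt⟩ := exists_lt_of_lt_csSup hne (sub_lt_self (sSup S) hε)
    set V : Submodule ℂ E := Submodule.span ℂ (Set.range v) with hV
    have : FiniteDimensional ℂ V := FiniteDimensional.span_of_finite ℂ (Set.finite_range v)
    have hunit : ∀ x ∈ Vᗮ, ‖x‖ = 1 → (inner ℂ (T x) x : ℂ).re ≤ ε := by
      intro x hx hx1
      have hcons : Orthonormal ℂ (Matrix.vecCons x v) := by
        refine orthonormal_vecCons_iff.2 ⟨hx1, fun i => ?_, hv⟩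
        exact (Submodule.mem_orthogonal' V x).1 hx _ (Submodule.subset_span ⟨i, rfl⟩)
      have := le_csSup hbdd ⟨n + 1, _, hcons, rfl⟩
      rw [Fin.sum_univ_succ] at this
      simp only [Matrix.cons_val_zero, Matrix.cons_val_succ] at this
      linarith
    have hquad : ∀ x ∈ Vᗮ, (inner ℂ (T x) x : ℂ).re ≤ ε * ‖x‖ ^ 2 := by
      intro x hx
      rcases eq_or_ne x 0 with rfl | hx0
      · simp
      have hn : ‖x‖ ≠ 0 := norm_ne_zero_iff.2 hx0
      have h1 := hunit (((‖x‖⁻¹ : ℝ) : ℂ) • x) (Vᗮ.smul_mem _ hx) (by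
        rw [norm_smul, Complex.norm_real, norm_inv, norm_norm, inv_mul_cancel₀ hn])
      rw [map_smul, inner_smul_left, inner_smul_right, Complex.conj_ofReal, ← mul_assoc,
        ← Complex.ofReal_mul, Complex.re_ofReal_mul] at h1
      have h2 : ‖x‖⁻¹ * ‖x‖⁻¹ = (‖x‖ ^ 2)⁻¹ := by rw [sq, mul_inv]
      rw [h2, inv_mul_le_iff₀ (by positivity)] at h1
      linarith
    set P : E →L[ℂ] E := Vᗮ.starProjection with hP
    set Q : E →L[ℂ] E := V.starProjection with hQ
    have hPQ : ∀ x, Q x + P x = x := fun x => V.starProjection_add_starProjection_orthogonal x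
    have hPmem : ∀ x, P x ∈ Vᗮ := fun x => Submodule.starProjection_apply_mem _ x
    have hPle : ∀ x, ‖P x‖ ≤ ‖x‖ := fun x => Submodule.norm_starProjection_apply_le _ x
    have hQc : IsCompactOperator Q := by
      have : ProperSpace V := FiniteDimensional.proper_rclike ℂ V
      have h1 : IsCompactOperator V.subtypeL := isCompactOperator_of_locallyCompactSpace_rng _
      exact h1.comp_clm V.orthogonalProjectionOnto
    refine ⟨T - P ∘L T ∘L P, ?_, ?_⟩
    · have h1 : (T - P ∘L T ∘L P) = Q ∘L T + (P ∘L T) ∘L Q := by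
        ext x
        simp only [sub_apply, add_apply,
          ContinuousLinearMap.comp_apply]
        have h2 := hPQ (T x)
        have h3 : P (T (Q x)) + P (T (P x)) = P (T x) := by
          rw [← map_add, ← map_add, hPQ]
        rw [sub_eq_iff_eq_add, add_assoc, h3, h2]
      rw [h1]
      exact (hQc.comp_clm T).add (hQc.clm_comp (P ∘L T))
    · rw [sub_sub_cancel]
      refine ContinuousLinearMap.opNorm_le_bound _ hε.le fun x => ?_
      set y := (P ∘L T ∘L P) x with hy
      rcases eq_or_ne y 0 with h0 | h0
      · rw [h0, norm_zero]; positivity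
      have hyV : y ∈ Vᗮ := hPmem _
      have hPy : P y = y := Submodule.starProjection_eq_self_iff.2 hyV
      have h1 : (inner ℂ y y : ℂ) = inner ℂ (T (P x)) y := by
        conv_lhs => rw [hy]
        simp only [ContinuousLinearMap.comp_apply]
        rw [hP, Submodule.inner_starProjection_left_eq_right, ← hP]
        exact congrArg (inner ℂ (T (P x))) hPy
      have h2 := hCS (P x) y
      rw [← h1, inner_self_eq_norm_sq_to_K] at h2
      have h3 : ‖((‖y‖ : ℂ)) ^ 2‖ = ‖y‖ ^ 2 := by simp
      have h2' : (‖y‖ ^ 2) ^ 2 ≤ _ := (congrArg (· ^ 2) h3).ge.trans h2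
      have h4 : (‖y‖ ^ 2) ^ 2 ≤ (ε * ‖x‖ ^ 2) * (ε * ‖y‖ ^ 2) := by
        calc (‖y‖ ^ 2) ^ 2 ≤ _ := h2'
          _ ≤ (ε * ‖x‖ ^ 2) * (ε * ‖y‖ ^ 2) := by
            refine mul_le_mul ((hquad _ (hPmem x)).trans ?_) (hquad y hyV) (hpos y) (by positivity)
            gcongr
            exact hPle x
      have hy0 : 0 < ‖y‖ ^ 2 := by positivity
      have h5 : ‖y‖ ^ 2 ≤ (ε * ‖x‖) ^ 2 := by
        refine le_of_mul_le_mul_right ?_ hy0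
        calc ‖y‖ ^ 2 * ‖y‖ ^ 2 = (‖y‖ ^ 2) ^ 2 := by ring
          _ ≤ _ := h4
          _ = _ := by ring
      exact (sq_le_sq₀ (norm_nonneg _) (by positivity)).1 h5
  choose K hK using fun n : ℕ => happrox (1 / ((n : ℝ) + 1)) (by positivity)
  refine isCompactOperator_of_tendsto (l := atTop) (F := K) ?_ (.of_forall fun n => (hK n).1)
  rw [tendsto_iff_norm_sub_tendsto_zero]
  refine squeeze_zero (fun n => norm_nonneg _) (fun n => ?_) tendsto_one_div_add_atTop_nhds_zero_nat
  rw [norm_sub_rev]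
  exact (hK n).2

/-- The averages of the forms `(x, y) ↦ ⟪x, Uⁿ f⟫ ⟪Uⁿ f, y⟫`. -/
noncomputable def avgForm (U : E ≃ₗᵢ[ℂ] E) (f : E) (N : ℕ) (x y : E) : ℂ :=
  (N : ℂ)⁻¹ * ∑ n ∈ Finset.range N, inner ℂ x (U^[n] f) * inner ℂ (U^[n] f) y

variable {U : E ≃ₗᵢ[ℂ] E} {f : E}

lemma norm_iterate (n : ℕ) (x : E) : ‖U^[n] x‖ = ‖x‖ := by
  induction n generalizing x with
  | zero => rfl
  | succ n ih => rw [Function.iterate_succ_apply, ih, U.norm_map]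

lemma inner_iterate (n : ℕ) (x y : E) : (inner ℂ (U^[n] x) (U^[n] y) : ℂ) = inner ℂ x y := by
  induction n generalizing x y with
  | zero => rfl
  | succ n ih => rw [Function.iterate_succ_apply, Function.iterate_succ_apply, ih, U.inner_map_map]

lemma norm_avgForm_le (N : ℕ) (x y : E) :
    ‖avgForm U f N x y‖ ≤ ‖f‖ ^ 2 * ‖x‖ * ‖y‖ := by
  rcases Nat.eq_zero_or_pos N with rfl | hN
  · simp [avgForm]; positivity
  have hN' : (0 : ℝ) < N := by exact_mod_cast hN
  rw [avgForm, norm_mul, norm_inv, Complex.norm_natCast, inv_mul_le_iff₀ hN']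
  refine (norm_sum_le _ _).trans ((Finset.sum_le_sum (g := fun _ => ‖f‖ ^ 2 * ‖x‖ * ‖y‖)
    fun n _ => ?_).trans (by simp))
  rw [norm_mul]
  have h1 := norm_inner_le_norm (𝕜 := ℂ) x (U^[n] f)
  have h2 := norm_inner_le_norm (𝕜 := ℂ) (U^[n] f) y
  rw [norm_iterate] at h1 h2
  calc _ ≤ (‖x‖ * ‖f‖) * (‖f‖ * ‖y‖) := by gcongr
    _ = _ := by ring

lemma avgForm_self (N : ℕ) (x : E) : avgForm U f N x x =
    (((N : ℝ)⁻¹ * ∑ n ∈ Finset.range N, ‖(inner ℂ (U^[n] f) x : ℂ)‖ ^ 2 : ℝ) : ℂ) := by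
  rw [avgForm]
  push_cast
  congr 1
  refine Finset.sum_congr rfl fun n _ => ?_
  rw [← inner_conj_symm x, Complex.conj_mul']

lemma norm_sq_avgForm_le (N : ℕ) (x y : E) :
    ‖avgForm U f N x y‖ ^ 2 ≤ (avgForm U f N x x).re * (avgForm U f N y y).re := by
  rw [avgForm_self, avgForm_self, Complex.ofReal_re, Complex.ofReal_re, avgForm, norm_mul,
    norm_inv, Complex.norm_natCast, mul_pow]
  have h1 : ‖∑ n ∈ Finset.range N, (inner ℂ x (U^[n] f) * inner ℂ (U^[n] f) y : ℂ)‖ ^ 2 ≤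
      (∑ n ∈ Finset.range N, ‖(inner ℂ (U^[n] f) x : ℂ)‖ ^ 2) *
      ∑ n ∈ Finset.range N, ‖(inner ℂ (U^[n] f) y : ℂ)‖ ^ 2 := by
    refine le_trans ?_ (Finset.sum_mul_sq_le_sq_mul_sq _ _ _)
    refine pow_le_pow_left₀ (norm_nonneg _) ((norm_sum_le _ _).trans (le_of_eq ?_)) 2
    refine Finset.sum_congr rfl fun n _ => ?_
    rw [norm_mul, norm_inner_symm]
  calc _ ≤ ((N : ℝ)⁻¹) ^ 2 * ((∑ n ∈ Finset.range N, ‖(inner ℂ (U^[n] f) x : ℂ)‖ ^ 2) *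
      ∑ n ∈ Finset.range N, ‖(inner ℂ (U^[n] f) y : ℂ)‖ ^ 2) := by gcongr
    _ = _ := by ring

lemma sum_avgForm_self_le (N : ℕ) {m : ℕ} {v : Fin m → E} (hv : Orthonormal ℂ v) :
    ∑ i, (avgForm U f N (v i) (v i)).re ≤ ‖f‖ ^ 2 := by
  simp only [avgForm_self, Complex.ofReal_re]
  rw [← Finset.mul_sum, Finset.sum_comm]
  rcases Nat.eq_zero_or_pos N with rfl | hN
  · simp
  have hN' : (0 : ℝ) < N := by exact_mod_cast hN
  rw [inv_mul_le_iff₀ hN']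
  refine (Finset.sum_le_sum (g := fun _ => ‖f‖ ^ 2) fun n _ => ?_).trans (by simp)
  have := hv.sum_inner_products_le (U^[n] f) (s := Finset.univ)
  rw [norm_iterate] at this
  simpa only [norm_inner_symm] using this

/-- Applying U shifts the summation index, so only two boundary terms survive. In the limit this
gives the commutation with U. -/
lemma norm_avgForm_map_sub_le (N : ℕ) (x y : E) :
    ‖avgForm U f N (U x) (U y) - avgForm U f N x y‖ ≤ (N : ℝ)⁻¹ * (2 * (‖f‖ ^ 2 * ‖x‖ * ‖y‖)) := by
  set a : ℕ → ℂ := fun n => inner ℂ (U x) (U^[n] f) * inner ℂ (U^[n] f) (U y) with ha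
  have h1 : ∀ n, inner ℂ x (U^[n] f) * inner ℂ (U^[n] f) y = a (n + 1) := fun n => by
    simp only [ha, Function.iterate_succ_apply', U.inner_map_map]
  have h2 : avgForm U f N (U x) (U y) - avgForm U f N x y = (N : ℂ)⁻¹ * (a 0 - a N) := by
    rw [avgForm, avgForm, ← mul_sub, Finset.sum_congr rfl fun n _ => h1 n]
    congr 1
    have := Finset.sum_range_sub a N
    rw [Finset.sum_sub_distrib] at this
    linear_combination -this
  have h3 : ∀ n, ‖a n‖ ≤ ‖f‖ ^ 2 * ‖x‖ * ‖y‖ := fun n => by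
    simp only [ha, norm_mul]
    have h1 := norm_inner_le_norm (𝕜 := ℂ) (U x) (U^[n] f)
    have h2 := norm_inner_le_norm (𝕜 := ℂ) (U^[n] f) (U y)
    rw [norm_iterate, U.norm_map] at h1 h2
    calc _ ≤ (‖x‖ * ‖f‖) * (‖f‖ * ‖y‖) := by gcongr
      _ = _ := by ring
  rw [h2, norm_mul, norm_inv, Complex.norm_natCast]
  gcongr
  exact (norm_sub_le _ _).trans (by linarith [h3 0, h3 N])

/-- An ultrafilter provides limits for all pairs of vectors simultaneously, without extracting
subsequences. The limit form inherits sesquilinearity and the bound ‖f‖², and is represented by a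
bounded operator. -/
lemma exists_limitForm [CompleteSpace E] (𝓤 : Ultrafilter ℕ) :
    ∃ T : E →L[ℂ] E, ∀ x y, Tendsto (fun N => avgForm U f N x y) 𝓤 (𝓝 (inner ℂ (T x) y)) := by
  have hex : ∀ x y, ∃ l : ℂ, Tendsto (fun N => avgForm U f N x y) 𝓤 (𝓝 l) ∧
      ‖l‖ ≤ ‖f‖ ^ 2 * ‖x‖ * ‖y‖ := fun x y => by
    have hc : IsCompact (Metric.closedBall (0 : ℂ) (‖f‖ ^ 2 * ‖x‖ * ‖y‖)) :=
      isCompact_closedBall _ _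
    obtain ⟨l, hl, hle⟩ := hc.ultrafilter_le_nhds' (𝓤.map fun N => avgForm U f N x y)
      (by
        refine Filter.mem_map.2 (Filter.univ_mem' fun N => ?_)
        simpa using norm_avgForm_le N x y)
    exact ⟨l, hle, by simpa using hl⟩
  choose L hL hLle using hex
  set B : E →ₗ⋆[ℂ] E →ₗ[ℂ] ℂ := LinearMap.mk₂'ₛₗ (starRingEnd ℂ) (RingHom.id ℂ) L
    (fun x x' y => by
      refine tendsto_nhds_unique (hL _ _) (((hL x y).add (hL x' y)).congr fun N => ?_)
      simp only [avgForm, ← mul_add, ← Finset.sum_add_distrib, ← add_mul, inner_add_left])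
    (fun c x y => by
      refine tendsto_nhds_unique (hL _ _) (((hL x y).const_mul (starRingEnd ℂ c)).congr fun N => ?_)
      simp only [avgForm, Finset.mul_sum, inner_smul_left]
      exact Finset.sum_congr rfl fun n _ => by ring)
    (fun x y y' => by
      refine tendsto_nhds_unique (hL _ _) (((hL x y).add (hL x y')).congr fun N => ?_)
      simp only [avgForm, ← mul_add, ← Finset.sum_add_distrib, inner_add_right])
    (fun c x y => by
      refine tendsto_nhds_unique (hL _ _) (((hL x y).const_mul c).congr fun N => ?_)
      simp only [avgForm, Finset.mul_sum, inner_smul_right]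
      exact Finset.sum_congr rfl fun n _ => by ring) with hB
  refine ⟨InnerProductSpace.continuousLinearMapOfBilin
    (B.mkContinuous₂ (‖f‖ ^ 2) fun x y => hLle x y), fun x y => ?_⟩
  rw [InnerProductSpace.continuousLinearMapOfBilin_apply]
  exact hL x y

/-- A vector orthogonal to all eigenvectors of a unitary operator has mean-square vanishing
correlations. -/
theorem tendsto_avg_sq_inner_iterate [CompleteSpace E] (hf : ∀ (v : E) (c : ℂ), U v = c • v → inner ℂ f v = (0 : ℂ))
    (x : E) : Tendsto (fun N : ℕ => (N : ℝ)⁻¹ *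
      ∑ n ∈ Finset.range N, ‖(inner ℂ (U^[n] f) x : ℂ)‖ ^ 2) atTop (𝓝 0) := by
  rw [tendsto_iff_ultrafilter]
  intro 𝓤 h𝓤
  obtain ⟨T, hT⟩ := exists_limitForm (U := U) (f := f) 𝓤
  have hre : ∀ x, Tendsto (fun N => (avgForm U f N x x).re) 𝓤 (𝓝 (inner ℂ (T x) x : ℂ).re) :=
    fun x => (Complex.continuous_re.tendsto _).comp (hT x x)
  have hpos : ∀ x, 0 ≤ (inner ℂ (T x) x : ℂ).re := fun x =>
    ge_of_tendsto' (hre x) fun N => by rw [avgForm_self, Complex.ofReal_re]; positivity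
  -- By Bessel's inequality every averaged form has trace at most ‖f‖², and so has the limit.
  have hcompact : IsCompactOperator T := by
    refine isCompactOperator_of_trace_le hpos (fun x y => ?_) (M := ‖f‖ ^ 2) fun n v hv => ?_
    · exact le_of_tendsto_of_tendsto' ((hT x y).norm.pow 2) ((hre x).mul (hre y))
        fun N => norm_sq_avgForm_le N x y
    · exact le_of_tendsto' (tendsto_finsetSum _ fun i _ => hre (v i))
        fun N => sum_avgForm_self_le N hv
  have hsymm : (T : E →ₗ[ℂ] E).IsSymmetric := by
    intro x y
    change inner ℂ (T x) y = inner ℂ x (T y)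
    rw [← inner_conj_symm x]
    refine tendsto_nhds_unique (hT x y)
      (((Complex.continuous_conj.tendsto _).comp (hT y x)).congr fun N => ?_)
    simp only [Function.comp_apply, avgForm, map_mul, map_sum, map_inv₀, Complex.conj_natCast,
      inner_conj_symm]
    congr 1
    exact Finset.sum_congr rfl fun n _ => mul_comm _ _
  have hcomm : ∀ x, T (U x) = U (T x) := by
    have h1 : ∀ x y, inner ℂ (T (U x)) (U y) = (inner ℂ (T x) y : ℂ) := fun x y => by
      refine tendsto_nhds_unique (hT (U x) (U y)) ?_
      have h0 : Tendsto (fun N : ℕ => (N : ℝ)⁻¹ * (2 * (‖f‖ ^ 2 * ‖x‖ * ‖y‖))) 𝓤 (𝓝 0) := by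
        have := (tendsto_inv_atTop_nhds_zero_nat (𝕜 := ℝ)).mul_const (2 * (‖f‖ ^ 2 * ‖x‖ * ‖y‖))
        rw [zero_mul] at this
        exact this.mono_left h𝓤
      have h2 := (squeeze_zero_norm (fun N => norm_avgForm_map_sub_le (U := U) (f := f) N x y)
        h0).add (hT x y)
      simpa using h2
    intro x
    refine ext_inner_right ℂ fun z => ?_
    obtain ⟨y, rfl⟩ := U.surjective z
    rw [h1, U.inner_map_map]
  -- The eigenspace of a nonzero eigenvalue of the compact operator T is finite-dimensional and
  -- U-invariant, so it contains an eigenvector v of U. As f is orthogonal to v, so are all U^n f,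
  -- whence ⟨Tv, v⟩ = 0, which is impossible.
  have hT0 : T = 0 := by
    refine (ContinuousLinearMap.eq_zero_of_forall_hasEigenvalue_eq_zero hcompact hsymm).1 ?_
    intro μ hμ
    by_contra hμ0
    set V := Module.End.eigenspace (T : E →ₗ[ℂ] E) μ with hV
    have hfin : FiniteDimensional ℂ V :=
      ContinuousLinearMap.finite_dimensional_eigenspace hcompact μ hμ0
    have hnt : Nontrivial V := Submodule.nontrivial_iff_ne_bot.2 hμ
    have hinv : ∀ v ∈ V, (U : E →ₗ[ℂ] E) v ∈ V := fun v hv => by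
      have hv' : T v = μ • v := Module.End.mem_eigenspace_iff.1 hv
      refine Module.End.mem_eigenspace_iff.2 ?_
      change T (U v) = μ • U v
      rw [hcomm, hv', map_smul]
    obtain ⟨c, hc⟩ := Module.End.exists_eigenvalue ((U : E →ₗ[ℂ] E).restrict hinv)
    obtain ⟨⟨v, hvV⟩, hv⟩ := hc.exists_hasEigenvector
    have hUv : U v = c • v := congrArg Subtype.val hv.apply_eq_smul
    have hv0 : v ≠ 0 := fun h => hv.2 (Subtype.ext h)
    have hc0 : c ≠ 0 := by
      rintro rfl
      rw [zero_smul] at hUv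
      exact hv0 (by simpa using hUv)
    have hiter : ∀ n : ℕ, U^[n] v = c ^ n • v := fun n => by
      induction n with
      | zero => simp
      | succ n ih => rw [Function.iterate_succ_apply', ih, map_smul, hUv, smul_smul, pow_succ]
    have hzero : ∀ n : ℕ, (inner ℂ (U^[n] f) v : ℂ) = 0 := fun n => by
      have h1 := inner_iterate (U := U) n f v
      rw [hiter, inner_smul_right, hf v c hUv] at h1
      exact (mul_eq_zero.1 h1).resolve_left (pow_ne_zero _ hc0)
    have hTv : T v = μ • v := Module.End.mem_eigenspace_iff.1 hvV
    have h2 : (inner ℂ (T v) v : ℂ) = 0 := by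
      refine tendsto_nhds_unique (hT v v) (tendsto_const_nhds.congr fun N => ?_)
      simp [avgForm, hzero]
    rw [hTv, inner_smul_left, mul_eq_zero] at h2
    rcases h2 with h2 | h2
    · exact hμ0 (by simpa using h2)
    · exact hv0 (inner_self_eq_zero.1 h2)
  have := hre x
  simp only [hT0, zero_apply, inner_zero_left, Complex.zero_re, avgForm_self,
    Complex.ofReal_re] at this
  exact this

end Hilbert

end SpecialFlow


namespace SpecialFlow

/-! ### Weak mixing from the absence of nonconstant eigenfunctions. -/

section WeakMixing

open scoped ENNReal

lemma tendsto_avg_abs_of_avg_sq {a : ℕ → ℝ}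
    (h : Tendsto (fun N : ℕ => (N : ℝ)⁻¹ * ∑ n ∈ Finset.range N, a n ^ 2) atTop (𝓝 0)) :
    Tendsto (fun N : ℕ => (1 / (N : ℝ)) * ∑ n ∈ Finset.range N, |a n|) atTop (𝓝 0) := by
  have h1 : Tendsto (fun N : ℕ => √((N : ℝ)⁻¹ * ∑ n ∈ Finset.range N, a n ^ 2)) atTop (𝓝 0) := by
    have h2 := (Real.continuous_sqrt.tendsto 0).comp h
    rwa [Real.sqrt_zero] at h2
  refine squeeze_zero (fun N => by positivity) (fun N => ?_) h1
  refine Real.le_sqrt_of_sq_le ?_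
  rcases Nat.eq_zero_or_pos N with rfl | hN
  · simp
  have hN' : (0 : ℝ) < N := by exact_mod_cast hN
  have h2 := sq_sum_le_card_mul_sum_sq (s := Finset.range N) (f := fun n => |a n|)
  simp only [sq_abs, Finset.card_range] at h2
  rw [mul_pow]
  calc (1 / (N : ℝ)) ^ 2 * (∑ n ∈ Finset.range N, |a n|) ^ 2
      ≤ (1 / (N : ℝ)) ^ 2 * (N * ∑ n ∈ Finset.range N, a n ^ 2) := by gcongr
    _ = _ := by field_simp

variable {X : Type*} [MeasurableSpace X] {μ : Measure X} {T S : X → X}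

/-- The Koopman operator of an invertible measure-preserving map. -/
noncomputable def koopman (hT : MeasurePreserving T μ μ) (hS : MeasurePreserving S μ μ)
    (hST : ∀ x, S (T x) = x) : Lp ℂ 2 μ ≃ₗᵢ[ℂ] Lp ℂ 2 μ :=
  LinearIsometryEquiv.ofSurjective (Lp.compMeasurePreservingₗᵢ ℂ T hT) fun v =>
    ⟨Lp.compMeasurePreserving S hS v, by
      refine Lp.ext ?_
      have h1 := Lp.coeFn_compMeasurePreserving (Lp.compMeasurePreserving S hS v) hT
      have h2 := hT.quasiMeasurePreserving.ae (Lp.coeFn_compMeasurePreserving v hS)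
      change Lp.compMeasurePreserving T hT (Lp.compMeasurePreserving S hS v) =ᵐ[μ] v
      filter_upwards [h1, h2] with x hx1 hx2
      rw [hx1, Function.comp_apply, hx2, Function.comp_apply, hST]⟩

lemma koopman_apply (hT : MeasurePreserving T μ μ) (hS : MeasurePreserving S μ μ)
    (hST : ∀ x, S (T x) = x) (v : Lp ℂ 2 μ) :
    koopman hT hS hST v = Lp.compMeasurePreserving T hT v := rfl

lemma koopman_iterate_indicator [IsProbabilityMeasure μ] (hT : MeasurePreserving T μ μ) (hS : MeasurePreserving S μ μ)
    (hST : ∀ x, S (T x) = x) {A : Set X} (hA : MeasurableSet A) (n : ℕ) :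
    (koopman hT hS hST)^[n] (indicatorConstLp 2 hA (measure_ne_top μ A) (1 : ℂ)) =
      indicatorConstLp 2 ((hT.iterate n).measurable hA) (measure_ne_top μ _) (1 : ℂ) := by
  induction n with
  | zero => rfl
  | succ n ih =>
    rw [Function.iterate_succ_apply', ih, koopman_apply, Lp.indicatorConstLp_compMeasurePreserving]
    rfl

/-- An invertible measure-preserving map without nonconstant eigenfunctions is weakly mixing. -/
theorem weaklyMixing_of_eigenfunction [IsProbabilityMeasure μ] (hT : MeasurePreserving T μ μ)
    (hS : MeasurePreserving S μ μ) (hST : ∀ x, S (T x) = x)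
    (h : ∀ (F : X → ℂ) (c : ℂ), Measurable F → ‖c‖ = 1 → (∀ᵐ z ∂μ, F (T z) = c * F z) →
      ∃ d, ∀ᵐ z ∂μ, F z = d) : WeaklyMixing T μ := by
  refine ⟨⟨inferInstance, hT⟩, fun A B hA hB => ?_⟩
  set U := koopman hT hS hST with hU
  set one : Lp ℂ 2 μ := indicatorConstLp 2 MeasurableSet.univ (measure_ne_top μ _) (1 : ℂ) with hone
  -- The indicator of A minus its mean: pairing U^n f with the indicator of D gives exactly the
  -- correlation μ(T⁻ⁿA ∩ D) − μ(A)μ(D). With n = 0 and D the whole space, f is orthogonal to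
  -- constants, which are the only eigenvectors.
  set f : Lp ℂ 2 μ := indicatorConstLp 2 hA (measure_ne_top μ A) (1 : ℂ) - (μ.real A : ℂ) • one
    with hf
  have hU1 : ∀ n, U^[n] one = one := fun n => by
    rw [hone, koopman_iterate_indicator]
    rfl
  have hiter : ∀ n, U^[n] f = indicatorConstLp 2 ((hT.iterate n).measurable hA)
      (measure_ne_top μ _) (1 : ℂ) - (μ.real A : ℂ) • one := fun n => by
    have h1 : ∀ (n : ℕ) (x y : Lp ℂ 2 μ) (c : ℂ), U^[n] (x - c • y) = U^[n] x - c • U^[n] y := by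
      intro n
      induction n with
      | zero => intros; rfl
      | succ n ih =>
        intro x y c
        simp only [Function.iterate_succ_apply', ih, map_sub, map_smul]
    rw [hf, h1, hU1, koopman_iterate_indicator]
  have hcorr : ∀ (n : ℕ) (D : Set X) (hD : MeasurableSet D),
      (inner ℂ (U^[n] f) (indicatorConstLp 2 hD (measure_ne_top μ D) (1 : ℂ)) : ℂ) =
        ((μ.real ((T^[n]) ⁻¹' A ∩ D) - μ.real A * μ.real D : ℝ) : ℂ) := fun n D hD => by
    rw [hiter, inner_sub_left, inner_smul_left, hone,
      L2.inner_indicatorConstLp_one_indicatorConstLp_one,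
      L2.inner_indicatorConstLp_one_indicatorConstLp_one, Set.univ_inter, Complex.conj_ofReal]
    push_cast
    rfl
  have horth : ∀ (v : Lp ℂ 2 μ) (c : ℂ), U v = c • v → inner ℂ f v = (0 : ℂ) := by
    intro v c hv
    rcases eq_or_ne v 0 with rfl | hv0
    · simp
    have hc : ‖c‖ = 1 := by
      have h1 := congrArg norm hv
      rw [U.norm_map, norm_smul] at h1
      exact (mul_eq_right₀ (norm_ne_zero_iff.2 hv0)).1 h1.symm
    obtain ⟨d, hd⟩ := h v c (Lp.stronglyMeasurable v).measurable hc (by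
      have h1 := Lp.coeFn_compMeasurePreserving v hT
      rw [← koopman_apply hT hS hST, ← hU, hv] at h1
      filter_upwards [h1, Lp.coeFn_smul c v] with x hx1 hx2
      rw [Function.comp_apply] at hx1
      rw [← hx1, hx2]
      rfl)
    have hvd : v = d • one := by
      refine Lp.ext ?_
      filter_upwards [hd, Lp.coeFn_smul d one, indicatorConstLp_coeFn (p := 2) (μ := μ)
        (hs := MeasurableSet.univ) (hμs := measure_ne_top μ _) (c := (1 : ℂ))] with x h1 h2 h3
      rw [h1, h2, Pi.smul_apply, hone, h3]
      simp
    have h2 := hcorr 0 _ MeasurableSet.univ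
    rw [hvd, inner_smul_right]
    rw [Function.iterate_zero, Function.iterate_zero, id, Set.preimage_id, Set.inter_univ,
      probReal_univ, mul_one, sub_self, Complex.ofReal_zero] at h2
    rw [hone, h2, mul_zero]
  have key := tendsto_avg_sq_inner_iterate horth
    (indicatorConstLp 2 hB (measure_ne_top μ B) (1 : ℂ))
  refine tendsto_avg_abs_of_avg_sq (key.congr fun N => ?_)
  simp only [hcorr, Complex.norm_real, Real.norm_eq_abs, sq_abs]

end WeakMixing

section FlowWeakMixing

variable {α C : ℝ} {g : C(UnitAddCircle, ℝ)}

theorem weaklyMixing_flow (hα : Irrational α) (hg : GoodRoof α g)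
    {f : UnitAddCircle → ℝ} (hfg : f = fun x => g x + C) (hpos : ∀ x, 0 < f x) (hC : 0 < C) :
    WeaklyMixing (flow α f C) (lebesgue α f) := by
  have hf : Continuous f := by rw [hfg]; fun_prop
  have := isProbabilityMeasure_lebesgue (α := α) hf hpos
  refine weaklyMixing_of_eigenfunction (measurePreserving_flow hf hpos C)
    (measurePreserving_flow hf hpos (-C)) (fun z => ?_) fun F c hF hc h =>
    ae_eq_const_of_eigenfunction' hα hg hfg hpos hC hF hc h
  rw [flow_add, add_neg_cancel, flow_zero]

end FlowWeakMixing

end SpecialFlow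


namespace SpecialFlow

/-! ### Equidistribution of irrational rotations. -/

section Weyl

variable {α : ℝ}

instance isProbabilityMeasure_volume_circle :
    IsProbabilityMeasure (volume : Measure UnitAddCircle) :=
  ⟨UnitAddCircle.measure_univ⟩

lemma fourier_add_apply (n : ℤ) (x y : UnitAddCircle) :
    (fourier n (x + y) : ℂ) = fourier n x * fourier n y := by
  simp [fourier_apply, smul_add, AddCircle.toCircle_add]

lemma fourier_coe_ne_one (hα : Irrational α) {n : ℤ} (hn : n ≠ 0) :
    (fourier n (α : UnitAddCircle) : ℂ) ≠ 1 := by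
  have h1 : (fourier n (α : UnitAddCircle) : ℂ) = e (n * α) := by
    rw [fourier_coe_apply, e]; congr 1; push_cast; ring
  rw [h1, ← e_zero, Ne, e_eq_e_iff, AddCircle.coe_zero, AddCircle.coe_eq_zero_iff]
  rintro ⟨m, hm⟩
  have h2 : Irrational ((n : ℝ) * α) := hα.intCast_mul hn
  exact h2 ⟨m, by rw [← hm]; simp⟩

/-- Translating by α multiplies the integral by a number different from 1 and does not change it. -/
lemma integral_fourier_eq_zero (hα : Irrational α) {n : ℤ} (hn : n ≠ 0) :
    ∫ x : UnitAddCircle, (fourier n x : ℂ) = 0 := by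
  have h1 := integral_add_right_eq_self (μ := (volume : Measure UnitAddCircle))
    (fun x => (fourier n x : ℂ)) (α : UnitAddCircle)
  simp only [fourier_add_apply, integral_mul_const] at h1
  have h2 := fourier_coe_ne_one hα hn
  have h3 : (∫ x : UnitAddCircle, (fourier n x : ℂ)) * (fourier n (α : UnitAddCircle) - 1) = 0 := by
    linear_combination h1
  exact (mul_eq_zero.1 h3).resolve_right (sub_ne_zero.2 h2)

lemma tendsto_avg_fourier (hα : Irrational α) (n : ℤ) (x : UnitAddCircle) :
    Tendsto (fun N : ℕ => (N : ℂ)⁻¹ * ∑ i ∈ Finset.range N,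
      (fourier n (x + i • (α : UnitAddCircle)) : ℂ)) atTop
      (𝓝 (∫ t : UnitAddCircle, (fourier n t : ℂ))) := by
  rcases eq_or_ne n 0 with rfl | hn
  · simp only [fourier_zero, Finset.sum_const, Finset.card_range, nsmul_eq_mul, mul_one,
      integral_const]
    refine tendsto_const_nhds.congr' ?_
    filter_upwards [eventually_gt_atTop 0] with N hN
    rw [inv_mul_cancel₀ (by exact_mod_cast hN.ne')]
    change (volume : Measure UnitAddCircle).real Set.univ • (1 : ℂ) = 1
    rw [probReal_univ, one_smul]
  rw [integral_fourier_eq_zero hα hn]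
  set w : ℂ := fourier n (α : UnitAddCircle) with hw
  have hw1 : w ≠ 1 := fourier_coe_ne_one hα hn
  have hwn : ‖w‖ = 1 := by rw [hw, fourier_apply]; exact Circle.norm_coe _
  have h1 : ∀ i : ℕ, (fourier n (x + i • (α : UnitAddCircle)) : ℂ) = fourier n x * w ^ i := by
    intro i
    induction i with
    | zero => simp
    | succ i ih => rw [succ_nsmul, ← add_assoc, fourier_add_apply, ih, pow_succ, mul_assoc]
  refine squeeze_zero_norm (a := fun N : ℕ => (N : ℝ)⁻¹ * (2 / ‖w - 1‖)) (fun N => ?_) ?_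
  · rw [Finset.sum_congr rfl fun i _ => h1 i, ← Finset.mul_sum, geom_sum_eq hw1, norm_mul,
      norm_inv, Complex.norm_natCast, norm_mul, norm_div, fourier_apply, Circle.norm_coe, one_mul]
    gcongr
    calc ‖w ^ N - 1‖ ≤ ‖w ^ N‖ + ‖(1 : ℂ)‖ := norm_sub_le _ _
      _ = 2 := by rw [norm_pow, hwn, one_pow, norm_one]; norm_num
  · simpa using (tendsto_inv_atTop_nhds_zero_nat (𝕜 := ℝ)).mul_const (2 / ‖w - 1‖)

/-- Weyl equidistribution of irrational rotations. -/
theorem tendsto_avg_rotation (hα : Irrational α) (H : C(UnitAddCircle, ℝ)) (x : UnitAddCircle) :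
    Tendsto (fun N : ℕ => (N : ℝ)⁻¹ * ∑ i ∈ Finset.range N, H (x + i • (α : UnitAddCircle)))
      atTop (𝓝 (∫ t, H t)) := by
  have hint : ∀ F : C(UnitAddCircle, ℂ), Integrable F volume := fun F =>
    F.continuous.integrable_of_hasCompactSupport (HasCompactSupport.of_compactSpace _)
  have hspan : ∀ F ∈ Submodule.span ℂ (Set.range (@fourier 1)),
      Tendsto (fun N : ℕ => (N : ℂ)⁻¹ * ∑ i ∈ Finset.range N, F (x + i • (α : UnitAddCircle)))
        atTop (𝓝 (∫ t, F t)) := by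
    intro F hF
    induction hF using Submodule.span_induction with
    | mem F hF => obtain ⟨n, rfl⟩ := hF; exact tendsto_avg_fourier hα n x
    | zero => simp
    | add F G _ _ hF hG =>
      simp only [ContinuousMap.add_apply, Finset.sum_add_distrib, mul_add]
      rw [integral_add (hint F) (hint G)]
      exact hF.add hG
    | smul c F _ hF =>
      simp only [ContinuousMap.smul_apply, smul_eq_mul, ← Finset.mul_sum]
      rw [integral_const_mul]
      exact (hF.const_mul c).congr fun N => by ring
  set F : C(UnitAddCircle, ℂ) := ⟨fun t => (H t : ℂ), by fun_prop⟩ with hFdef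
  have hlim : Tendsto (fun N : ℕ => (N : ℂ)⁻¹ * ∑ i ∈ Finset.range N,
      F (x + i • (α : UnitAddCircle))) atTop (𝓝 (∫ t, F t)) := by
    rw [Metric.tendsto_atTop]
    intro ε hε
    have hF : F ∈ (Submodule.span ℂ (Set.range (@fourier 1))).topologicalClosure := by
      rw [span_fourier_closure_eq_top]; trivial
    obtain ⟨G, hG, hFG⟩ := Metric.mem_closure_iff.1 hF (ε / 3) (by positivity)
    have hpt : ∀ t, ‖F t - G t‖ ≤ ε / 3 := fun t => by
      rw [← dist_eq_norm]; exact (ContinuousMap.dist_apply_le_dist t).trans hFG.le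
    obtain ⟨N₀, hN₀⟩ := Metric.tendsto_atTop.1 (hspan G hG) (ε / 3) (by positivity)
    refine ⟨N₀, fun N hN => ?_⟩
    have h1 := hN₀ N hN
    rw [dist_eq_norm] at h1 ⊢
    have h2 : ‖(∫ t, F t) - ∫ t, G t‖ ≤ ε / 3 := by
      rw [← integral_sub (hint F) (hint G)]
      have h2 := norm_integral_le_of_norm_le_const (μ := (volume : Measure UnitAddCircle))
        (f := fun t => F t - G t) (.of_forall hpt)
      rwa [probReal_univ, mul_one] at h2
    have h3 : ‖(N : ℂ)⁻¹ * ∑ i ∈ Finset.range N, F (x + i • (α : UnitAddCircle)) -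
        (N : ℂ)⁻¹ * ∑ i ∈ Finset.range N, G (x + i • (α : UnitAddCircle))‖ ≤ ε / 3 := by
      rw [← mul_sub, ← Finset.sum_sub_distrib, norm_mul, norm_inv, Complex.norm_natCast]
      rcases Nat.eq_zero_or_pos N with rfl | hN0
      · simpa using (by positivity : 0 ≤ ε / 3)
      rw [inv_mul_le_iff₀ (by exact_mod_cast hN0)]
      refine (norm_sum_le _ _).trans ((Finset.sum_le_sum fun i _ => hpt _).trans ?_)
      simp
    calc _ = ‖((N : ℂ)⁻¹ * ∑ i ∈ Finset.range N, F (x + i • (α : UnitAddCircle)) -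
        (N : ℂ)⁻¹ * ∑ i ∈ Finset.range N, G (x + i • (α : UnitAddCircle))) +
        ((N : ℂ)⁻¹ * ∑ i ∈ Finset.range N, G (x + i • (α : UnitAddCircle)) - ∫ t, G t) -
        ((∫ t, F t) - ∫ t, G t)‖ := by congr 1; ring
      _ ≤ _ := norm_sub_le _ _
      _ ≤ _ + _ + _ := add_le_add_left (norm_add_le _ _) _
      _ < ε := by linarith
  have hre := (Complex.continuous_re.tendsto _).comp hlim
  have h4 : ∫ t, F t = ((∫ t, H t : ℝ) : ℂ) := integral_ofReal
  rw [h4, Complex.ofReal_re] at hre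
  refine hre.congr fun N => ?_
  simp only [hFdef, ContinuousMap.coe_mk, Function.comp_apply]
  rw [← Complex.ofReal_sum, ← Complex.ofReal_natCast, ← Complex.ofReal_inv, ← Complex.ofReal_mul,
    Complex.ofReal_re]

end Weyl

/-! ### Uniform Birkhoff averages from unique ergodicity. -/

section UniformConvergence

variable {X : Type*} [TopologicalSpace X] [CompactSpace X] [T2Space X]
  [SecondCountableTopology X] [MeasurableSpace X] [BorelSpace X]

lemma measurePreserving_of_integral_comp {T : X → X} (hT : Continuous T) {ν : Measure X}
    [IsFiniteMeasure ν] (h : ∀ φ : C(X, ℝ), ∫ x, φ (T x) ∂ν = ∫ x, φ x ∂ν) :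
    MeasurePreserving T ν ν := by
  refine ⟨hT.measurable, ?_⟩
  have : IsFiniteMeasure (ν.map T) := Measure.isFiniteMeasure_map ν T
  refine ext_of_forall_integral_eq_of_IsFiniteMeasure fun φ => ?_
  rw [integral_map hT.measurable.aemeasurable φ.continuous.aestronglyMeasurable]
  exact h φ.toContinuousMap

/-- For a uniquely ergodic map the orbit averages converge uniformly. -/
theorem eventually_abs_avg_sub_le {T : X → X} (hT : Continuous T) {μ : Measure X}
    (huniq : ∀ ν, IsInvariantProb T ν → ν = μ) (h : C(X, ℝ)) {ε : ℝ} (hε : 0 < ε) :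
    ∀ᶠ q : ℕ in atTop, ∀ z, |(q : ℝ)⁻¹ * ∑ j ∈ Finset.range q, h (T^[j] z) - ∫ x, h x ∂μ| ≤ ε := by
  by_contra hcon
  rw [eventually_atTop] at hcon
  push Not at hcon
  choose q hq z hz using fun k : ℕ => hcon (k + 1)
  have hq0 : ∀ k, 0 < q k := fun k => (Nat.succ_pos k).trans_le (hq k)
  have hqt : Tendsto q atTop atTop :=
    tendsto_atTop_mono (fun k => (Nat.le_succ k).trans (hq k)) tendsto_id
  -- Empirical measures of orbit pieces violating the bound, with lengths tending to infinity. A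
  -- weak limit of them is T-invariant by telescoping, hence equal to μ, contradicting the violation
  -- for `h`.
  set m : ℕ → Measure X := fun k =>
    (q k : ENNReal)⁻¹ • ∑ j ∈ Finset.range (q k), Measure.dirac (T^[j] (z k)) with hm
  have hprob : ∀ k, IsProbabilityMeasure (m k) := fun k => ⟨by
    simp only [hm, Measure.smul_apply, Measure.finsetSum_apply, measure_univ, Finset.sum_const,
      Finset.card_range, nsmul_eq_mul, mul_one, smul_eq_mul]
    exact ENNReal.inv_mul_cancel (by exact_mod_cast (hq0 k).ne') (ENNReal.natCast_ne_top _)⟩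
  have hint : ∀ k (φ : C(X, ℝ)), ∫ x, φ x ∂m k =
      (q k : ℝ)⁻¹ * ∑ j ∈ Finset.range (q k), φ (T^[j] (z k)) := fun k φ => by
    simp only [hm]
    rw [integral_smul_measure, integral_finsetSum_measure]
    · simp [integral_dirac]
    · intro j _
      exact φ.continuous.integrable_of_hasCompactSupport (HasCompactSupport.of_compactSpace _)
  set M : ℕ → ProbabilityMeasure X := fun k => ⟨m k, hprob k⟩ with hM
  set 𝓤 : Ultrafilter ℕ := hyperfilter ℕ with h𝓤
  have h𝓤le : (𝓤 : Filter ℕ) ≤ atTop := Nat.hyperfilter_le_atTop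
  obtain ⟨ν, -, hν⟩ := isCompact_univ.ultrafilter_le_nhds (𝓤.map M) (by simp)
  have hlim : ∀ φ : C(X, ℝ), Tendsto (fun k => (q k : ℝ)⁻¹ * ∑ j ∈ Finset.range (q k),
      φ (T^[j] (z k))) 𝓤 (𝓝 (∫ x, φ x ∂(ν : Measure X))) := fun φ => by
    have h1 : Tendsto M 𝓤 (𝓝 ν) := hν
    have h2 := ProbabilityMeasure.tendsto_iff_forall_integral_tendsto.1 h1
      (BoundedContinuousFunction.mkOfCompact φ)
    exact h2.congr fun k => hint k φ
  have hinv : IsInvariantProb T (ν : Measure X) := by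
    refine ⟨inferInstance, measurePreserving_of_integral_comp hT fun φ => ?_⟩
    refine tendsto_nhds_unique (hlim (φ.comp ⟨T, hT⟩)) ?_
    have h0 : Tendsto (fun k => (q k : ℝ)⁻¹ * (2 * ‖φ‖)) 𝓤 (𝓝 0) := by
      have := ((tendsto_inv_atTop_nhds_zero_nat (𝕜 := ℝ)).comp hqt).mul_const (2 * ‖φ‖)
      rw [zero_mul] at this
      exact this.mono_left h𝓤le
    have h3 : Tendsto (fun k => (q k : ℝ)⁻¹ * (φ (T^[q k] (z k)) - φ (z k))) 𝓤 (𝓝 0) := by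
      refine squeeze_zero_norm (fun k => ?_) h0
      rw [norm_mul, norm_inv, Real.norm_natCast]
      gcongr
      have h1 := φ.norm_coe_le_norm (z k)
      have h2 := φ.norm_coe_le_norm ((T^[q k]) (z k))
      exact (norm_sub_le _ _).trans (by linarith)
    have h4 := h3.add (hlim φ)
    rw [zero_add] at h4
    refine h4.congr fun k => ?_
    have h5 := Finset.sum_range_sub (fun j => φ (T^[j] (z k))) (q k)
    rw [Finset.sum_sub_distrib] at h5
    simp only [ContinuousMap.comp_apply, ContinuousMap.coe_mk, ← Function.iterate_succ_apply' T]
    simp only [Function.iterate_zero, id] at h5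
    rw [← h5]
    ring
  have h6 := hlim h
  rw [huniq _ hinv] at h6
  obtain ⟨k, hk⟩ := ((tendsto_iff_dist_tendsto_zero.1 h6).eventually_lt_const hε).exists
  rw [Real.dist_eq] at hk
  exact absurd hk (hz k).le.not_gt

end UniformConvergence

end SpecialFlow


namespace SpecialFlow

/-! ### Ergodic sums of the roof and pointwise convergence of flow averages. -/

section Roof

variable {α C : ℝ} {g : C(UnitAddCircle, ℝ)}

lemma continuous_ergodicSum {φ : UnitAddCircle → ℝ} (hφ : Continuous φ) (n : ℕ) :
    Continuous (ergodicSum α φ n) := by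
  unfold ergodicSum; fun_prop

lemma abs_ergodicSum_le_iSup (α : ℝ) (g : C(UnitAddCircle, ℝ)) (n : ℕ) (x : UnitAddCircle) :
    |ergodicSum α g n x| ≤ ⨆ x, |ergodicSum α g n x| :=
  le_ciSup (isCompact_range (continuous_ergodicSum g.continuous n).abs).bddAbove x

lemma GoodRoof.eventually_abs_ergodicSum_le (hg : GoodRoof α g) {ε : ℝ} (hε : 0 < ε) :
    ∀ᶠ n : ℕ in atTop, ∀ x, |ergodicSum α g (convDen α n) x| ≤
      ε * (convDen α (n + 1) : ℝ) ^ (-(4 / 5) : ℝ) := by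
  filter_upwards [hg.rigid.bound hε] with n hn x
  refine (abs_ergodicSum_le_iSup α g _ x).trans ((le_abs_self _).trans (hn.trans (le_of_eq ?_)))
  rw [Real.norm_of_nonneg (by positivity)]

lemma GoodRoof.eventually_abs_ergodicSum_le' (hg : GoodRoof α g) {ε : ℝ} (hε : 0 < ε) :
    ∀ᶠ n : ℕ in atTop, ∀ x, |ergodicSum α g (convDen α n) x| ≤ ε := by
  filter_upwards [hg.eventually_abs_ergodicSum_le hε] with n hn x
  refine (hn x).trans (mul_le_of_le_one_right hε.le ?_)
  exact Real.rpow_le_one_of_one_le_of_nonpos (by exact_mod_cast convDen_pos α (n + 1)) (by norm_num)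

lemma integral_ergodicSum {φ : UnitAddCircle → ℝ} (hφ : Continuous φ) (n : ℕ) :
    ∫ x, ergodicSum α φ n x = n * ∫ x, φ x := by
  unfold ergodicSum
  rw [integral_finsetSum]
  · simp_rw [integral_add_right_eq_self φ]
    simp
  · intro i _
    exact (by fun_prop : Continuous fun x : UnitAddCircle => φ (x + i • (α : UnitAddCircle))
      ).integrable_of_hasCompactSupport (HasCompactSupport.of_compactSpace _)

/-- The integral of S_{q_n}(g) is q_n ∫ g, and S_{q_n}(g) is uniformly small. Consequently C is the
mean of the roof. -/
lemma GoodRoof.integral_eq_zero (hg : GoodRoof α g) : ∫ x, g x = 0 := by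
  refine abs_nonpos_iff.1 (le_of_forall_pos_le_add fun ε hε => ?_)
  obtain ⟨n, hn⟩ := (hg.eventually_abs_ergodicSum_le' hε).exists
  have h1 := norm_integral_le_of_norm_le_const (μ := (volume : Measure UnitAddCircle))
    (f := ergodicSum α g (convDen α n)) (.of_forall hn)
  rw [integral_ergodicSum g.continuous, probReal_univ, mul_one, norm_mul, Real.norm_natCast,
    Real.norm_eq_abs] at h1
  have h2 : (1 : ℝ) ≤ convDen α n := by exact_mod_cast convDen_pos α n
  nlinarith [abs_nonneg (∫ x, g x)]

lemma roof_pos (hC : -(⨅ x : UnitAddCircle, g x) < C) (x : UnitAddCircle) : 0 < g x + C := by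
  have := ciInf_le (isCompact_range g.continuous).bddBelow x
  linarith

lemma GoodRoof.height_pos (hg : GoodRoof α g) (hC : -(⨅ x : UnitAddCircle, g x) < C) : 0 < C := by
  have h1 : 0 < ∫ x, (g x + C) := integral_roof_pos (f := fun x => g x + C) (by fun_prop) (roof_pos hC)
  rw [integral_add (g.continuous.integrable_of_hasCompactSupport
    (HasCompactSupport.of_compactSpace _)) (integrable_const _), hg.integral_eq_zero,
    integral_const, probReal_univ, one_smul, zero_add] at h1
  exact h1

lemma GoodRoof.integral_roof (hg : GoodRoof α g) : ∫ x, (g x + C) = C := by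
  rw [integral_add (g.continuous.integrable_of_hasCompactSupport
    (HasCompactSupport.of_compactSpace _)) (integrable_const _), hg.integral_eq_zero,
    integral_const, probReal_univ, one_smul, zero_add]

lemma ergodicSum_add_const (φ : UnitAddCircle → ℝ) (n : ℕ) (x : UnitAddCircle) :
    ergodicSum α (fun x => φ x + C) n x = ergodicSum α φ n x + n * C := by
  simp [ergodicSum, Finset.sum_add_distrib]

lemma ergodicSum_succ (φ : UnitAddCircle → ℝ) (n : ℕ) (x : UnitAddCircle) :
    ergodicSum α φ (n + 1) x = ergodicSum α φ n x + φ (x + n • (α : UnitAddCircle)) :=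
  Finset.sum_range_succ _ _

variable {f : UnitAddCircle → ℝ}

lemma mk_add_ergodicSum (n : ℕ) (x : UnitAddCircle) (y : ℝ) :
    mk α f (x, y + ergodicSum α f n x) = mk α f (x + n • (α : UnitAddCircle), y) := by
  induction n generalizing y with
  | zero => simp [ergodicSum]
  | succ n ih =>
    rw [ergodicSum_succ, ← add_assoc, add_right_comm, ih, ← mk_step, step_apply,
      add_sub_cancel_right, succ_nsmul, add_assoc]

/-- The integral of `h` over the fibre above `x`. -/
noncomputable def fibreIntegral (α : ℝ) (f : UnitAddCircle → ℝ) (h : Space α f → ℝ)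
    (x : UnitAddCircle) : ℝ := ∫ y in (0 : ℝ)..f x, h (mk α f (x, y))

lemma continuous_fibreIntegral (hf : Continuous f) (h : C(Space α f, ℝ)) :
    Continuous (fibreIntegral α f h) :=
  intervalIntegral.continuous_parametric_intervalIntegral_of_continuous
    (f := fun x y => h (mk α f (x, y))) (h.continuous.comp continuous_mk) hf

lemma intervalIntegrable_orbit (h : C(Space α f, ℝ)) (x : UnitAddCircle) (a b : ℝ) :
    IntervalIntegrable (fun t => h (mk α f (x, t))) volume a b :=
  (h.continuous.comp (continuous_mk.comp (Continuous.prodMk_right x))).intervalIntegrable _ _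

lemma integral_ergodicSum_orbit (h : C(Space α f, ℝ)) (n : ℕ) (x : UnitAddCircle) :
    ∫ t in (0 : ℝ)..ergodicSum α f n x, h (mk α f (x, t)) =
      ∑ i ∈ Finset.range n, fibreIntegral α f h (x + i • (α : UnitAddCircle)) := by
  induction n with
  | zero => simp [ergodicSum]
  | succ n ih =>
    rw [Finset.sum_range_succ, ← ih, ← intervalIntegral.integral_add_adjacent_intervals
      (intervalIntegrable_orbit h x 0 (ergodicSum α f n x)) (intervalIntegrable_orbit h x _ _)]
    congr 1
    simp only [fibreIntegral, ← mk_add_ergodicSum]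
    rw [intervalIntegral.integral_comp_add_right (fun t => h (mk α f (x, t))), zero_add,
      ergodicSum_succ, add_comm]

lemma norm_integral_orbit_le (h : C(Space α f, ℝ)) [CompactSpace (Space α f)] (x : UnitAddCircle)
    (a b : ℝ) : |∫ t in a..b, h (mk α f (x, t))| ≤ ‖h‖ * |b - a| :=
  intervalIntegral.norm_integral_le_of_norm_le_const fun _ _ => h.norm_coe_le_norm _

/-- The flow averages over the times `q_n C` converge at every point. -/
theorem tendsto_avg_flow (hα : Irrational α) (hg : GoodRoof α g) (hfg : f = fun x => g x + C)
    (hpos : ∀ x, 0 < f x) (hC : 0 < C) (h : C(Space α f, ℝ)) (z : Space α f) :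
    Tendsto (fun n : ℕ => (convDen α n : ℝ)⁻¹ * ∫ t in (0 : ℝ)..convDen α n * C, h (flow α f t z))
      atTop (𝓝 (C * ∫ w, h w ∂lebesgue α f)) := by
  have hf : Continuous f := by rw [hfg]; fun_prop
  have hc : CompactSpace (Space α f) := compactSpace hf hpos
  have hfC : ∫ x, f x = C := by rw [hfg]; exact hg.integral_roof
  obtain ⟨⟨x, y⟩, rfl⟩ := mk_surjective α f z
  have hlim : C * ∫ w, h w ∂lebesgue α f = ∫ x, fibreIntegral α f h x := by
    rw [integral_lebesgue hf hpos, hfC, mul_inv_cancel_left₀ hC.ne']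
    rfl
  have h1 := (tendsto_avg_rotation hα ⟨_, continuous_fibreIntegral hf h⟩ x).comp
    (tendsto_convDen hα)
  rw [hlim]
  -- Because S_{q_n}(f)(x) = q_n C + S_{q_n}(g)(x) with the last term bounded, the orbit piece of
  -- length q_n C consists of the q_n full fibres over x, …, x + (q_n − 1)α, up to two pieces of
  -- bounded length at the ends. The claim becomes Weyl's theorem for the fibre integral.
  have h2 : Tendsto (fun n : ℕ => (convDen α n : ℝ)⁻¹ * ((∫ t in (0 : ℝ)..convDen α n * C,
      h (flow α f t (mk α f (x, y)))) - ∑ i ∈ Finset.range (convDen α n),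
        fibreIntegral α f h (x + i • (α : UnitAddCircle)))) atTop (𝓝 0) := by
    have h0 : Tendsto (fun n : ℕ => (convDen α n : ℝ)⁻¹ * (‖h‖ * |y| + ‖h‖ * (|y| + 1))) atTop
        (𝓝 0) := by
      simpa using ((tendsto_inv_atTop_nhds_zero_nat (𝕜 := ℝ)).comp (tendsto_convDen hα)).mul_const
        (‖h‖ * |y| + ‖h‖ * (|y| + 1))
    refine squeeze_zero_norm' ?_ h0
    filter_upwards [hg.eventually_abs_ergodicSum_le' one_pos] with n hn
    rw [norm_mul, norm_inv, Real.norm_natCast, ← integral_ergodicSum_orbit]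
    gcongr
    simp only [flow_mk]
    rw [intervalIntegral.integral_comp_add_left (fun t => h (mk α f (x, t))), add_zero,
      intervalIntegral.integral_interval_sub_interval_comm' (intervalIntegrable_orbit h x _ _)
        (intervalIntegrable_orbit h x _ _) (intervalIntegrable_orbit h x _ _)]
    refine (norm_sub_le _ _).trans ?_
    rw [add_comm]
    refine add_le_add ?_ ?_
    · refine (norm_integral_orbit_le h x _ _).trans (le_of_eq ?_)
      simp
    · refine (norm_integral_orbit_le h x _ _).trans ?_
      gcongr
      have h3 : ergodicSum α f (convDen α n) x = ergodicSum α g (convDen α n) x + convDen α n * C := by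
        rw [hfg, ergodicSum_add_const]
      rw [h3]
      calc _ = |y - ergodicSum α g (convDen α n) x| := by congr 1; ring
        _ ≤ |y| + |ergodicSum α g (convDen α n) x| := abs_sub _ _
        _ ≤ |y| + 1 := by gcongr; exact hn x
  have h4 := h2.add h1
  rw [zero_add] at h4
  refine h4.congr fun n => ?_
  simp only [Function.comp_apply, ContinuousMap.coe_mk]
  ring

lemma integral_flow_eq_sum (hf : Continuous f) (h : C(Space α f, ℝ)) (N : ℕ) (z : Space α f) :
    ∫ t in (0 : ℝ)..N * C, h (flow α f t z) = ∑ j ∈ Finset.range N,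
      ∫ t in (0 : ℝ)..C, h (flow α f t ((flow α f C)^[j] z)) := by
  have hint : ∀ a b, IntervalIntegrable (fun t => h (flow α f t z)) volume a b := fun a b =>
    (h.continuous.comp ((continuous_flow_uncurry hf).comp
      (Continuous.prodMk_left z))).intervalIntegrable _ _
  induction N with
  | zero => simp
  | succ N ih =>
    rw [Finset.sum_range_succ, ← ih, ← intervalIntegral.integral_add_adjacent_intervals
      (hint 0 (N * C)) (hint _ _)]
    congr 1
    simp only [flow_iterate, flow_add]
    rw [intervalIntegral.integral_comp_add_left (fun t => h (flow α f t z))]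
    congr 1 <;> push_cast <;> ring

end Roof

end SpecialFlow


namespace SpecialFlow

/-! ### Unique ergodicity of the time-C map. -/

section UniqueErgodicity

variable {α C : ℝ} {g : C(UnitAddCircle, ℝ)} {f : UnitAddCircle → ℝ}

/-- The integral over `t ∈ (0, δ]` of the images of `ν` under `T_t`. -/
noncomputable def flowAverage (α : ℝ) (f : UnitAddCircle → ℝ) (ν : Measure (Space α f)) (δ : ℝ) :
    Measure (Space α f) :=
  (ν.prod (volume.restrict (Set.Ioc 0 δ))).map fun p => flow α f p.2 p.1

lemma continuous_flow_swap (hf : Continuous f) :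
    Continuous fun p : Space α f × ℝ => flow α f p.2 p.1 :=
  (continuous_flow_uncurry hf).comp continuous_swap

lemma measurable_flow_swap (hf : Continuous f) :
    Measurable fun p : Space α f × ℝ => flow α f p.2 p.1 := by
  have := secondCountableTopology (α := α) hf
  exact (continuous_flow_swap hf).measurable

lemma isFiniteMeasure_flowAverage {ν : Measure (Space α f)} [IsFiniteMeasure ν] (δ : ℝ) :
    IsFiniteMeasure (flowAverage α f ν δ) :=
  Measure.isFiniteMeasure_map _ _

lemma integral_flowAverage (hf : Continuous f) (hpos : ∀ x, 0 < f x) {ν : Measure (Space α f)}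
    [IsFiniteMeasure ν] {δ : ℝ} (hδ : 0 ≤ δ) (h : C(Space α f, ℝ)) :
    ∫ z, h z ∂flowAverage α f ν δ = ∫ z, (∫ t in (0 : ℝ)..δ, h (flow α f t z)) ∂ν := by
  have := secondCountableTopology (α := α) hf
  have hc : CompactSpace (Space α f) := compactSpace hf hpos
  have hcont := h.continuous.comp (continuous_flow_swap hf)
  rw [flowAverage, integral_map (measurable_flow_swap hf).aemeasurable
    h.continuous.aestronglyMeasurable, integral_prod]
  · refine integral_congr_ae (.of_forall fun z => ?_)
    simp only [intervalIntegral.integral_of_le hδ]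
  · exact Integrable.of_bound hcont.aestronglyMeasurable ‖h‖
      (.of_forall fun p => h.norm_coe_le_norm _)

lemma measurePreserving_flowAverage (hf : Continuous f) {ν : Measure (Space α f)}
    [IsFiniteMeasure ν] (hν : MeasurePreserving (flow α f C) ν ν) (δ : ℝ) :
    MeasurePreserving (flow α f C) (flowAverage α f ν δ) (flowAverage α f ν δ) := by
  refine ⟨hν.measurable, ?_⟩
  have h1 := hν.prod (MeasurePreserving.id (volume.restrict (Set.Ioc (0 : ℝ) δ)))
  have hm := measurable_flow_swap (α := α) hf
  rw [flowAverage, Measure.map_map hν.measurable hm]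
  conv_rhs => rw [← h1.map_eq, Measure.map_map hm h1.measurable]
  congr 1
  ext p
  simp only [Function.comp_apply, Prod.map_fst, Prod.map_snd, id, flow_add, add_comm]

lemma flowAverage_mono (hf : Continuous f) {ν : Measure (Space α f)} [IsFiniteMeasure ν] {δ δ' : ℝ}
    (h : δ ≤ δ') : flowAverage α f ν δ ≤ flowAverage α f ν δ' :=
  Measure.map_mono (Measure.prod_mono le_rfl (Measure.restrict_mono (Set.Ioc_subset_Ioc_right h)
    le_rfl)) (measurable_flow_swap hf)

lemma flowAverage_univ (hf : Continuous f) {ν : Measure (Space α f)} [IsProbabilityMeasure ν] (δ : ℝ) :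
    flowAverage α f ν δ Set.univ = ENNReal.ofReal δ := by
  rw [flowAverage, Measure.map_apply (measurable_flow_swap hf) MeasurableSet.univ,
    Set.preimage_univ, Measure.prod_apply MeasurableSet.univ]
  simp

/-- By T-invariance, the ν-integral of q_n⁻¹ ∫ h(T_t z) dt over 0 ≤ t ≤ q_n C is independent of n
and equals the integral of h against the left side. By dominated convergence it tends to C ∫ h dμ.
-/
lemma flowAverage_height (hα : Irrational α) (hg : GoodRoof α g) (hfg : f = fun x => g x + C)
    (hpos : ∀ x, 0 < f x) (hC : 0 < C) {ν : Measure (Space α f)}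
    (hν : IsInvariantProb (flow α f C) ν) :
    flowAverage α f ν C = ENNReal.ofReal C • lebesgue α f := by
  have hf : Continuous f := by rw [hfg]; fun_prop
  have hc : CompactSpace (Space α f) := compactSpace hf hpos
  have := t2Space (α := α) hf hpos
  have := secondCountableTopology (α := α) hf
  have := isProbabilityMeasure_lebesgue (α := α) hf hpos
  have := hν.isProbabilityMeasure
  have := isFiniteMeasure_flowAverage (ν := ν) C
  have : IsFiniteMeasure (ENNReal.ofReal C • lebesgue α f) :=
    Measure.smul_finite _ ENNReal.ofReal_ne_top
  refine ext_of_forall_integral_eq_of_IsFiniteMeasure fun φ => ?_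
  set h : C(Space α f, ℝ) := φ.toContinuousMap with hh
  change ∫ z, h z ∂_ = ∫ z, h z ∂_
  rw [integral_flowAverage hf hpos hC.le, integral_smul_measure, ENNReal.toReal_ofReal hC.le,
    smul_eq_mul]
  set Φ : Space α f → ℝ := fun z => ∫ t in (0 : ℝ)..C, h (flow α f t z) with hΦ
  have hΦc : Continuous Φ := intervalIntegral.continuous_parametric_intervalIntegral_of_continuous'
    (f := fun z t => h (flow α f t z)) (h.continuous.comp (continuous_flow_swap hf)) 0 C
  have hlim : Tendsto (fun n : ℕ => ∫ z, ((convDen α n : ℝ)⁻¹ *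
      ∫ t in (0 : ℝ)..convDen α n * C, h (flow α f t z)) ∂ν) atTop
      (𝓝 (∫ _, (C * ∫ w, h w ∂lebesgue α f) ∂ν)) := by
    refine tendsto_integral_of_dominated_convergence (fun _ => ‖h‖ * C) (fun n => ?_)
      (integrable_const _) (fun n => .of_forall fun z => ?_)
      (.of_forall fun z => tendsto_avg_flow hα hg hfg hpos hC h z)
    · refine ((intervalIntegral.continuous_parametric_intervalIntegral_of_continuous'
        (f := fun z t => h (flow α f t z)) (h.continuous.comp (continuous_flow_swap hf))
        0 _).const_mul _).aestronglyMeasurable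
    · have hq : (0 : ℝ) < convDen α n := by exact_mod_cast convDen_pos α n
      rw [norm_mul, norm_inv, Real.norm_natCast, inv_mul_le_iff₀ hq]
      refine (intervalIntegral.norm_integral_le_of_norm_le_const
        fun _ _ => h.norm_coe_le_norm _).trans (le_of_eq ?_)
      rw [sub_zero, abs_of_pos (by positivity)]
      ring
  rw [integral_const, probReal_univ, one_smul] at hlim
  refine tendsto_nhds_unique (tendsto_const_nhds.congr fun n => ?_) hlim
  have hq : (convDen α n : ℝ) ≠ 0 := by exact_mod_cast (convDen_pos α n).ne'
  simp only [integral_flow_eq_sum hf h]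
  rw [integral_const_mul, integral_finsetSum]
  · have h1 : ∀ j : ℕ, ∫ z, Φ ((flow α f C)^[j] z) ∂ν = ∫ z, Φ z ∂ν := fun j => by
      have h2 := hν.measurePreserving.iterate j
      conv_rhs => rw [← h2.map_eq, integral_map h2.measurable.aemeasurable
        hΦc.aestronglyMeasurable]
    rw [Finset.sum_congr rfl fun j _ => h1 j, Finset.sum_const, Finset.card_range, nsmul_eq_mul,
      inv_mul_cancel_left₀ hq]
  · intro j _
    exact (hΦc.comp ((continuous_flow hf C).iterate j)).integrable_of_hasCompactSupport
      (HasCompactSupport.of_compactSpace _)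

theorem eq_lebesgue_of_isInvariantProb (hα : Irrational α) (hg : GoodRoof α g)
    (hfg : f = fun x => g x + C) (hpos : ∀ x, 0 < f x) (hC : 0 < C) {ν : Measure (Space α f)}
    (hν : IsInvariantProb (flow α f C) ν) : ν = lebesgue α f := by
  have hf : Continuous f := by rw [hfg]; fun_prop
  have hc : CompactSpace (Space α f) := compactSpace hf hpos
  have := t2Space (α := α) hf hpos
  have := secondCountableTopology (α := α) hf
  have := isProbabilityMeasure_lebesgue (α := α) hf hpos
  have := hν.isProbabilityMeasure
  have havg : ∀ δ, 0 < δ → δ ≤ C → flowAverage α f ν δ = ENNReal.ofReal δ • lebesgue α f := by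
    intro δ hδ hδC
    have := isFiniteMeasure_flowAverage (ν := ν) δ
    -- The average up to δ is dominated by the average up to C, a multiple of μ. Being T-invariant,
    -- it is itself a multiple of the ergodic measure μ, and total mass fixes the factor.
    have hac : flowAverage α f ν δ ≪ lebesgue α f := by
      refine (flowAverage_mono hf hδC).absolutelyContinuous.trans ?_
      rw [flowAverage_height hα hg hfg hpos hC hν]
      exact Measure.smul_absolutelyContinuous
    obtain ⟨c, hc⟩ := (ergodic_flow hα hg hfg hpos hC).eq_smul_of_absolutelyContinuous
      (measurePreserving_flowAverage hf hν.measurePreserving δ) hac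
    have h1 := flowAverage_univ (α := α) hf (ν := ν) δ
    rw [hc, Measure.smul_apply, measure_univ, smul_eq_mul, mul_one] at h1
    rw [hc, h1]
  refine ext_of_forall_integral_eq_of_IsFiniteMeasure fun φ => ?_
  set h : C(Space α f, ℝ) := φ.toContinuousMap with hh
  change ∫ z, h z ∂_ = ∫ z, h z ∂_
  -- The rescaling t = δs makes the mean over (0, δ] continuous in δ up to δ = 0, where it is `h`.
  set K : ℝ → Space α f → ℝ := fun δ z => ∫ s in (0 : ℝ)..1, h (flow α f (δ * s) z) with hK
  have hKc : Continuous fun p : ℝ × Space α f => K p.1 p.2 :=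
    intervalIntegral.continuous_parametric_intervalIntegral_of_continuous'
      (f := fun (p : ℝ × Space α f) s => h (flow α f (p.1 * s) p.2)) (h.continuous.comp
        ((continuous_flow_uncurry hf).comp (by fun_prop :
          Continuous fun p : (ℝ × Space α f) × ℝ => (p.1.1 * p.2, p.1.2)))) 0 1
  have hKavg : ∀ δ, 0 < δ → δ ≤ C → ∫ z, K δ z ∂ν = ∫ z, h z ∂lebesgue α f := by
    intro δ hδ hδC
    have h1 := integral_flowAverage (ν := ν) hf hpos hδ.le h
    rw [havg δ hδ hδC, integral_smul_measure, ENNReal.toReal_ofReal hδ.le, smul_eq_mul] at h1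
    have h2 : ∀ z, K δ z = δ⁻¹ * ∫ t in (0 : ℝ)..δ, h (flow α f t z) := fun z => by
      simp only [hK]
      rw [intervalIntegral.integral_comp_mul_left (fun t => h (flow α f t z)) hδ.ne', mul_zero,
        mul_one, smul_eq_mul]
    simp only [h2]
    rw [integral_const_mul, ← h1, inv_mul_cancel_left₀ hδ.ne']
  have hδ0 : Tendsto (fun k : ℕ => C * (1 / ((k : ℝ) + 1))) atTop (𝓝 0) := by
    simpa using tendsto_one_div_add_atTop_nhds_zero_nat.const_mul C
  have hlim : Tendsto (fun k : ℕ => ∫ z, K (C * (1 / ((k : ℝ) + 1))) z ∂ν) atTop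
      (𝓝 (∫ z, K 0 z ∂ν)) := by
    refine tendsto_integral_of_dominated_convergence (fun _ => ‖h‖) (fun k => ?_)
      (integrable_const _) (fun k => .of_forall fun z => ?_) (.of_forall fun z => ?_)
    · exact (hKc.comp (Continuous.prodMk_right _)).aestronglyMeasurable
    · refine (intervalIntegral.norm_integral_le_of_norm_le_const
        fun _ _ => h.norm_coe_le_norm _).trans (le_of_eq (by simp))
    · exact ((hKc.comp (Continuous.prodMk_left z)).tendsto 0).comp hδ0
  have hK0 : ∀ z, K 0 z = h z := fun z => by simp [hK, flow_zero]
  simp only [hK0] at hlim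
  refine tendsto_nhds_unique hlim (tendsto_const_nhds.congr fun k => ?_)
  refine (hKavg _ (by positivity) (mul_le_of_le_one_right hC.le ?_)).symm
  rw [div_le_one (by positivity)]
  linarith [Nat.cast_nonneg (α := ℝ) k]

theorem uniquelyErgodic_flow (hα : Irrational α) (hg : GoodRoof α g)
    (hfg : f = fun x => g x + C) (hpos : ∀ x, 0 < f x) (hC : 0 < C) :
    UniquelyErgodic (flow α f C) := by
  have hf : Continuous f := by rw [hfg]; fun_prop
  exact ⟨lebesgue α f, ⟨isProbabilityMeasure_lebesgue hf hpos, measurePreserving_flow hf hpos C⟩,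
    fun ν hν => eq_lebesgue_of_isInvariantProb hα hg hfg hpos hC hν⟩

end UniqueErgodicity

end SpecialFlow


namespace SpecialFlow

/-! ### Rigidity: iterates close to the identity. -/

section SlowVariation

variable {α C : ℝ} {g : C(UnitAddCircle, ℝ)} {f : UnitAddCircle → ℝ}

lemma ergodicSum_add (φ : UnitAddCircle → ℝ) (m n : ℕ) (x : UnitAddCircle) :
    ergodicSum α φ (m + n) x = ergodicSum α φ m x + ergodicSum α φ n (x + m • (α : UnitAddCircle)) := by
  simp only [ergodicSum, Finset.sum_range_add, add_nsmul, add_assoc]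

lemma abs_ergodicSum_mul_le {φ : UnitAddCircle → ℝ} {q : ℕ} {B : ℝ}
    (h : ∀ x, |ergodicSum α φ q x| ≤ B) (k : ℕ) (x : UnitAddCircle) :
    |ergodicSum α φ (k * q) x| ≤ k * B := by
  induction k generalizing x with
  | zero => simp [ergodicSum]
  | succ k ih =>
    rw [add_mul, one_mul, ergodicSum_add]
    refine (abs_add_le _ _).trans ?_
    push_cast
    linarith [ih x, h (x + (k * q) • (α : UnitAddCircle))]

lemma norm_convDen_nsmul_le (hα : Irrational α) (n : ℕ) :
    ‖convDen α n • (α : UnitAddCircle)‖ ≤ 1 / convDen α (n + 1) := by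
  have h1 : convDen α n • (α : UnitAddCircle) =
      ((convDen α n * α - (Real.convergent α n).num : ℝ) : UnitAddCircle) := by
    rw [AddCircle.coe_sub, ← nsmul_eq_mul, AddCircle.coe_nsmul]
    have h2 : (((Real.convergent α n).num : ℝ) : UnitAddCircle) = 0 :=
      (AddCircle.coe_eq_zero_iff 1).2 ⟨(Real.convergent α n).num, by simp⟩
    rw [h2, sub_zero]
  rw [h1]
  exact QuotientAddGroup.norm_mk_le_norm.trans (abs_convDen_mul_sub_le hα n)

/-- The elapsed time nC cancels the constant part of S_n(f) = S_n(g) + nC. This is why the flow time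
is taken equal to the constant in the roof. -/
lemma flow_iterate_mk (hfg : f = fun x => g x + C) (n : ℕ) (x : UnitAddCircle) (y : ℝ) :
    (flow α f C)^[n] (mk α f (x, y)) =
      mk α f (x + n • (α : UnitAddCircle), y - ergodicSum α g n x) := by
  rw [flow_iterate, flow_mk, ← mk_add_ergodicSum]
  have h : ergodicSum α f n x = ergodicSum α g n x + n * C := by rw [hfg, ergodicSum_add_const]
  rw [h]
  congr 2
  ring

/-- The iterates `T^{k q_n}` are uniformly close to the identity for `k` up to a multiple of
`q_{n+1}^{4/5}`. -/
theorem eventually_abs_iterate_mul_sub_le (hα : Irrational α) (hg : GoodRoof α g)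
    (hfg : f = fun x => g x + C) (hpos : ∀ x, 0 < f x) (h : C(Space α f, ℝ)) {K : ℝ} (hK : 0 < K)
    {ε : ℝ} (hε : 0 < ε) :
    ∀ᶠ n : ℕ in atTop, ∀ (z : Space α f) (k : ℕ), (k : ℝ) ≤ K * (convDen α (n + 1) : ℝ) ^ (4 / 5 : ℝ) →
      |h ((flow α f C)^[k * convDen α n] z) - h z| ≤ ε := by
  have hf : Continuous f := by rw [hfg]; fun_prop
  obtain ⟨R, hR⟩ := exists_le_bound hf
  -- The margin 1 on both sides of [0, R] keeps the displaced points in the compact strip, since the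
  -- vertical displacement is at most η ≤ 1.
  have hcpt : IsCompact ((Set.univ : Set UnitAddCircle) ×ˢ Set.Icc (-1 : ℝ) (R + 1)) :=
    isCompact_univ.prod isCompact_Icc
  have huc := hcpt.uniformContinuousOn_of_continuous
    (h.continuous.comp (continuous_mk (α := α) (f := f))).continuousOn
  obtain ⟨δ, hδ, huc⟩ := Metric.uniformContinuousOn_iff.1 huc ε hε
  set η : ℝ := min (δ / 2) 1 with hη
  have hη0 : 0 < η := by positivity
  have hQ : Tendsto (fun n : ℕ => K * (convDen α (n + 1) : ℝ) ^ (-(1 / 5) : ℝ)) atTop (𝓝 0) := by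
    simpa using ((tendsto_rpow_neg_atTop (by norm_num : (0 : ℝ) < 1 / 5)).comp
      (tendsto_natCast_atTop_atTop.comp ((tendsto_convDen hα).comp (tendsto_add_atTop_nat 1)))
      ).const_mul K
  filter_upwards [hg.eventually_abs_ergodicSum_le (ε := η / K) (by positivity),
    hQ.eventually_lt_const hδ] with n hn hnQ z k hk
  obtain ⟨⟨x, y⟩, ⟨hy0, hy1⟩, rfl⟩ := exists_fundDomain_rep (α := α) hf hpos z
  simp only at hy0 hy1
  have hQ0 : (0 : ℝ) < convDen α (n + 1) := by exact_mod_cast convDen_pos α (n + 1)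
  have hS : |ergodicSum α g (k * convDen α n) x| ≤ η := by
    refine (abs_ergodicSum_mul_le hn k x).trans ?_
    calc (k : ℝ) * (η / K * (convDen α (n + 1) : ℝ) ^ (-(4 / 5) : ℝ))
        ≤ (K * (convDen α (n + 1) : ℝ) ^ (4 / 5 : ℝ)) *
          (η / K * (convDen α (n + 1) : ℝ) ^ (-(4 / 5) : ℝ)) := by gcongr
      _ = η * ((convDen α (n + 1) : ℝ) ^ (4 / 5 : ℝ) *
          (convDen α (n + 1) : ℝ) ^ (-(4 / 5) : ℝ)) := by field_simp
      _ = η := by rw [← Real.rpow_add hQ0]; simp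
  have hrot : ‖(k * convDen α n) • (α : UnitAddCircle)‖ < δ := by
    rw [mul_nsmul']
    refine (norm_nsmul_le).trans_lt (lt_of_le_of_lt ?_ hnQ)
    calc (k : ℝ) * ‖convDen α n • (α : UnitAddCircle)‖
        ≤ (K * (convDen α (n + 1) : ℝ) ^ (4 / 5 : ℝ)) * (1 / convDen α (n + 1)) := by
          gcongr; exact norm_convDen_nsmul_le hα n
      _ = K * ((convDen α (n + 1) : ℝ) ^ (4 / 5 : ℝ) * (convDen α (n + 1) : ℝ) ^ (-1 : ℝ)) := by
          rw [Real.rpow_neg_one]; ring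
      _ = _ := by rw [← Real.rpow_add hQ0]; norm_num
  rw [flow_iterate_mk hfg, ← Real.dist_eq]
  have hS' := abs_le.1 (hS.trans (min_le_right _ _))
  refine (huc _ ⟨trivial, ?_, ?_⟩ _ ⟨trivial, ?_, ?_⟩ ?_).le
  · simp only; linarith
  · simp only; linarith [hR x]
  · simp only; linarith
  · simp only; linarith [hR x]
  · rw [Prod.dist_eq, max_lt_iff]
    constructor
    · rw [dist_eq_norm, add_sub_cancel_left]; exact hrot
    · rw [Real.dist_eq, sub_sub_cancel_left, abs_neg]
      exact (hS.trans (min_le_left _ _)).trans_lt (by linarith)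

end SlowVariation

end SpecialFlow


namespace SpecialFlow

/-! ### Equidistribution of square orbits. -/

section Squares

variable {α C : ℝ} {g : C(UnitAddCircle, ℝ)} {f : UnitAddCircle → ℝ}

lemma blockLength_le (q : ℕ) : blockLength q ≤ q := by
  rcases Nat.eq_zero_or_pos q with rfl | hq
  · simp [blockLength]
  refine Nat.ceil_le.2 ?_
  have hq1 : (1 : ℝ) ≤ q := by exact_mod_cast hq
  calc (q : ℝ) ^ (3 / 4 : ℝ) ≤ (q : ℝ) ^ (1 : ℝ) :=
        Real.rpow_le_rpow_of_exponent_le hq1 (by norm_num)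
    _ = q := Real.rpow_one _

lemma sum_zmod_val (q : ℕ) [NeZero q] (a : ℕ → ℝ) :
    ∑ t : ZMod q, a t.val = ∑ j ∈ Finset.range q, a j := by
  obtain ⟨n, rfl⟩ := Nat.exists_eq_succ_of_ne_zero (NeZero.ne q)
  exact (Finset.sum_range (fun j => a j)).symm

lemma cast_eq_of_val_add_mul {q : ℕ} [NeZero q] (t : ZMod q) (m : ℕ) (h : (m : ZMod q) = t) :
    m = m / q * q + t.val := by
  rw [← h, ZMod.val_natCast, Nat.div_add_mod']

/-- Along a block of length `⌈q^{3/4}⌉` with `q = q_{m+1}`, the square orbit of every point is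
nearly equidistributed. -/
theorem eventually_abs_sum_block_sub_le (hα : Irrational α) (hg : GoodRoof α g)
    (hfg : f = fun x => g x + C) (hpos : ∀ x, 0 < f x) (hC : 0 < C) (h : C(Space α f, ℝ))
    {ε : ℝ} (hε : 0 < ε) :
    ∀ᶠ m : ℕ in atTop, ∀ (z : Space α f) (M : ℕ),
      ((M + blockLength (convDen α (m + 1)) : ℕ) : ℝ) ≤
        (convDen α (m + 2) : ℝ) ^ (4 / 5 : ℝ) →
      |∑ i ∈ Finset.range (blockLength (convDen α (m + 1))), h ((flow α f C)^[(M + i) ^ 2] z) -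
        blockLength (convDen α (m + 1)) * ∫ w, h w ∂lebesgue α f| ≤
          blockLength (convDen α (m + 1)) * (6 * ε) := by
  have hf : Continuous f := by rw [hfg]; fun_prop
  have hc : CompactSpace (Space α f) := compactSpace hf hpos
  have := t2Space (α := α) hf hpos
  have := secondCountableTopology (α := α) hf
  set T := flow α f C with hT
  set I := ∫ w, h w ∂lebesgue α f with hI
  have hshift := tendsto_add_atTop_nat 1
  have hslow := eventually_abs_iterate_mul_sub_le hα hg hfg hpos h (K := 4) (by norm_num) hε
  have hq := (tendsto_convDen hα).comp hshift
  filter_upwards [hslow, hshift.eventually hslow,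
    hq.eventually (eventually_abs_avg_sub_le (continuous_flow hf C)
      (fun ν hν => eq_lebesgue_of_isInvariantProb hα hg hfg hpos hC hν) h hε),
    hq.eventually (eventually_abs_sum_quadratic_sub_le (B := ‖h‖) (ε := 2 * ε) (by positivity))]
    with m hslow1 hslow2 havg hquad z M hM
  simp only [Function.comp_apply] at havg hquad
  change ∀ (z : Space α f) (k : ℕ), (k : ℝ) ≤ 4 * (convDen α (m + 2) : ℝ) ^ (4 / 5 : ℝ) →
    |h (T^[k * convDen α (m + 1)] z) - h z| ≤ ε at hslow2
  set q := convDen α (m + 1) with hqdef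
  set p := convDen α m with hpdef
  have hqpos : 0 < q := convDen_pos α (m + 1)
  have : NeZero q := ⟨hqpos.ne'⟩
  have hpq : p ≤ q := convDen_le_succ hα m
  have hqQ : q ≤ convDen α (m + 2) := convDen_le_succ hα (m + 1)
  set L : ℝ := (convDen α (m + 2) : ℝ) ^ (4 / 5 : ℝ) with hL
  have hqL : (q : ℝ) ^ (4 / 5 : ℝ) ≤ L := by
    rw [hL]; gcongr
  have hq1 : (1 : ℝ) ≤ (q : ℝ) ^ (4 / 5 : ℝ) :=
    Real.one_le_rpow (by exact_mod_cast hqpos) (by norm_num)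
  set H := blockLength q with hH
  have hHq : H ≤ q := blockLength_le q
  set w := T^[M ^ 2] z with hw
  set v : (ZMod q)ˣ := ZMod.unitOfCoprime p (convDen_coprime hα m) with hv
  have hvp : (v : ZMod q) = p := ZMod.coe_unitOfCoprime _ _
  set F : ZMod q → ℝ := fun t => h (T^[t.val] w) with hF
  -- passing from an exponent to its residue
  have hres : ∀ k : ℕ, ((k / q : ℕ) : ℝ) ≤ 4 * L → |h (T^[k] w) - F k| ≤ ε := fun k hk => by
    have h1 := cast_eq_of_val_add_mul (q := q) (k : ZMod q) k rfl
    have h2 := hslow2 (T^[(k : ZMod q).val] w) (k / q) hk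
    rwa [← Function.iterate_add_apply, ← h1] at h2
  -- Replacing t by t + s adds sp to the exponent. Rigidity at time p = q_m allows s up to a
  -- multiple of q_{m+1}^{4/5}, which is where `smoothScale` comes from; the reduction of the new
  -- exponent mod q costs the second ε.
  have hG : ∀ t, ∀ s < smoothScale q, |F (v * (t + s)) - F (v * t)| ≤ 2 * ε := by
    intro t s hs
    have hs' : (s : ℝ) < (q : ℝ) ^ (4 / 5 : ℝ) := Nat.lt_ceil.1 hs
    set k := ((v : ZMod q) * t).val with hk
    have hkq : k < q := ZMod.val_lt _
    have h1 : ((s * p + k : ℕ) : ZMod q) = v * (t + s) := by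
      push_cast
      rw [hk, ZMod.natCast_zmod_val, hvp]
      ring
    have h2 : (((s * p + k) / q : ℕ) : ℝ) ≤ 4 * L := by
      have h3 : (s * p + k) / q ≤ s + 1 := by
        refine Nat.div_le_of_le_mul ?_
        nlinarith
      have h4 : (((s * p + k) / q : ℕ) : ℝ) ≤ s + 1 := by exact_mod_cast h3
      linarith
    have h5 := hres _ h2
    rw [h1, Function.iterate_add_apply] at h5
    have h6 := hslow1 (T^[k] w) s (by linarith)
    calc |F (v * (t + s)) - F (v * t)|
        = |(h (T^[s * p] (T^[k] w)) - h (T^[k] w)) -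
            (h (T^[s * p] (T^[k] w)) - F (v * (t + s)))| := by congr 1; simp only [hF, hk]; ring
      _ ≤ _ := abs_sub _ _
      _ ≤ 2 * ε := by linarith
  -- Modulo q the exponent (M+i)² − M² equals p times p⁻¹(M+i)² − p⁻¹M², so `F` at the exponents is
  -- the slowly varying function t ↦ F(pt) along a quadratic sequence with unit leading coefficient.
  have h1 := hquad M v⁻¹ (-((v⁻¹ : (ZMod q)ˣ) : ZMod q) * (M : ZMod q) ^ 2) (fun t => F (v * t))
    (fun t => h.norm_coe_le_norm _) hG
  have h2 : ∑ t, F (v * t) = ∑ j ∈ Finset.range q, h (T^[j] w) := by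
    rw [← sum_zmod_val q (fun j => h (T^[j] w))]
    exact Equiv.sum_comp v.mulLeft F
  rw [h2] at h1
  have h3 := havg w
  have h4 : |∑ i ∈ Finset.range H, h (T^[(M + i) ^ 2] z) - ∑ i ∈ Finset.range H,
      F (v * ((v⁻¹ : (ZMod q)ˣ) * ((M + i : ℕ) : ZMod q) ^ 2 +
        -((v⁻¹ : (ZMod q)ˣ) : ZMod q) * (M : ZMod q) ^ 2))| ≤ H * ε := by
    rw [← Finset.sum_sub_distrib]
    refine (Finset.abs_sum_le_sum_abs _ _).trans
      ((Finset.sum_le_sum (g := fun _ => ε) fun i hi => ?_).trans (by simp))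
    have hiH : i < H := Finset.mem_range.1 hi
    -- The base point is w = T^{M²}z, so only the increment (M+i)² − M² is reduced mod q. Since i ≤
    -- H ≤ q, the quotient k/q is at most 2(M+H), within the range where T^{q} is rigid.
    set k := i * (2 * M + i) with hk
    have h5 : (M + i) ^ 2 = k + M ^ 2 := by rw [hk]; ring
    have h6 : (k : ZMod q) = v * ((v⁻¹ : (ZMod q)ˣ) * ((M + i : ℕ) : ZMod q) ^ 2 +
        -((v⁻¹ : (ZMod q)ˣ) : ZMod q) * (M : ZMod q) ^ 2) := by
      rw [neg_mul, ← sub_eq_add_neg, ← mul_sub, Units.mul_inv_cancel_left, hk]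
      push_cast
      ring
    rw [h5, Function.iterate_add_apply, ← h6]
    refine hres k ?_
    have h7 : k / q ≤ 2 * (M + H) := by
      refine Nat.div_le_of_le_mul ?_
      rw [hk]
      exact Nat.mul_le_mul (hiH.le.trans hHq) (by omega)
    have h8 : ((k / q : ℕ) : ℝ) ≤ 2 * ((M + H : ℕ) : ℝ) := by exact_mod_cast h7
    linarith
  have hH0 : (0 : ℝ) ≤ H := Nat.cast_nonneg _
  have h5 : |(H : ℝ) * ((∑ j ∈ Finset.range q, h (T^[j] w)) / q) - H * I| ≤ H * ε := by
    rw [← mul_sub, abs_mul, abs_of_nonneg hH0, div_eq_inv_mul]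
    gcongr
  -- The 6ε is made of 4ε from the quadratic sequence, ε from the reduction of exponents and ε from
  -- the Birkhoff average.
  rw [abs_le] at h1 h4 h5 ⊢
  constructor <;> linarith [h1.1, h1.2, h4.1, h4.2, h5.1, h5.2]

lemma abs_sum_range_mul_sub_le {a : ℕ → ℝ} {H : ℕ} {I ε : ℝ} {b : ℕ}
    (h : ∀ j < b, |∑ i ∈ Finset.range H, a (j * H + i) - H * I| ≤ H * ε) :
    |∑ i ∈ Finset.range (b * H), a i - (b * H : ℕ) * I| ≤ (b * H : ℕ) * ε := by
  induction b with
  | zero => simp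
  | succ b ih =>
    have h1 := abs_le.1 (ih fun j hj => h j (hj.trans b.lt_succ_self))
    have h2 := abs_le.1 (h b b.lt_succ_self)
    rw [add_mul, one_mul, Finset.sum_range_add, abs_le]
    push_cast at h1 h2 ⊢
    constructor <;> linarith [h1.1, h1.2, h2.1, h2.2]

lemma eventually_blockLength_le {η : ℝ} (hη : 0 < η) :
    ∀ᶠ q : ℕ in atTop, (blockLength q : ℝ) ≤ η * (q : ℝ) ^ (4 / 5 : ℝ) := by
  have h1 : Tendsto (fun q : ℕ => 2 * (q : ℝ) ^ (-(1 / 20) : ℝ)) atTop (𝓝 0) := by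
    simpa using ((tendsto_rpow_neg_atTop (by norm_num : (0 : ℝ) < 1 / 20)).comp
      tendsto_natCast_atTop_atTop).const_mul 2
  filter_upwards [h1.eventually_le_const hη, eventually_ge_atTop 1] with q hq hq1
  have hq1' : (1 : ℝ) ≤ q := by exact_mod_cast hq1
  have h2 : (1 : ℝ) ≤ (q : ℝ) ^ (3 / 4 : ℝ) := Real.one_le_rpow hq1' (by norm_num)
  have h3 : (blockLength q : ℝ) < (q : ℝ) ^ (3 / 4 : ℝ) + 1 := Nat.ceil_lt_add_one (by positivity)
  calc (blockLength q : ℝ) ≤ 2 * (q : ℝ) ^ (3 / 4 : ℝ) := by linarith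
    _ = 2 * (q : ℝ) ^ (-(1 / 20) : ℝ) * (q : ℝ) ^ (4 / 5 : ℝ) := by
      rw [mul_assoc, ← Real.rpow_add (by linarith)]; norm_num
    _ ≤ _ := by gcongr

theorem squareOrbitEquidistributed_flow (hα : Irrational α) (hg : GoodRoof α g)
    (hfg : f = fun x => g x + C) (hpos : ∀ x, 0 < f x) (hC : 0 < C) (z : Space α f) :
    SquareOrbitEquidistributed (flow α f C) (lebesgue α f) z := by
  intro h
  have hf : Continuous f := by rw [hfg]; fun_prop
  have hc : CompactSpace (Space α f) := compactSpace hf hpos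
  set T := flow α f C with hT
  set I := ∫ w, h w ∂lebesgue α f with hI
  rw [Metric.tendsto_atTop]
  intro ε hε
  set B := ‖h‖ + |I| + 1 with hB
  have hB0 : 0 < B := by positivity
  obtain ⟨m₀, hm₀⟩ := eventually_atTop.1 ((eventually_abs_sum_block_sub_le hα hg hfg hpos hC h
    (ε := ε / 24) (by positivity)).and (((tendsto_convDen hα).comp
      (tendsto_add_atTop_nat 1)).eventually (eventually_blockLength_le (η := ε / (4 * B))
        (by positivity))))
  set s : ℕ → ℝ := fun n => (convDen α n : ℝ) ^ (4 / 5 : ℝ) with hs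
  have hsmono : Monotone s := fun i j hij => by
    have : (convDen α i : ℝ) ≤ convDen α j := by exact_mod_cast convDen_monotone hα hij
    simp only [hs]
    gcongr
  have hslim : Tendsto s atTop atTop :=
    (tendsto_rpow_atTop (by norm_num)).comp (tendsto_natCast_atTop_atTop.comp (tendsto_convDen hα))
  refine ⟨⌈s (m₀ + 1)⌉₊ + 1, fun N hN => ?_⟩
  have hN0 : (0 : ℝ) < N := by
    have : 0 < N := by omega
    exact_mod_cast this
  have hNs : s (m₀ + 1) ≤ N := (Nat.le_ceil _).trans (by exact_mod_cast (Nat.le_succ _).trans hN)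
  -- The upper bound on N makes the block estimate valid for every block below N. The lower bound
  -- makes the incomplete last block, shorter than ⌈q_{m+1}^{3/4}⌉, negligible against N.
  obtain ⟨m, hm, hm1, hm2⟩ : ∃ m, m₀ ≤ m ∧ s (m + 1) ≤ N ∧ (N : ℝ) < s (m + 2) := by
    have hex : ∃ n, (N : ℝ) < s n := (hslim.eventually_gt_atTop (N : ℝ)).exists
    classical
    have h1 := Nat.find_spec hex
    have h2 : m₀ + 1 < Nat.find hex := by
      by_contra hcon
      exact absurd (h1.trans_le (hsmono (not_lt.1 hcon))) hNs.not_gt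
    obtain ⟨m, hm⟩ : ∃ m, Nat.find hex = m + 2 := ⟨Nat.find hex - 2, by omega⟩
    refine ⟨m, by omega, ?_, hm ▸ h1⟩
    exact not_lt.1 (Nat.find_min hex (m := m + 1) (by omega))
  obtain ⟨hblock, hlen⟩ := hm₀ m hm
  simp only [Function.comp_apply] at hlen
  set H := blockLength (convDen α (m + 1)) with hH
  have hHpos : 0 < H := Nat.ceil_pos.2 (Real.rpow_pos_of_pos
    (by exact_mod_cast convDen_pos α (m + 1)) _)
  set a : ℕ → ℝ := fun i => h (T^[i ^ 2] z) with ha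
  set b := N / H with hb
  have hsplit : N = b * H + N % H := (Nat.div_add_mod' N H).symm
  have hbH : b * H ≤ N := Nat.div_mul_le_self N H
  have hmain : |∑ i ∈ Finset.range (b * H), a i - (b * H : ℕ) * I| ≤ (b * H : ℕ) * (ε / 4) := by
    refine abs_sum_range_mul_sub_le fun j hj => ?_
    have h1 : j * H + H ≤ b * H := by nlinarith
    have h2 : ((j * H + H : ℕ) : ℝ) ≤ s (m + 2) :=
      (by exact_mod_cast h1.trans hbH : ((j * H + H : ℕ) : ℝ) ≤ N).trans hm2.le
    have h3 := hblock z (j * H) h2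
    rwa [show 6 * (ε / 24) = ε / 4 by ring] at h3
  have hrem : |∑ i ∈ Finset.range (N % H), a (b * H + i) - (N % H : ℕ) * I| ≤ N * (ε / 4) := by
    calc _ ≤ |∑ i ∈ Finset.range (N % H), a (b * H + i)| + |((N % H : ℕ) : ℝ) * I| := abs_sub _ _
      _ ≤ (N % H : ℕ) * ‖h‖ + (N % H : ℕ) * |I| := by
          refine add_le_add ((Finset.abs_sum_le_sum_abs _ _).trans ((Finset.sum_le_sum
            (g := fun _ => ‖h‖) fun i _ => h.norm_coe_le_norm _).trans (by simp))) (le_of_eq ?_)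
          rw [abs_mul, Nat.abs_cast]
      _ ≤ (N % H : ℕ) * B := by
          rw [← mul_add]; gcongr; rw [hB]; linarith
      _ ≤ (ε / (4 * B) * s (m + 1)) * B := by
          gcongr
          exact le_trans (by exact_mod_cast (Nat.mod_lt N hHpos).le) hlen
      _ ≤ (ε / (4 * B) * N) * B := by gcongr
      _ = _ := by field_simp
  have htot : |∑ i ∈ Finset.range N, a i - N * I| ≤ N * (ε / 2) := by
    have h1 : ∑ i ∈ Finset.range N, a i = ∑ i ∈ Finset.range (b * H), a i +
        ∑ i ∈ Finset.range (N % H), a (b * H + i) := by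
      conv_lhs => rw [hsplit, Finset.sum_range_add]
    have h2 : (N : ℝ) = (b * H : ℕ) + (N % H : ℕ) := by exact_mod_cast hsplit
    have h3 : ((b * H : ℕ) : ℝ) * (ε / 4) ≤ N * (ε / 4) := by
      gcongr
    rw [h1]
    have h4 := abs_le.1 hmain
    have h5 := abs_le.1 hrem
    have h6 : (N : ℝ) * I = (b * H : ℕ) * I + (N % H : ℕ) * I := by rw [← add_mul, ← h2]
    rw [abs_le]
    constructor <;> linarith [h4.1, h4.2, h5.1, h5.2]
  rw [Real.dist_eq]
  have h7 : 1 / (N : ℝ) * ∑ i ∈ Finset.range N, a i - I =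
      (∑ i ∈ Finset.range N, a i - N * I) / N := by field_simp
  rw [h7, abs_div, abs_of_pos hN0, div_lt_iff₀ hN0]
  nlinarith

end Squares

end SpecialFlow


namespace SpecialFlow

/-! ### Growth of denominators and the gaps of a Liouville number. -/

section Denominators

variable {α : ℝ}

/-- Denominators at least double every two steps and (3/4)² > 1/2; the factor 2 covers a single step
without growth. -/
lemma convDen_le_geom_mul (hα : Irrational α) (n j : ℕ) :
    (convDen α n : ℝ) ≤ 2 * (3 / 4 : ℝ) ^ j * convDen α (n + j) := by
  have h0 : ∀ k, (0 : ℝ) ≤ convDen α k := fun k => Nat.cast_nonneg _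
  induction j using Nat.twoStepInduction with
  | zero => simp; linarith [h0 n]
  | one =>
    have : (convDen α n : ℝ) ≤ convDen α (n + 1) := by exact_mod_cast convDen_le_succ hα n
    linarith [h0 n]
  | more j ih _ =>
    have h1 : (2 * convDen α (n + j) : ℝ) ≤ convDen α (n + (j + 2)) := by
      have := two_pow_mul_convDen_le hα (n + j) 1
      rw [pow_one, mul_one, add_assoc] at this
      exact_mod_cast this
    have h2 : (0 : ℝ) < (3 / 4) ^ j := by positivity
    rw [pow_add]
    nlinarith [h0 (n + (j + 2))]

lemma tendsto_mul_convDen_rpow (hα : Irrational α) {s : ℝ} (hs : 0 < s) :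
    Tendsto (fun n : ℕ => (n : ℝ) * (convDen α n : ℝ) ^ (-s)) atTop (𝓝 0) := by
  have h1 : ((3 / 4 : ℝ) ^ s) < 1 := Real.rpow_lt_one (by norm_num) (by norm_num) hs
  have h2 := (tendsto_self_mul_const_pow_of_lt_one (by positivity) h1).mul_const ((2 : ℝ) ^ s)
  rw [zero_mul] at h2
  refine squeeze_zero (fun n => by positivity) (fun n => ?_) h2
  rw [mul_assoc]
  gcongr
  have hq : (0 : ℝ) < convDen α n := by exact_mod_cast convDen_pos α n
  have h3 : (1 : ℝ) ≤ convDen α 0 := by exact_mod_cast convDen_pos α 0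
  have h4 := h3.trans (convDen_le_geom_mul hα 0 n)
  rw [zero_add, ← div_le_iff₀ hq, one_div] at h4
  calc (convDen α n : ℝ) ^ (-s) = ((convDen α n : ℝ)⁻¹) ^ s := by
        rw [Real.rpow_neg hq.le, Real.inv_rpow hq.le]
    _ ≤ (2 * (3 / 4 : ℝ) ^ n) ^ s := by gcongr
    _ = ((3 / 4 : ℝ) ^ s) ^ n * 2 ^ s := by
      rw [Real.mul_rpow (by norm_num) (by positivity), mul_comm, ← Real.rpow_natCast,
        ← Real.rpow_natCast, ← Real.rpow_mul (by norm_num), ← Real.rpow_mul (by norm_num),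
        mul_comm (n : ℝ)]

/-- Liouville numbers have arbitrarily large gaps between consecutive denominators. -/
theorem frequently_pow_convDen_le (hα : Liouville α) :
    ∃ᶠ n : ℕ in atTop, convDen α n ^ 20 ≤ convDen α (n + 1) := by
  rw [frequently_atTop]
  intro N₀
  obtain ⟨m, hm⟩ := pow_unbounded_of_one_lt (convDen α N₀) (one_lt_two (α := ℕ))
  -- In the exponent m + 22, one power of b is lost in passing from |α − r| to |q_nα − p_n| and one
  -- absorbs the factor 2. What remains gives q_{n+1} ≥ b^{m+20}: the 20 produces the gap, and 2^m >
  -- q_{N₀} forces n ≥ N₀.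
  obtain ⟨a, b, hb, hne, hlt⟩ := hα (m + 22)
  have hirr := hα.irrational
  lift b to ℕ using by omega
  have hb2 : 2 ≤ b := by exact_mod_cast hb
  have hb0 : (0 : ℝ) < b := by exact_mod_cast (by omega : 0 < b)
  set r : ℚ := (a : ℚ) / (b : ℚ) with hr
  have hrR : ((r : ℚ) : ℝ) = a / b := by rw [hr]; push_cast; rfl
  have hdb : r.den ≤ b := by
    refine Nat.le_of_dvd (by omega) ?_
    have := Rat.den_dvd a b
    have h2 : r = Rat.divInt a b := by rw [Rat.divInt_eq_div, hr, Int.cast_natCast]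
    rw [← h2] at this
    exact_mod_cast this
  have hd0 : (0 : ℝ) < r.den := by exact_mod_cast r.den_pos
  have hdb' : (r.den : ℝ) ≤ b := by exact_mod_cast hdb
  simp only [Int.cast_natCast] at hlt
  rw [← hrR] at hlt
  have hb2' : (2 : ℝ) ≤ b := by exact_mod_cast hb2
  obtain ⟨n, hn⟩ : ∃ n, r = Real.convergent α n := by
    refine Real.exists_rat_eq_convergent (hlt.trans_le ?_)
    refine one_div_le_one_div_of_le (by positivity) ?_
    calc 2 * (r.den : ℝ) ^ 2 ≤ b * b ^ 2 := by gcongr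
      _ = (b : ℝ) ^ 3 := by ring
      _ ≤ (b : ℝ) ^ (m + 22) := pow_le_pow_right₀ (by linarith) (by omega)
  have hqn : convDen α n = r.den := by rw [convDen, ← hn]
  have hQ0 : (0 : ℝ) < convDen α (n + 1) := by exact_mod_cast convDen_pos α (n + 1)
  have h1 := le_abs_convDen_mul_sub hirr n
  rw [hqn, ← hn] at h1
  have h2 : |(r.den : ℝ) * α - r.num| = r.den * |α - r| := by
    rw [← abs_of_pos hd0, ← abs_mul, abs_of_pos hd0, mul_sub]
    congr 2
    exact_mod_cast (Rat.den_mul_eq_num r).symm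
  rw [h2] at h1
  have h3 : 1 / (2 * (convDen α (n + 1) : ℝ)) ≤ b * (1 / (b : ℝ) ^ (m + 22)) :=
    h1.trans (by gcongr)
  have h4 : (b : ℝ) ^ (m + 20) ≤ convDen α (n + 1) := by
    rw [mul_one_div, div_le_div_iff₀ (by positivity) (by positivity), one_mul] at h3
    have h5 : (b : ℝ) ^ (m + 22) = b ^ (m + 20) * b * b := by ring
    rw [h5] at h3
    have h6 : (b : ℝ) ^ (m + 20) * b ≤ 2 * convDen α (n + 1) := by
      refine le_of_mul_le_mul_right ?_ hb0
      linarith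
    have h7 : (0 : ℝ) < b ^ (m + 20) := by positivity
    nlinarith
  have h5 : b ^ (m + 20) ≤ convDen α (n + 1) := by exact_mod_cast h4
  refine ⟨n, ?_, ?_⟩
  · by_contra hlt'
    have h6 : convDen α (n + 1) ≤ convDen α N₀ := convDen_monotone hirr (by omega)
    have h7 : 2 ^ m ≤ b ^ (m + 20) :=
      (Nat.pow_le_pow_left hb2 m).trans (Nat.pow_le_pow_right (by omega) (by omega))
    omega
  · rw [hqn]
    exact (Nat.pow_le_pow_left hdb 20).trans ((Nat.pow_le_pow_right (by omega) (by omega)).trans h5)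

end Denominators

/-! ### Ergodic sums of cosines at the frequencies q_k. -/

section CosineSums

variable {α : ℝ}

lemma norm_e_sub_one_eq (t : ℝ) : ‖e t - 1‖ = 2 * |Real.sin (Real.pi * t)| := by
  have h : e t = Complex.exp (Complex.I * ((2 * Real.pi * t : ℝ) : ℂ)) := by
    rw [e]; congr 1; push_cast; ring
  rw [h, Complex.norm_exp_I_mul_ofReal_sub_one, Real.norm_eq_abs, abs_mul, abs_two]
  congr 3
  ring

lemma norm_e_sub_one_le (t : ℝ) : ‖e t - 1‖ ≤ 2 * Real.pi * |t| := by
  rw [norm_e_sub_one_eq]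
  have h : |Real.sin (Real.pi * t)| ≤ |Real.pi * t| := Real.abs_sin_le_abs
  rw [abs_mul, abs_of_pos Real.pi_pos] at h
  linarith

lemma le_norm_e_sub_one {t : ℝ} (ht : |t| ≤ 1 / 2) : 4 * |t| ≤ ‖e t - 1‖ := by
  rw [norm_e_sub_one_eq]
  have h1 : |Real.sin (Real.pi * t)| = |Real.sin (Real.pi * |t|)| := by
    rcases abs_choice t with h | h <;> rw [h]
    rw [mul_neg, Real.sin_neg, abs_neg]
  have h2 := Real.mul_le_sin (x := Real.pi * |t|) (by positivity) (by
    have := Real.pi_pos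
    nlinarith)
  have h3 : 2 / Real.pi * (Real.pi * |t|) = 2 * |t| := by field_simp
  rw [h3] at h2
  rw [h1]
  linarith [le_abs_self (Real.sin (Real.pi * |t|))]

/-- `x ↦ cos (2 π k x)` on the circle. -/
noncomputable def circleCos (k : ℕ) (x : UnitAddCircle) : ℝ := (fourier (k : ℤ) x : ℂ).re

lemma circleCos_coe (k : ℕ) (x : ℝ) :
    circleCos k (x : UnitAddCircle) = Real.cos (2 * Real.pi * k * x) := by
  rw [circleCos, fourier_coe_apply]
  have h : 2 * (Real.pi : ℂ) * Complex.I * ((k : ℤ) : ℂ) * (x : ℂ) / ((1 : ℝ) : ℂ) =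
      ((2 * Real.pi * k * x : ℝ) : ℂ) * Complex.I := by push_cast; ring
  rw [h, Complex.exp_ofReal_mul_I_re]

lemma continuous_circleCos (k : ℕ) : Continuous (circleCos k) :=
  Complex.continuous_re.comp (fourier (k : ℤ)).continuous

lemma abs_circleCos_le (k : ℕ) (x : UnitAddCircle) : |circleCos k x| ≤ 1 := by
  refine (Complex.abs_re_le_norm _).trans ?_
  rw [fourier_apply, Circle.norm_coe]

lemma abs_ergodicSum_circleCos_le (N k : ℕ) (x : UnitAddCircle) :
    |ergodicSum α (circleCos k) N x| ≤ N :=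
  (Finset.abs_sum_le_sum_abs _ _).trans
    ((Finset.sum_le_sum fun _ _ => abs_circleCos_le k _).trans (by simp))

lemma fourier_add_nsmul (n : ℤ) (x y : UnitAddCircle) (i : ℕ) :
    (fourier n (x + i • y) : ℂ) = fourier n x * fourier n y ^ i := by
  induction i with
  | zero => simp
  | succ i ih => rw [succ_nsmul, ← add_assoc, fourier_add_apply, ih, pow_succ, mul_assoc]

lemma fourier_coe_eq_e (k : ℕ) (t : ℝ) : (fourier (k : ℤ) (t : UnitAddCircle) : ℂ) = e (k * t) := by
  rw [fourier_coe_apply, e]; congr 1; push_cast; ring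

lemma e_add_int (t : ℝ) (n : ℤ) : e (t + n) = e t := by rw [e_add, e_int, mul_one]

lemma e_pow (t : ℝ) (n : ℕ) : e t ^ n = e (n * t) := by
  rw [e, e, ← Complex.exp_nat_mul]; congr 1; push_cast; ring

lemma fourier_convDen_eq (n : ℕ) : (fourier (convDen α n : ℤ) (α : UnitAddCircle) : ℂ) =
    e (convDen α n * α - (Real.convergent α n).num) := by
  rw [fourier_coe_eq_e, ← e_add_int (_ - _) (Real.convergent α n).num, sub_add_cancel]

/-- A geometric sum of ratio w = e(q_kα). Here |w − 1| ≥ 2/q_{k+1}, while |w^{q_n} − 1| ≤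
2πq_k/q_{n+1} because q_nα is within 1/q_{n+1} of an integer. The condition k ≥ 1 gives q_{k+1} ≥ 2,
as needed to bound the chord from below. The estimate is useful for k < n. -/
lemma abs_ergodicSum_circleCos_convDen_le (hα : Irrational α) (n : ℕ) {k : ℕ} (hk : 1 ≤ k)
    (x : UnitAddCircle) :
    |ergodicSum α (circleCos (convDen α k)) (convDen α n) x| ≤
      4 * convDen α k * convDen α (k + 1) / convDen α (n + 1) := by
  set w : ℂ := fourier (convDen α k : ℤ) (α : UnitAddCircle) with hw
  have hQk : (0 : ℝ) < convDen α (k + 1) := by exact_mod_cast convDen_pos α (k + 1)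
  have hQn : (0 : ℝ) < convDen α (n + 1) := by exact_mod_cast convDen_pos α (n + 1)
  have hqk : (0 : ℝ) < convDen α k := by exact_mod_cast convDen_pos α k
  have hden : 2 / (convDen α (k + 1) : ℝ) ≤ ‖w - 1‖ := by
    rw [hw, fourier_convDen_eq]
    have h2 : (2 : ℝ) ≤ convDen α (k + 1) := by
      obtain ⟨j, rfl⟩ := Nat.exists_eq_add_of_le' hk
      have h1 := convDen_add_le hα j
      have h2 := convDen_pos α j
      have h3 := convDen_pos α (j + 1)
      exact_mod_cast (by omega : 2 ≤ convDen α (j + 2))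
    refine le_trans ?_ (le_norm_e_sub_one ((abs_convDen_mul_sub_le hα k).trans
      (one_div_le_one_div_of_le two_pos h2)))
    have := le_abs_convDen_mul_sub hα k
    calc 2 / (convDen α (k + 1) : ℝ) = 4 * (1 / (2 * convDen α (k + 1))) := by field_simp; norm_num
      _ ≤ _ := by gcongr
  have hw1 : w ≠ 1 := by
    intro h
    rw [h, sub_self, norm_zero] at hden
    exact absurd hden (not_le.2 (by positivity))
  have hnum : ‖w ^ convDen α n - 1‖ ≤ 2 * Real.pi * (convDen α k * (1 / convDen α (n + 1))) := by
    have h1 : w ^ convDen α n = e (convDen α k * (convDen α n * α - (Real.convergent α n).num)) := by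
      rw [hw, fourier_coe_eq_e, e_pow, ← e_add_int (convDen α k * (_ - _))
        (convDen α k * (Real.convergent α n).num)]
      congr 1
      push_cast
      ring
    rw [h1]
    refine (norm_e_sub_one_le _).trans ?_
    rw [abs_mul, abs_of_pos hqk]
    gcongr
    exact abs_convDen_mul_sub_le hα n
  have hsum : ergodicSum α (circleCos (convDen α k)) (convDen α n) x =
      (fourier (convDen α k : ℤ) x * ∑ i ∈ Finset.range (convDen α n), w ^ i : ℂ).re := by
    rw [ergodicSum, Finset.mul_sum, Complex.re_sum]
    exact Finset.sum_congr rfl fun i _ => by rw [circleCos, fourier_add_nsmul]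
  rw [hsum]
  refine (Complex.abs_re_le_norm _).trans ?_
  rw [norm_mul, fourier_apply, Circle.norm_coe, one_mul, geom_sum_eq hw1, norm_div]
  have hpi : Real.pi ≤ 4 := Real.pi_le_four
  calc _ ≤ 2 * Real.pi * (convDen α k * (1 / convDen α (n + 1))) / (2 / (convDen α (k + 1) : ℝ)) := by
        gcongr
    _ = Real.pi * (convDen α k * convDen α (k + 1) / convDen α (n + 1)) := by field_simp
    _ ≤ 4 * (convDen α k * convDen α (k + 1) / convDen α (n + 1)) := by gcongr
    _ = _ := by ring

end CosineSums

end SpecialFlow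


namespace SpecialFlow

/-! ### The roof series and its rigidity. -/

section RoofSeries

variable {α : ℝ}

/-- The coefficients `q_k⁻¹ q_{k+1}^{-9/10}`. -/
noncomputable def roofCoeff (α : ℝ) (k : ℕ) : ℝ :=
  (convDen α k : ℝ)⁻¹ * (convDen α (k + 1) : ℝ) ^ (-(9 / 10) : ℝ)

lemma roofCoeff_pos (α : ℝ) (k : ℕ) : 0 < roofCoeff α k := by
  have h1 : (0 : ℝ) < convDen α k := by exact_mod_cast convDen_pos α k
  have h2 : (0 : ℝ) < convDen α (k + 1) := by exact_mod_cast convDen_pos α (k + 1)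
  unfold roofCoeff
  positivity

lemma roofCoeff_le (hα : Irrational α) (k : ℕ) : roofCoeff α k ≤ 2 * (3 / 4 : ℝ) ^ k := by
  have hq : (0 : ℝ) < convDen α k := by exact_mod_cast convDen_pos α k
  have h1 : (1 : ℝ) ≤ convDen α 0 := by exact_mod_cast convDen_pos α 0
  have h2 := h1.trans (convDen_le_geom_mul hα 0 k)
  rw [zero_add, ← div_le_iff₀ hq, one_div] at h2
  refine le_trans (mul_le_of_le_one_right (by positivity) ?_) h2
  exact Real.rpow_le_one_of_one_le_of_nonpos (by exact_mod_cast convDen_pos α (k + 1)) (by norm_num)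

/-- The series `∑ a_k cos (2 π q_k x)`. -/
noncomputable def roofSeries (α : ℝ) (x : UnitAddCircle) : ℝ :=
  ∑' k : ℕ, roofCoeff α (k + 1) * circleCos (convDen α (k + 1)) x

lemma norm_roofTerm_le (hα : Irrational α) (k : ℕ) (x : UnitAddCircle) :
    ‖roofCoeff α (k + 1) * circleCos (convDen α (k + 1)) x‖ ≤ 2 * (3 / 4 : ℝ) ^ k := by
  rw [norm_mul, Real.norm_of_nonneg (roofCoeff_pos α _).le]
  refine (mul_le_of_le_one_right (roofCoeff_pos α _).le (abs_circleCos_le _ x)).trans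
    ((roofCoeff_le hα _).trans ?_)
  rw [pow_succ]
  have : (0 : ℝ) < (3 / 4) ^ k := by positivity
  linarith

lemma hasSum_geom_three_quarters : HasSum (fun k : ℕ => 2 * (3 / 4 : ℝ) ^ k) 8 := by
  have := (hasSum_geometric_of_lt_one (r := (3 / 4 : ℝ)) (by norm_num) (by norm_num)).mul_left 2
  norm_num at this
  exact this

lemma continuous_roofSeries (hα : Irrational α) : Continuous (roofSeries α) :=
  continuous_tsum (fun _ => (continuous_circleCos _).const_mul _)
    hasSum_geom_three_quarters.summable (norm_roofTerm_le hα)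

lemma hasSum_roofSeries (hα : Irrational α) (x : UnitAddCircle) :
    HasSum (fun k : ℕ => roofCoeff α (k + 1) * circleCos (convDen α (k + 1)) x) (roofSeries α x) :=
  (hasSum_geom_three_quarters.summable.of_norm_bounded fun k => norm_roofTerm_le hα k x).hasSum

lemma hasSum_ergodicSum_roofSeries (hα : Irrational α) (N : ℕ) (x : UnitAddCircle) :
    HasSum (fun k : ℕ => roofCoeff α (k + 1) * ergodicSum α (circleCos (convDen α (k + 1))) N x)
      (ergodicSum α (roofSeries α) N x) := by
  simp only [ergodicSum, Finset.mul_sum]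
  exact hasSum_sum fun i _ => hasSum_roofSeries hα _

/-- A bound for the ergodic sum at time `q_n` of the roof series without its `n`-th term. -/
noncomputable def roofError (α : ℝ) (n : ℕ) : ℝ :=
  4 * n * (convDen α n : ℝ) ^ (1 / 10 : ℝ) / convDen α (n + 1) +
    8 * (convDen α n / convDen α (n + 1)) * (convDen α (n + 1) : ℝ) ^ (-(9 / 10) : ℝ)

/-- The n-th term is resonant and is kept apart. Below n the geometric-sum bound gives
4q_{k+1}^{1/10}/q_{n+1} per term; above n the trivial bound q_n a_k decays geometrically. Both parts
gain over the n-th term enough to survive multiplication by q_{n+1}^{9/10} when the gap is large. -/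
lemma abs_ergodicSum_roofSeries_sub_le (hα : Irrational α) {n : ℕ} (hn : 1 ≤ n)
    (x : UnitAddCircle) :
    |ergodicSum α (roofSeries α) (convDen α n) x -
      roofCoeff α n * ergodicSum α (circleCos (convDen α n)) (convDen α n) x| ≤ roofError α n := by
  obtain ⟨ν, rfl⟩ := Nat.exists_eq_add_of_le' hn
  set q := convDen α (ν + 1) with hq
  have hq0 : (0 : ℝ) < q := by exact_mod_cast convDen_pos α (ν + 1)
  have hpos : ∀ k, (0 : ℝ) < convDen α k := fun k => by exact_mod_cast convDen_pos α k
  have hmono : ∀ {i j}, i ≤ j → (convDen α i : ℝ) ≤ convDen α j := fun h => by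
    exact_mod_cast convDen_monotone hα h
  -- The index k carries the frequency q_{k+1}, so the resonant term n = ν + 1 is `b ν`.
  set b : ℕ → ℝ := fun k => roofCoeff α (k + 1) *
    ergodicSum α (circleCos (convDen α (k + 1))) q x with hb
  have hs : HasSum b _ := hasSum_ergodicSum_roofSeries hα q x
  have hsplit := hs.summable.sum_add_tsum_nat_add (ν + 1)
  rw [hs.tsum_eq, Finset.sum_range_succ] at hsplit
  have hhead : |∑ k ∈ Finset.range ν, b k| ≤ 4 * ((ν + 1 : ℕ) : ℝ) * (q : ℝ) ^ (1 / 10 : ℝ) /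
      convDen α (ν + 1 + 1) := by
    refine (Finset.abs_sum_le_sum_abs _ _).trans ((Finset.sum_le_sum
      (g := fun _ => 4 * (q : ℝ) ^ (1 / 10 : ℝ) / convDen α (ν + 1 + 1)) fun k hk => ?_).trans ?_)
    · have hkν : k + 1 + 1 ≤ ν + 1 := by have := Finset.mem_range.1 hk; omega
      rw [hb, abs_mul, abs_of_pos (roofCoeff_pos α _)]
      calc roofCoeff α (k + 1) * |ergodicSum α (circleCos (convDen α (k + 1))) q x|
          ≤ roofCoeff α (k + 1) * (4 * convDen α (k + 1) * convDen α (k + 1 + 1) /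
            convDen α (ν + 1 + 1)) := by
            gcongr
            · exact (roofCoeff_pos α _).le
            · exact abs_ergodicSum_circleCos_convDen_le hα _ (by omega) x
        _ = 4 * ((convDen α (k + 1 + 1) : ℝ) ^ (-(9 / 10) : ℝ) *
            (convDen α (k + 1 + 1) : ℝ) ^ (1 : ℝ)) / convDen α (ν + 1 + 1) := by
            have := (hpos (k + 1)).ne'
            rw [roofCoeff, Real.rpow_one]
            field_simp
        _ = 4 * (convDen α (k + 1 + 1) : ℝ) ^ (1 / 10 : ℝ) / convDen α (ν + 1 + 1) := by
            rw [← Real.rpow_add (hpos _)]; norm_num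
        _ ≤ _ := by
            gcongr
            exact convDen_monotone hα hkν
    · rw [Finset.sum_const, Finset.card_range, nsmul_eq_mul]
      calc (ν : ℝ) * (4 * (q : ℝ) ^ (1 / 10 : ℝ) / convDen α (ν + 1 + 1))
          ≤ ((ν + 1 : ℕ) : ℝ) * (4 * (q : ℝ) ^ (1 / 10 : ℝ) / convDen α (ν + 1 + 1)) := by
            gcongr; omega
        _ = _ := by ring
  have htail : |∑' j, b (j + (ν + 1))| ≤ 8 * (q / convDen α (ν + 1 + 1)) *
      (convDen α (ν + 1 + 1) : ℝ) ^ (-(9 / 10) : ℝ) := by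
    have hg := hasSum_geom_three_quarters.mul_right
      ((q / convDen α (ν + 1 + 1) : ℝ) * (convDen α (ν + 1 + 1) : ℝ) ^ (-(9 / 10) : ℝ))
    rw [← mul_assoc] at hg
    rw [← Real.norm_eq_abs]
    refine tsum_of_norm_bounded hg fun j => ?_
    rw [hb, norm_mul, Real.norm_of_nonneg (roofCoeff_pos α _).le]
    have hjq : (convDen α (ν + 1 + 1) : ℝ) ≤ 2 * (3 / 4 : ℝ) ^ j * convDen α (j + (ν + 1) + 1) := by
      have := convDen_le_geom_mul hα (ν + 1 + 1) j
      rwa [show ν + 1 + 1 + j = j + (ν + 1) + 1 by ring] at this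
    calc roofCoeff α (j + (ν + 1) + 1) *
          ‖ergodicSum α (circleCos (convDen α (j + (ν + 1) + 1))) q x‖
        ≤ roofCoeff α (j + (ν + 1) + 1) * q := by
          gcongr
          · exact (roofCoeff_pos α _).le
          · exact abs_ergodicSum_circleCos_le _ _ x
      _ = q * (convDen α (j + (ν + 1) + 1) : ℝ)⁻¹ *
          (convDen α (j + (ν + 1) + 1 + 1) : ℝ) ^ (-(9 / 10) : ℝ) := by rw [roofCoeff]; ring
      _ ≤ q * (2 * (3 / 4 : ℝ) ^ j * (convDen α (ν + 1 + 1) : ℝ)⁻¹) *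
          (convDen α (ν + 1 + 1) : ℝ) ^ (-(9 / 10) : ℝ) := by
          refine mul_le_mul (mul_le_mul_of_nonneg_left ?_ hq0.le) ?_ (by positivity) (by positivity)
          · rw [← div_eq_mul_inv, le_div_iff₀ (hpos _), inv_mul_le_iff₀ (hpos _), mul_comm]
            exact hjq
          · exact Real.rpow_le_rpow_of_nonpos (hpos _) (hmono (by omega)) (by norm_num)
      _ = _ := by ring
  have hfinal : ergodicSum α (roofSeries α) q x - b ν =
      ∑ k ∈ Finset.range ν, b k + ∑' j, b (j + (ν + 1)) := by rw [← hsplit]; ring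
  change |ergodicSum α (roofSeries α) q x - b ν| ≤ _
  rw [hfinal]
  exact (abs_add_le _ _).trans (add_le_add hhead htail)

lemma abs_ergodicSum_roofSeries_le (hα : Irrational α) {n : ℕ} (hn : 1 ≤ n) (x : UnitAddCircle) :
    |ergodicSum α (roofSeries α) (convDen α n) x| ≤
      13 * (((n + 1 : ℕ) : ℝ) * (convDen α (n + 1) : ℝ) ^ (-(1 / 10) : ℝ)) *
        (convDen α (n + 1) : ℝ) ^ (-(4 / 5) : ℝ) := by
  have hq : (0 : ℝ) < convDen α n := by exact_mod_cast convDen_pos α n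
  have hQ : (0 : ℝ) < convDen α (n + 1) := by exact_mod_cast convDen_pos α (n + 1)
  have hqQ : (convDen α n : ℝ) ≤ convDen α (n + 1) := by exact_mod_cast convDen_le_succ hα n
  set P := (convDen α (n + 1) : ℝ) ^ (-(9 / 10) : ℝ) with hP
  have hP0 : 0 < P := by positivity
  have h1 : |roofCoeff α n * ergodicSum α (circleCos (convDen α n)) (convDen α n) x| ≤ P := by
    rw [abs_mul, abs_of_pos (roofCoeff_pos α n)]
    calc _ ≤ roofCoeff α n * convDen α n := by
          gcongr
          · exact (roofCoeff_pos α _).le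
          · exact abs_ergodicSum_circleCos_le _ _ x
      _ = P := by rw [roofCoeff, ← hP]; field_simp
  have h2 : roofError α n ≤ 4 * n * P + 8 * P := by
    refine add_le_add ?_ ?_
    · calc 4 * n * (convDen α n : ℝ) ^ (1 / 10 : ℝ) / convDen α (n + 1)
          ≤ 4 * n * (convDen α (n + 1) : ℝ) ^ (1 / 10 : ℝ) / convDen α (n + 1) := by gcongr
        _ = 4 * n * ((convDen α (n + 1) : ℝ) ^ (1 / 10 : ℝ) *
            (convDen α (n + 1) : ℝ) ^ (-1 : ℝ)) := by rw [Real.rpow_neg_one]; ring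
        _ = _ := by rw [← Real.rpow_add hQ]; norm_num [hP]
    · calc 8 * ((convDen α n : ℝ) / convDen α (n + 1)) * P ≤ 8 * 1 * P := by
            gcongr
            exact (div_le_one hQ).2 hqQ
        _ = _ := by ring
  have h3 : (convDen α (n + 1) : ℝ) ^ (-(1 / 10) : ℝ) * (convDen α (n + 1) : ℝ) ^ (-(4 / 5) : ℝ) =
      P := by rw [← Real.rpow_add hQ]; norm_num [hP]
  have h4 := abs_ergodicSum_roofSeries_sub_le hα hn x
  have h5 := abs_sub_abs_le_abs_sub (ergodicSum α (roofSeries α) (convDen α n) x)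
    (roofCoeff α n * ergodicSum α (circleCos (convDen α n)) (convDen α n) x)
  calc _ ≤ (4 * n + 9) * P := by linarith
    _ ≤ 13 * ((n + 1 : ℕ) : ℝ) * P := by
      gcongr
      push_cast
      linarith [(Nat.cast_nonneg n : (0 : ℝ) ≤ n)]
    _ = _ := by rw [← h3]; ring

lemma isLittleO_iSup_ergodicSum_roofSeries (hα : Irrational α) :
    (fun n : ℕ => ⨆ x : UnitAddCircle, |ergodicSum α (roofSeries α) (convDen α n) x|)
      =o[atTop] fun n : ℕ => (convDen α (n + 1) : ℝ) ^ (-(4 / 5) : ℝ) := by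
  refine IsLittleO.of_bound fun c hc => ?_
  have h1 := ((tendsto_mul_convDen_rpow hα (by norm_num : (0 : ℝ) < 1 / 10)).comp
    (tendsto_add_atTop_nat 1)).const_mul 13
  rw [mul_zero] at h1
  filter_upwards [h1.eventually_le_const hc, eventually_ge_atTop 1] with n hn hn1
  rw [Real.norm_of_nonneg (Real.iSup_nonneg fun _ => abs_nonneg _),
    Real.norm_of_nonneg (by positivity)]
  refine ciSup_le fun x => (abs_ergodicSum_roofSeries_le hα hn1 x).trans ?_
  gcongr
  exact hn

lemma isLittleO_roofCoeff (hα : Irrational α) : roofCoeff α =o[atTop] fun n : ℕ =>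
    1 / ((convDen α n : ℝ) * (convDen α (n + 1) : ℝ) ^ (4 / 5 : ℝ)) := by
  refine IsLittleO.of_bound fun c hc => ?_
  have h1 : Tendsto (fun n : ℕ => (convDen α (n + 1) : ℝ) ^ (-(1 / 10) : ℝ)) atTop (𝓝 0) :=
    (tendsto_rpow_neg_atTop (by norm_num : (0 : ℝ) < 1 / 10)).comp
      (tendsto_natCast_atTop_atTop.comp ((tendsto_convDen hα).comp (tendsto_add_atTop_nat 1)))
  filter_upwards [h1.eventually_le_const hc] with n hn
  have hq : (0 : ℝ) < convDen α n := by exact_mod_cast convDen_pos α n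
  have hQ : (0 : ℝ) < convDen α (n + 1) := by exact_mod_cast convDen_pos α (n + 1)
  rw [Real.norm_of_nonneg (roofCoeff_pos α n).le, Real.norm_of_nonneg (by positivity), roofCoeff]
  have h2 : (convDen α (n + 1) : ℝ) ^ (-(9 / 10) : ℝ) = (convDen α (n + 1) : ℝ) ^ (-(1 / 10) : ℝ) *
      ((convDen α (n + 1) : ℝ) ^ (4 / 5 : ℝ))⁻¹ := by
    rw [← Real.rpow_neg hQ.le, ← Real.rpow_add hQ]; norm_num
  rw [h2]
  calc _ = (convDen α (n + 1) : ℝ) ^ (-(1 / 10) : ℝ) *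
      (1 / ((convDen α n : ℝ) * (convDen α (n + 1) : ℝ) ^ (4 / 5 : ℝ))) := by
        field_simp
    _ ≤ _ := by gcongr

/-- The inequality amounts to q_n^{1/5} ≤ q_{n+1}^{1/10}, so a gap q_n² ≤ q_{n+1} would suffice. -/
lemma le_roofCoeff {n : ℕ} (h : convDen α n ^ 20 ≤ convDen α (n + 1)) :
    1 / ((convDen α n : ℝ) ^ (4 / 5 : ℝ) * (convDen α (n + 1) : ℝ)) ≤ roofCoeff α n := by
  have hq : (0 : ℝ) < convDen α n := by exact_mod_cast convDen_pos α n
  have hQ : (0 : ℝ) < convDen α (n + 1) := by exact_mod_cast convDen_pos α (n + 1)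
  have h1 : (convDen α n : ℝ) ^ (1 / 5 : ℝ) ≤ (convDen α (n + 1) : ℝ) ^ (1 / 10 : ℝ) := by
    have h2 : (convDen α n : ℝ) ^ (2 : ℝ) ≤ convDen α (n + 1) := by
      rw [Real.rpow_two]
      exact_mod_cast (Nat.pow_le_pow_right (convDen_pos α n) (by norm_num)).trans h
    calc (convDen α n : ℝ) ^ (1 / 5 : ℝ) = ((convDen α n : ℝ) ^ (2 : ℝ)) ^ (1 / 10 : ℝ) := by
          rw [← Real.rpow_mul hq.le]; norm_num
      _ ≤ _ := by gcongr
  have h3 : (convDen α n : ℝ)⁻¹ * (convDen α n : ℝ) ^ (1 / 5 : ℝ) =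
      ((convDen α n : ℝ) ^ (4 / 5 : ℝ))⁻¹ := by
    rw [← Real.rpow_neg_one, ← Real.rpow_add hq, ← Real.rpow_neg hq.le]; norm_num
  have h4 : (convDen α (n + 1) : ℝ)⁻¹ * (convDen α (n + 1) : ℝ) ^ (1 / 10 : ℝ) =
      (convDen α (n + 1) : ℝ) ^ (-(9 / 10) : ℝ) := by
    rw [← Real.rpow_neg_one, ← Real.rpow_add hQ]; norm_num
  rw [one_div, mul_inv, ← h3, roofCoeff, ← h4, mul_assoc, mul_comm ((convDen α n : ℝ) ^ _)]
  gcongr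

end RoofSeries

end SpecialFlow


namespace SpecialFlow

/-! ### An integral obstruction to the cohomological equation. -/

section CohomologicalEquation

variable {α : ℝ}

lemma norm_e_sub_e_le (s t : ℝ) : ‖e s - e t‖ ≤ 2 * Real.pi * |s - t| := by
  have h : e s - e t = e t * (e (s - t) - 1) := by
    rw [mul_sub, ← e_add, add_sub_cancel, mul_one]
  rw [h, norm_mul, norm_e, one_mul]
  exact norm_e_sub_one_le _

lemma measurePreserving_add_nsmul (N : ℕ) : MeasurePreserving
    (fun x : UnitAddCircle => x + N • (α : UnitAddCircle)) volume volume :=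
  measurePreserving_add_right _ _

lemma ae_ergodicSum_eq_of_cohomologous {G ψ : UnitAddCircle → ℝ} {r β : ℝ}
    (h : ∀ᵐ x : UnitAddCircle, ((r * G x : ℝ) : UnitAddCircle) =
      ((ψ (x + (α : UnitAddCircle)) - ψ x + β : ℝ) : UnitAddCircle)) (N : ℕ) :
    ∀ᵐ x : UnitAddCircle, e (r * ergodicSum α G N x) * e (ψ x) =
      e (N * β) * e (ψ (x + N • (α : UnitAddCircle))) := by
  induction N with
  | zero => simp [ergodicSum, e_zero]
  | succ N ih =>
    filter_upwards [ih, (measurePreserving_add_nsmul (α := α) N).quasiMeasurePreserving.ae h]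
      with x hx hx'
    rw [← e_eq_e_iff, e_add, sub_eq_add_neg, e_add, e_neg] at hx'
    rw [ergodicSum_succ, mul_add, e_add, hx', succ_nsmul, ← add_assoc]
    have h1 : e ((N + 1 : ℕ) * β) = e (N * β) * e β := by rw [← e_add]; congr 1; push_cast; ring
    have h2 := e_ne_zero (ψ (x + N • (α : UnitAddCircle)))
    rw [h1]
    field_simp
    linear_combination (e (ψ (x + N • (α : UnitAddCircle) + α)) * e β) * hx

/-- If `G` is cohomologous to a constant modulo `1`, then the exponentials of its ergodic sums
along rigidity times have integrals of absolute value tending to `1`. -/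
theorem tendsto_norm_integral_of_cohomologous {G ψ : UnitAddCircle → ℝ} {r β : ℝ}
    (hψ : Measurable ψ) (h : ∀ᵐ x : UnitAddCircle, ((r * G x : ℝ) : UnitAddCircle) =
      ((ψ (x + (α : UnitAddCircle)) - ψ x + β : ℝ) : UnitAddCircle)) {l : Filter ℕ} {N : ℕ → ℕ}
    (hN : Tendsto (fun n => N n • (α : UnitAddCircle)) l (𝓝 0)) :
    Tendsto (fun n => ‖∫ x : UnitAddCircle, e (r * ergodicSum α G (N n) x)‖) l (𝓝 1) := by
  have hm : Measurable fun x => e (ψ x) := continuous_e.measurable.comp hψ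
  have hmem : MemLp (fun x => e (ψ x)) 2 (volume : Measure UnitAddCircle) :=
    MemLp.of_bound hm.aestronglyMeasurable 1 (.of_forall fun x => (norm_e _).le)
  set Φ : Lp ℂ 2 (volume : Measure UnitAddCircle) := hmem.toLp _ with hΦ
  set τ : UnitAddCircle → C(UnitAddCircle, UnitAddCircle) := fun t => ⟨fun x => x + t, by fun_prop⟩
    with hτ
  have hτmp : ∀ t, MeasurePreserving (τ t) volume volume := fun t => measurePreserving_add_right _ t
  have hτc : Continuous τ := by
    refine ContinuousMap.continuous_of_continuous_uncurry _ ?_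
    exact (by fun_prop : Continuous fun p : UnitAddCircle × UnitAddCircle => p.2 + p.1)
  -- With Φ = e(ψ), the integral of e(r S_N G) is, up to a unimodular factor, the inner product of Φ
  -- with its translate by Nα. Translation is continuous in L², so this tends to ‖Φ‖² = 1.
  have hlim : Tendsto (fun n => Lp.compMeasurePreserving (τ (N n • (α : UnitAddCircle)))
      (hτmp _) Φ) l (𝓝 (Lp.compMeasurePreserving (τ 0) (hτmp 0) Φ)) :=
    (tendsto_const_nhds (x := Φ)).compMeasurePreservingLp ((hτc.tendsto 0).comp hN)
      (fun _ => hτmp _) (hτmp 0) (by norm_num)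
  have hinner : ∀ t, (inner ℂ Φ (Lp.compMeasurePreserving (τ t) (hτmp t) Φ) : ℂ) =
      ∫ x, e (ψ (x + t)) * (e (ψ x))⁻¹ := fun t => by
    rw [L2.inner_def]
    refine integral_congr_ae ?_
    filter_upwards [hmem.coeFn_toLp, Lp.coeFn_compMeasurePreserving Φ (hτmp t),
      (hτmp t).quasiMeasurePreserving.ae hmem.coeFn_toLp] with x h1 h2 h3
    rw [h2, Function.comp_apply, hΦ, h1, h3, RCLike.inner_apply, Complex.inv_def,
      Complex.normSq_eq_norm_sq, norm_e]
    simp [hτ]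
  have hlim2 := (tendsto_const_nhds (x := Φ)).inner (𝕜 := ℂ) hlim
  simp only [hinner] at hlim2
  have h1 : ∫ x, e (ψ (x + 0)) * (e (ψ x))⁻¹ = (1 : ℂ) := by
    simp only [add_zero, mul_inv_cancel₀ (e_ne_zero _), integral_const, probReal_univ, one_smul]
  rw [h1] at hlim2
  have hlim3 := hlim2.norm
  rw [norm_one] at hlim3
  refine hlim3.congr fun n => ?_
  have h2 : ∫ x : UnitAddCircle, e (r * ergodicSum α G (N n) x) =
      e (N n * β) * ∫ x, e (ψ (x + N n • (α : UnitAddCircle))) * (e (ψ x))⁻¹ := by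
    rw [← integral_const_mul]
    refine integral_congr_ae ?_
    filter_upwards [ae_ergodicSum_eq_of_cohomologous h (N n)] with x hx
    rw [← mul_assoc, ← hx, mul_inv_cancel_right₀ (e_ne_zero _)]
  rw [h2, norm_mul, norm_e, one_mul]

lemma circleCos_eq_nsmul (k : ℕ) (x : UnitAddCircle) : circleCos k x = circleCos 1 ((k : ℤ) • x) := by
  simp [circleCos, fourier_apply]

/-- Multiplication by k preserves Lebesgue measure on the circle, so the limit value does not depend
on the frequency q_n. -/
lemma integral_e_circleCos {k : ℕ} (hk : 0 < k) (s : ℝ) :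
    ∫ x, e (s * circleCos k x) = ∫ x, e (s * circleCos 1 x) := by
  have h1 : MeasurePreserving (fun x : UnitAddCircle => (k : ℤ) • x) volume volume :=
    Measure.measurePreserving_zsmul volume (by exact_mod_cast hk.ne')
  have hc : Continuous fun x => e (s * circleCos 1 x) :=
    continuous_e.comp ((continuous_circleCos 1).const_mul s)
  conv_rhs => rw [← h1.map_eq, integral_map h1.measurable.aemeasurable hc.aestronglyMeasurable]
  simp only [circleCos_eq_nsmul k]

/-- Equality in |∫ F| ≤ ∫ |F| would make e(s cos 2πx) constant, but its values at x = 0 and x = 1/4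
are e(s) and 1, and s = ±1/4 is not an integer. -/
lemma norm_integral_e_circleCos_ne_one {s : ℝ} (hs : |s| = 1 / 4) :
    ‖∫ x, e (s * circleCos 1 x)‖ ≠ 1 := by
  intro h
  set J := ∫ x, e (s * circleCos 1 x) with hJ
  have hc : Continuous fun x => e (s * circleCos 1 x) :=
    continuous_e.comp ((continuous_circleCos 1).const_mul s)
  have hint : Integrable (fun x => e (s * circleCos 1 x)) (volume : Measure UnitAddCircle) :=
    hc.integrable_of_hasCompactSupport (HasCompactSupport.of_compactSpace _)
  set F : UnitAddCircle → ℝ := fun x => 1 - (starRingEnd ℂ J * e (s * circleCos 1 x)).re with hF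
  have hFc : Continuous F := by
    simp only [hF]; fun_prop
  have hF0 : ∀ x, 0 ≤ F x := fun x => by
    have h1 := (Complex.re_le_norm (starRingEnd ℂ J * e (s * circleCos 1 x)))
    rw [norm_mul, RCLike.norm_conj, h, norm_e, one_mul] at h1
    simp only [hF]; linarith
  have hFint : ∫ x, F x = 0 := by
    simp only [hF]
    have hre : Integrable (fun x => (starRingEnd ℂ J * e (s * circleCos 1 x)).re)
      (volume : Measure UnitAddCircle) := (hint.const_mul _).re
    rw [integral_sub (integrable_const _) hre, integral_const, probReal_univ,
      one_smul]
    have h2 : ∫ x, (starRingEnd ℂ J * e (s * circleCos 1 x)).re =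
        (∫ x, starRingEnd ℂ J * e (s * circleCos 1 x)).re := integral_re (hint.const_mul _)
    rw [h2, integral_const_mul, ← hJ, Complex.conj_mul', h]
    simp
  have hFzero : F = 0 := by
    have h1 := (integral_eq_zero_iff_of_nonneg hF0
      (hFc.integrable_of_hasCompactSupport (HasCompactSupport.of_compactSpace _))).1 hFint
    exact (hFc.ae_eq_iff_eq volume continuous_zero).1 h1
  have hval : ∀ x, e (s * circleCos 1 x) = J := fun x => by
    have h1 : (starRingEnd ℂ J * e (s * circleCos 1 x)).re = 1 := by
      have := congrFun hFzero x
      simp only [hF, Pi.zero_apply] at this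
      linarith
    have h2 : ‖starRingEnd ℂ J * e (s * circleCos 1 x)‖ = 1 := by
      rw [norm_mul, RCLike.norm_conj, h, norm_e, one_mul]
    have h3 : starRingEnd ℂ J * e (s * circleCos 1 x) = 1 := by
      have h4 := Complex.sq_norm (starRingEnd ℂ J * e (s * circleCos 1 x))
      rw [h2, Complex.normSq_apply, h1] at h4
      refine Complex.ext (by rw [h1, Complex.one_re]) ?_
      rw [Complex.one_im]
      nlinarith
    have h5 : J * starRingEnd ℂ J = 1 := by rw [Complex.mul_conj', h]; simp
    calc _ = J * starRingEnd ℂ J * e (s * circleCos 1 x) := by rw [h5, one_mul]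
      _ = J := by rw [mul_assoc, h3, mul_one]
  have h1 : circleCos 1 ((0 : ℝ) : UnitAddCircle) = 1 := by rw [circleCos_coe]; simp
  have h2 : circleCos 1 ((1 / 4 : ℝ) : UnitAddCircle) = 0 := by
    rw [circleCos_coe, ← Real.cos_pi_div_two]; congr 1; push_cast; ring
  have h3 := (hval ((0 : ℝ) : UnitAddCircle)).trans (hval ((1 / 4 : ℝ) : UnitAddCircle)).symm
  rw [h1, h2, mul_one, mul_zero, e_eq_e_iff, ← sub_eq_zero, ← AddCircle.coe_sub, sub_zero,
    AddCircle.coe_eq_zero_iff] at h3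
  obtain ⟨n, hn⟩ := h3
  rw [zsmul_eq_mul, mul_one] at hn
  rw [← hn] at hs
  have h4 : (4 * |n| : ℤ) = 1 := by
    have : (4 * |(n : ℝ)|) = 1 := by linarith
    exact_mod_cast this
  omega

end CohomologicalEquation

/-! ### The roof series admits no solution of the cohomological equation. -/

section NoSolution

variable {α : ℝ}

/-- The times `⌊c q_{n+1}^{9/10}⌋ q_n`. -/
noncomputable def rigidTime (α c : ℝ) (n : ℕ) : ℕ :=
  ⌊c * (convDen α (n + 1) : ℝ) ^ (9 / 10 : ℝ)⌋₊ * convDen α n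

lemma tendsto_rigidTime_nsmul (hα : Irrational α) {c : ℝ} (hc : 0 ≤ c) :
    Tendsto (fun n => rigidTime α c n • (α : UnitAddCircle)) atTop (𝓝 0) := by
  have h1 : Tendsto (fun n : ℕ => c * (convDen α (n + 1) : ℝ) ^ (-(1 / 10) : ℝ)) atTop (𝓝 0) := by
    simpa using ((tendsto_rpow_neg_atTop (by norm_num : (0 : ℝ) < 1 / 10)).comp
      (tendsto_natCast_atTop_atTop.comp ((tendsto_convDen hα).comp (tendsto_add_atTop_nat 1)))
      ).const_mul c
  refine squeeze_zero_norm (fun n => ?_) h1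
  have hQ : (0 : ℝ) < convDen α (n + 1) := by exact_mod_cast convDen_pos α (n + 1)
  rw [rigidTime, mul_nsmul']
  refine norm_nsmul_le.trans ?_
  calc _ ≤ (c * (convDen α (n + 1) : ℝ) ^ (9 / 10 : ℝ)) * (1 / convDen α (n + 1)) := by
        gcongr
        · exact Nat.floor_le (by positivity)
        · exact norm_convDen_nsmul_le hα n
    _ = c * ((convDen α (n + 1) : ℝ) ^ (9 / 10 : ℝ) * (convDen α (n + 1) : ℝ) ^ (-1 : ℝ)) := by
        rw [Real.rpow_neg_one]; ring
    _ = _ := by rw [← Real.rpow_add hQ]; norm_num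

lemma abs_ergodicSum_circleCos_sub_le (hα : Irrational α) (n N : ℕ) (x : UnitAddCircle) :
    |ergodicSum α (circleCos (convDen α n)) N x - N * circleCos (convDen α n) x| ≤
      N * (8 * (N / convDen α (n + 1))) := by
  have hterm : ∀ i < N, |circleCos (convDen α n) (x + i • (α : UnitAddCircle)) -
      circleCos (convDen α n) x| ≤ 8 * (N / convDen α (n + 1)) := fun i hi => by
    rw [circleCos, circleCos, ← Complex.sub_re, fourier_add_nsmul]
    refine (Complex.abs_re_le_norm _).trans ?_
    rw [← mul_sub_one, norm_mul, fourier_apply, Circle.norm_coe, one_mul,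
      fourier_convDen_eq, e_pow]
    refine (norm_e_sub_one_le _).trans ?_
    rw [abs_mul, Nat.abs_cast]
    calc _ ≤ 2 * 4 * ((N : ℝ) * (1 / convDen α (n + 1))) := by
          gcongr
          · exact Real.pi_le_four
          · exact abs_convDen_mul_sub_le hα n
      _ = _ := by ring
  have h : ergodicSum α (circleCos (convDen α n)) N x - N * circleCos (convDen α n) x =
      ∑ i ∈ Finset.range N, (circleCos (convDen α n) (x + i • (α : UnitAddCircle)) -
        circleCos (convDen α n) x) := by
    rw [Finset.sum_sub_distrib]; simp [ergodicSum]
  rw [h]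
  refine (Finset.abs_sum_le_sum_abs _ _).trans ((Finset.sum_le_sum fun i hi =>
    hterm i (Finset.mem_range.1 hi)).trans (by simp))

/-- Along the times `rigidTime`, the ergodic sums of the roof series are close to a cosine. -/
lemma abs_ergodicSum_rigidTime_sub_le (hα : Irrational α) {c : ℝ} (hc : 0 ≤ c) {n : ℕ} (hn : 1 ≤ n)
    (hgap : convDen α n ^ 20 ≤ convDen α (n + 1)) (x : UnitAddCircle) :
    |ergodicSum α (roofSeries α) (rigidTime α c n) x - c * circleCos (convDen α n) x| ≤
      (8 * c + 8 * c ^ 2 + 1) * (((n + 1 : ℕ) : ℝ) * (convDen α (n + 1) : ℝ) ^ (-(1 / 20) : ℝ)) := by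
  set q : ℝ := (convDen α n : ℝ) with hq
  set Q : ℝ := (convDen α (n + 1) : ℝ) with hQ
  set m := ⌊c * Q ^ (9 / 10 : ℝ)⌋₊ with hm
  set a := roofCoeff α n with ha
  set G : UnitAddCircle → ℝ := fun x => roofSeries α x - a * circleCos (convDen α n) x with hG
  have hq1 : 1 ≤ q := by rw [hq]; exact_mod_cast convDen_pos α n
  have hQ1 : 1 ≤ Q := by rw [hQ]; exact_mod_cast convDen_pos α (n + 1)
  have hQ0 : 0 < Q := by linarith
  have ha0 : 0 < a := roofCoeff_pos α n
  set y := Q ^ (1 / 20 : ℝ) with hy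
  have hy0 : 0 < y := by positivity
  -- The gap q^{20} ≤ Q lets Q^{1/20} replace q. The non-resonant terms and the drift of the
  -- resonant cosine are then O(nQ^{9/10} · Q^{1/20}/Q), and the rounding in `m` costs at most
  -- Q^{-9/10}; all of this is O(nQ^{-1/20}).
  have hqy : q ≤ y := by
    have h1 : q ^ (20 : ℝ) ≤ Q := by
      rw [hq, hQ, show (20 : ℝ) = (20 : ℕ) by norm_num, Real.rpow_natCast]; exact_mod_cast hgap
    calc q = (q ^ (20 : ℝ)) ^ (1 / 20 : ℝ) := by rw [← Real.rpow_mul (by linarith)]; norm_num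
      _ ≤ y := by rw [hy]; gcongr
  have hmle : (m : ℝ) ≤ c * Q ^ (9 / 10 : ℝ) := Nat.floor_le (by positivity)
  have hmlt : c * Q ^ (9 / 10 : ℝ) < m + 1 := Nat.lt_floor_add_one _
  have hQ9 : Q ^ (9 / 10 : ℝ) * Q ^ (-(9 / 10) : ℝ) = 1 := by rw [← Real.rpow_add hQ0]; norm_num
  have hP0 : 0 < Q ^ (-(9 / 10) : ℝ) := by positivity
  have hP1 : Q ^ (-(9 / 10) : ℝ) ≤ 1 := Real.rpow_le_one_of_one_le_of_nonpos hQ1 (by norm_num)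
  have hyQ : Q ^ (9 / 10 : ℝ) * (y / Q) = Q ^ (-(1 / 20) : ℝ) := by
    rw [div_eq_mul_inv y Q, hy, ← Real.rpow_neg_one Q, ← Real.rpow_add hQ0, ← Real.rpow_add hQ0]
    norm_num
  set δ := Q ^ (-(1 / 20) : ℝ) with hδ
  have hδ0 : 0 < δ := by positivity
  have hNcast : ((rigidTime α c n : ℕ) : ℝ) = m * q := by rw [rigidTime]; push_cast; rfl
  have haN : a * (m * q) = m * Q ^ (-(9 / 10) : ℝ) := by
    rw [ha, roofCoeff, ← hq, ← hQ]; field_simp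
  have haNc : a * (m * q) ≤ c := by
    rw [haN]
    calc (m : ℝ) * Q ^ (-(9 / 10) : ℝ) ≤ c * Q ^ (9 / 10 : ℝ) * Q ^ (-(9 / 10) : ℝ) := by gcongr
      _ = c := by rw [mul_assoc, hQ9, mul_one]
  have hlin : ∀ N x, ergodicSum α G N x = ergodicSum α (roofSeries α) N x -
      a * ergodicSum α (circleCos (convDen α n)) N x := fun N x => by
    simp only [ergodicSum, hG, Finset.sum_sub_distrib, Finset.mul_sum]
  -- the terms other than the `n`-th
  have h1 : |ergodicSum α G (rigidTime α c n) x| ≤ 4 * c * (n + 2) * δ := by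
    have hE : roofError α n ≤ (4 * n + 8) * (y / Q) := by
      have h2 : q ^ (1 / 10 : ℝ) ≤ y := by
        refine le_trans ?_ hqy
        calc q ^ (1 / 10 : ℝ) ≤ q ^ (1 : ℝ) :=
              Real.rpow_le_rpow_of_exponent_le hq1 (by norm_num)
          _ = q := Real.rpow_one q
      calc roofError α n = 4 * n * (q ^ (1 / 10 : ℝ) / Q) + 8 * (q / Q) * Q ^ (-(9 / 10) : ℝ) := by
            rw [roofError]; ring
        _ ≤ 4 * n * (y / Q) + 8 * (y / Q) * 1 := by gcongr
        _ = _ := by ring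
    have h3 := abs_ergodicSum_mul_le (α := α) (φ := G) (q := convDen α n) (B := roofError α n)
      (fun x => by rw [hlin]; exact abs_ergodicSum_roofSeries_sub_le hα hn x) m x
    refine h3.trans ?_
    calc (m : ℝ) * roofError α n ≤ (c * Q ^ (9 / 10 : ℝ)) * ((4 * n + 8) * (y / Q)) := by
          have : 0 ≤ roofError α n := (abs_nonneg _).trans (abs_ergodicSum_roofSeries_sub_le hα hn x)
          gcongr
      _ = c * (4 * n + 8) * (Q ^ (9 / 10 : ℝ) * (y / Q)) := by ring
      _ = _ := by rw [hyQ]; ring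
  -- the `n`-th term
  have h2 : |a * (ergodicSum α (circleCos (convDen α n)) (rigidTime α c n) x -
      (rigidTime α c n : ℕ) * circleCos (convDen α n) x)| ≤ 8 * c ^ 2 * δ := by
    rw [abs_mul, abs_of_pos ha0]
    calc _ ≤ a * ((m * q) * (8 * (m * q / Q))) := by
          gcongr
          have := abs_ergodicSum_circleCos_sub_le hα n (rigidTime α c n) x
          rwa [hNcast] at this ⊢
      _ = a * (m * q) * (8 * (m * (q / Q))) := by ring
      _ ≤ c * (8 * ((c * Q ^ (9 / 10 : ℝ)) * (y / Q))) := by gcongr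
      _ = 8 * c ^ 2 * (Q ^ (9 / 10 : ℝ) * (y / Q)) := by ring
      _ = _ := by rw [hyQ]
  have h3 : |(a * (m * q) - c) * circleCos (convDen α n) x| ≤ δ := by
    rw [abs_mul]
    have h4 : |a * (m * q) - c| ≤ Q ^ (-(9 / 10) : ℝ) := by
      have h5 : c ≤ (m + 1) * Q ^ (-(9 / 10) : ℝ) := by
        calc c = c * Q ^ (9 / 10 : ℝ) * Q ^ (-(9 / 10) : ℝ) := by rw [mul_assoc, hQ9, mul_one]
          _ ≤ _ := by gcongr
      rw [abs_le]
      constructor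
      · rw [haN]; linarith
      · linarith
    calc _ ≤ Q ^ (-(9 / 10) : ℝ) * 1 := by gcongr; exact abs_circleCos_le _ x
      _ ≤ δ := by
        rw [mul_one]
        exact Real.rpow_le_rpow_of_exponent_le hQ1 (by norm_num)
  have hdecomp : ergodicSum α (roofSeries α) (rigidTime α c n) x - c * circleCos (convDen α n) x =
      ergodicSum α G (rigidTime α c n) x +
      a * (ergodicSum α (circleCos (convDen α n)) (rigidTime α c n) x -
        (rigidTime α c n : ℕ) * circleCos (convDen α n) x) +
      (a * (m * q) - c) * circleCos (convDen α n) x := by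
    rw [hlin, hNcast]; ring
  rw [hdecomp]
  refine (abs_add_three _ _ _).trans ((add_le_add (add_le_add h1 h2) h3).trans ?_)
  have hn0 : (1 : ℝ) ≤ n := by exact_mod_cast hn
  push_cast
  calc 4 * c * (n + 2) * δ + 8 * c ^ 2 * δ + δ
      ≤ 4 * c * (2 * (n + 1)) * δ + 8 * c ^ 2 * (n + 1) * δ + (n + 1) * δ := by
        refine add_le_add (add_le_add ?_ ?_) ?_
        · gcongr; linarith
        · exact mul_le_mul_of_nonneg_right
            (le_mul_of_one_le_right (by positivity) (by linarith)) hδ0.le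
        · exact le_mul_of_one_le_left hδ0.le (by linarith)
    _ = _ := by ring

theorem roofSeries_no_solution (hα : Irrational α)
    (hgap : ∃ᶠ n : ℕ in atTop, convDen α n ^ 20 ≤ convDen α (n + 1)) {r : ℝ} (hr : r ≠ 0) (β : ℝ) :
    ¬ ∃ ψ : UnitAddCircle → ℝ, Measurable ψ ∧
      ∀ᵐ x : UnitAddCircle, ((r * roofSeries α x : ℝ) : UnitAddCircle) =
        ((ψ (x + (α : UnitAddCircle)) - ψ x + β : ℝ) : UnitAddCircle) := by
  rintro ⟨ψ, hψ, h⟩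
  -- This choice makes |rc| = 1/4, so that e(rc cos 2πx) is not constant.
  set c : ℝ := 1 / (4 * |r|) with hc
  have hr0 : 0 < |r| := abs_pos.2 hr
  have hc0 : 0 ≤ c := by positivity
  have hs : |r * c| = 1 / 4 := by
    rw [abs_mul, abs_of_nonneg hc0, hc]; field_simp
  -- The limit is taken along the indices with a large gap only; the filter is nontrivial because
  -- there are infinitely many.
  set l : Filter ℕ := atTop ⊓ 𝓟 {n | convDen α n ^ 20 ≤ convDen α (n + 1)} with hl
  have hne : l.NeBot := frequently_mem_iff_neBot.1 hgap
  have hlim1 := tendsto_norm_integral_of_cohomologous hψ h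
    ((tendsto_rigidTime_nsmul hα hc0).mono_left (inf_le_left : l ≤ atTop))
  have h0 : Tendsto (fun n : ℕ => 2 * Real.pi * (|r| * ((8 * c + 8 * c ^ 2 + 1) *
      (((n + 1 : ℕ) : ℝ) * (convDen α (n + 1) : ℝ) ^ (-(1 / 20) : ℝ))))) l (𝓝 0) := by
    have := (((tendsto_mul_convDen_rpow hα (by norm_num : (0 : ℝ) < 1 / 20)).comp
      (tendsto_add_atTop_nat 1)).const_mul (8 * c + 8 * c ^ 2 + 1)).const_mul |r|
    have := this.const_mul (2 * Real.pi)
    simp only [mul_zero] at this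
    exact this.mono_left inf_le_left
  have hcont := continuous_roofSeries hα
  have hint1 : ∀ N, Integrable (fun x => e (r * ergodicSum α (roofSeries α) N x))
      (volume : Measure UnitAddCircle) := fun N =>
    (continuous_e.comp ((continuous_ergodicSum hcont N).const_mul r)
      ).integrable_of_hasCompactSupport (HasCompactSupport.of_compactSpace _)
  have hint2 : ∀ k, Integrable (fun x => e (r * c * circleCos k x))
      (volume : Measure UnitAddCircle) := fun k =>
    (continuous_e.comp ((continuous_circleCos k).const_mul (r * c))
      ).integrable_of_hasCompactSupport (HasCompactSupport.of_compactSpace _)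
  have hlim2 : Tendsto (fun n => (∫ x : UnitAddCircle,
      e (r * ergodicSum α (roofSeries α) (rigidTime α c n) x)) -
      ∫ x, e (r * c * circleCos 1 x)) l (𝓝 0) := by
    refine squeeze_zero_norm' ?_ h0
    filter_upwards [(eventually_ge_atTop 1).filter_mono inf_le_left,
      (mem_principal_self _ : _ ∈ 𝓟 {n | convDen α n ^ 20 ≤ convDen α (n + 1)}) |>
        (mem_inf_of_right ·)] with n hn hgap
    rw [← integral_e_circleCos (convDen_pos α n), ← integral_sub (hint1 _) (hint2 _)]
    have hb : ∀ x, ‖e (r * ergodicSum α (roofSeries α) (rigidTime α c n) x) -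
        e (r * c * circleCos (convDen α n) x)‖ ≤ 2 * Real.pi * (|r| * ((8 * c + 8 * c ^ 2 + 1) *
      (((n + 1 : ℕ) : ℝ) * (convDen α (n + 1) : ℝ) ^ (-(1 / 20) : ℝ)))) := fun x => by
      refine (norm_e_sub_e_le _ _).trans ?_
      rw [mul_assoc r, ← mul_sub, abs_mul]
      gcongr
      exact abs_ergodicSum_rigidTime_sub_le hα hc0 hn hgap x
    have := norm_integral_le_of_norm_le_const (μ := (volume : Measure UnitAddCircle))
      (.of_forall hb)
    rwa [probReal_univ, mul_one] at this
  have hlim3 := (hlim2.add_const (∫ x, e (r * c * circleCos 1 x))).norm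
  simp only [sub_add_cancel, zero_add] at hlim3
  exact norm_integral_e_circleCos_ne_one hs (tendsto_nhds_unique hlim3 hlim1)

end NoSolution

section Existence

theorem exists_goodRoof : ∃ (α : ℝ) (a : ℕ → ℝ) (g : C(UnitAddCircle, ℝ)), Irrational α ∧
    (a =o[atTop] fun n : ℕ => 1 / ((convDen α n : ℝ) * (convDen α (n + 1) : ℝ) ^ (4 / 5 : ℝ))) ∧
    (∃ᶠ n : ℕ in atTop,
      1 / ((convDen α n : ℝ) ^ (4 / 5 : ℝ) * (convDen α (n + 1) : ℝ)) ≤ |a n|) ∧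
    (∀ x : ℝ, HasSum (fun k : ℕ => a (k + 1) *
      Real.cos (2 * Real.pi * (convDen α (k + 1) : ℝ) * x)) (g (x : UnitAddCircle))) ∧
    GoodRoof α g := by
  have hL : Liouville (liouvilleNumber (2 : ℕ)) := liouville_liouvilleNumber le_rfl
  set α : ℝ := liouvilleNumber (2 : ℕ) with hα'
  have hα : Irrational α := hL.irrational
  have hgap := frequently_pow_convDen_le hL
  refine ⟨α, roofCoeff α, ⟨roofSeries α, continuous_roofSeries hα⟩, hα, isLittleO_roofCoeff hα,
    hgap.mono fun n hn => (le_roofCoeff hn).trans (le_abs_self _), fun x => ?_, ?_, ?_⟩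
  · have := hasSum_roofSeries hα (x : UnitAddCircle)
    simp only [circleCos_coe] at this
    exact this
  · exact isLittleO_iSup_ergodicSum_roofSeries hα
  · exact fun r hr β => roofSeries_no_solution hα hgap hr β

end Existence

end SpecialFlow

theorem mainTheorem5 :
    (∀ (α : ℝ) (g : C(UnitAddCircle, ℝ)) (C : ℝ), Irrational α → SpecialFlow.GoodRoof α g →
      -(⨅ x : UnitAddCircle, g x) < C →
        SpecialFlow.WeaklyMixing (SpecialFlow.flow α (fun x => g x + C) C)
          (SpecialFlow.lebesgue α (fun x => g x + C)) ∧
        SpecialFlow.UniquelyErgodic (SpecialFlow.flow α (fun x => g x + C) C) ∧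
        ∀ z : SpecialFlow.Space α (fun x => g x + C),
          SpecialFlow.SquareOrbitEquidistributed (SpecialFlow.flow α (fun x => g x + C) C)
            (SpecialFlow.lebesgue α (fun x => g x + C)) z) ∧
    (∃ (α : ℝ) (a : ℕ → ℝ) (g : C(UnitAddCircle, ℝ)), Irrational α ∧
      (a =o[atTop] fun n : ℕ => 1 / ((SpecialFlow.convDen α n : ℝ) *
        (SpecialFlow.convDen α (n + 1) : ℝ) ^ (4 / 5 : ℝ))) ∧
      (∃ᶠ n : ℕ in atTop, 1 / ((SpecialFlow.convDen α n : ℝ) ^ (4 / 5 : ℝ) *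
        (SpecialFlow.convDen α (n + 1) : ℝ)) ≤ |a n|) ∧
      (∀ x : ℝ, HasSum (fun k : ℕ => a (k + 1) *
        Real.cos (2 * Real.pi * (SpecialFlow.convDen α (k + 1) : ℝ) * x))
          (g (x : UnitAddCircle))) ∧
      SpecialFlow.GoodRoof α g) := by
  refine ⟨fun α g C hα hg hC => ?_, SpecialFlow.exists_goodRoof⟩
  have hpos := SpecialFlow.roof_pos hC
  have hC0 := hg.height_pos hC
  exact ⟨SpecialFlow.weaklyMixing_flow hα hg rfl hpos hC0,
    SpecialFlow.uniquelyErgodic_flow hα hg rfl hpos hC0,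
    fun z => SpecialFlow.squareOrbitEquidistributed_flow hα hg rfl hpos hC0 z⟩
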